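/- **Left $\mathcal B_-(\cdot|\beta)$-SOV representation.** *Setting.* Let $\operatorname{Im}\omega>0$, $q=e^{i\pi\omega}$, and let $\theta_j(x|\tau)$ be the Jacobi theta functions with nome $e^{i\pi\tau}$ and quasi-periods $\pi,\pi\tau$; put $\theta(x)=\theta_1(x|\omega)$ and $\Lambda=\pi\mathbb Z+\pi\omega\mathbb Z$. Let $\eta,\alpha,\beta,\zeta,\kappa,\tau\in\mathbb C$ with $\theta_1(\zeta|2\omega)\ne0$, and $\xi_1,\dots,\xi_N\in\mathbb C$. $R(\lambda)$ is the 8-vertex matrix with non-zero entries $\mathrm a$ (positions 11, 44), $\mathrm b$ (22, 33), $\mathrm c$ (23, 32), $\mathrm d$ (14, 41), where, with $C=2/(\theta_2(0|\omega)\theta_4(0|2\omega))$ and $\theta_j(\cdot)$ of modulus $2\omega$ on the right, $\mathrm a=C\theta_4(\eta)\theta_1(\lambda+\eta)\theta_4(\lambda)$, $\mathrm b=C\theta_4(\eta)\theta_1(\lambda)\theta_4(\lambda+\eta)$, $\mathrm c=C\theta_1(\eta)\theta_4(\lambda)\theta_4(\lambda+\eta)$, $\mathrm d=C\theta_1(\eta)\theta_1(\lambda+\eta)\theta_1(\lambda)$.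 On $\mathbb C^2\otimes(\mathbb C^2)^{\otimes N}$ let $M(\lambda)=R_{0N}(\lambda-\xi_N-\eta/2)\cdots R_{01}(\lambda-\xi_1-\eta/2)$, $\hat M(\lambda)=(-1)^N\sigma^y_0M(-\lambda)^{t_0}\sigma^y_0$ and $\mathcal U_-(\lambda)=M(\lambda)K(\lambda-\eta/2)\hat M(\lambda)$, where (all theta functions of modulus $2\omega$) $$K(x)=\begin{pmatrix}\frac{\theta_4(\zeta)\theta_4(\zeta-x)\theta_1(\zeta+x)}{\theta_1(\zeta)}&\kappa e^{\tau}k(x)\,(\theta_4^2(x)-e^{-2\tau}\theta_1^2(x))\\ \kappa e^{-\tau}k(x)\,(\theta_4^2(x)-e^{2\tau}\theta_1^2(x))&\frac{\theta_4(\zeta)\theta_1(\zeta-x)\theta_4(\zeta+x)}{\theta_1(\zeta)}\end{pmatrix},\quad k(x)=\frac{\theta_1(2x)\theta_4^3(\zeta)}{\theta_1(\zeta)\theta_4^2(0)\theta_4(2x)} .$$ Put $X_b(x)=(\theta_2,\theta_3)^t(x+(\alpha+b)\eta|2\omega)$, $Y_b(x)=(\theta_2,\theta_3)^t(x+(\alpha-b)\eta|2\omega)$,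 $\tilde Y_b(x)=\dfrac{(-\theta_3,\theta_2)(x+(\alpha-b)\eta|2\omega)}{\theta(x+(\alpha+1)\eta)\,\theta((b+1)\eta)}$, $r(\lambda)=\theta_4(2\lambda-\eta|2\omega)\theta(\lambda+(\alpha+\tfrac12)\eta)$, and define, as entire functions of $\lambda$, $\mathcal A_-(\lambda|b)=r(\lambda)\tilde Y_{b-3}(\lambda-\tfrac\eta2)\,\mathcal U_-(\lambda)X_{b-1}(\tfrac\eta2-\lambda)$, $\mathcal B_-(\lambda|b)=r(\lambda)\tilde Y_{b-1}(\lambda-\tfrac\eta2)\,\mathcal U_-(\lambda)Y_{b-1}(\tfrac\eta2-\lambda)$, and the scalar $r(\lambda)K_-(\lambda|b)_{12}$ with $K_-(\lambda|b)_{12}=\tilde Y_{b+N-1}(\lambda-\tfrac\eta2)K(\lambda-\tfrac\eta2)Y_{b+N-1}(\tfrac\eta2-\lambda)$. Let $\rho_1,\rho_2$ be even functions with $\rho_1(y)^2=\theta_1(\zeta+y)\theta_4(\zeta+y)\theta_1(\zeta-y)\theta_4(\zeta-y)$ and $\rho_2(y)^2=(\theta_4^2(y)-e^{2\tau}\theta_1^2(y))(\theta_4^2(y)-e^{-2\tau}\theta_1^2(y))$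 (modulus $2\omega$), $g_-(\tfrac\eta2+y)=\frac{\theta_4(\zeta|2\omega)}{\theta_1(\zeta|2\omega)}\rho_1(y)+\kappa k(y)\rho_2(y)$, $a(\lambda)=\prod_n\theta(\lambda-\xi_n+\tfrac\eta2)$ and $\mathsf A_-(\lambda)=r(\lambda)g_-(\lambda)a(\lambda)a(-\lambda-\eta)$. Let $\mathsf n$ be a function with $\mathsf n_\beta,\mathsf n_{\beta+2}\neq0$. For $\mathbf h\in\{0,1\}^N$ put $a_{\mathbf h}(\lambda)=\prod_n\theta(\lambda-\xi_n-(h_n-\tfrac12)\eta)$ and $$\langle b|=2^N\prod_{n=1}^N\theta((N-n+b+1)\eta)\bigotimes_{n=1}^N\tilde Y_{b+N-n}(\xi_n),\qquad \langle b,\mathbf h|=\frac1{\mathsf n_{b+2}}\langle b|\prod_{n=1}^N\Big(\frac{\mathcal A_-(\eta/2-\xi_n|b+2)}{\mathsf A_-(\eta/2-\xi_n)}\Big)^{h_n}.$$ *Assumptions.* (i) $\xi_a-\xi_b\notin r\eta+\Lambda$ for $a\neq b$, and $\xi_a+\xi_b\notin r\eta+\Lambda$ for all $a,b$, $r\in\{-1,0,1\}$;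 $2\xi_a\notin\pm2\eta+\Lambda$. (ii) $\mathsf A_-(\eta/2\pm\xi_n)\ne0$ for all $n$. (iii) $(\beta+k)\eta\notin\Lambda$ for all $k\in\mathbb Z$, and $\theta_1(2\beta\eta|2\omega)\neq0$. (iv) for $k=0,\dots,N-1$ the function $\lambda\mapsto r(\lambda)K_-(\lambda|\beta-2k)_{12}$ is not identically zero. *Conclusions.* 1. The $2^N$ covectors $\langle\beta,\mathbf h|$ form a basis, and for all $\lambda,\mathbf h$: $\langle\beta,\mathbf h|\mathcal B_-(\lambda|\beta)=\mathsf b_{\beta,\mathbf h}(\lambda)\langle\beta-2,\mathbf h|$ with $$\mathsf b_{\beta,\mathbf h}(\lambda)=\frac{\mathsf n_\beta}{\mathsf n_{\beta+2}}(-1)^N\frac{\theta((N+\beta)\eta)}{\theta(\beta\eta)}\,r(\lambda)K_-(\lambda|\beta)_{12}\,a_{\mathbf h}(\lambda)a_{\mathbf h}(-\lambda).$$ 2. For every $b$, $\mathcal B_-(\cdot|b)$ and $\mathcal A_-(\cdot|b)$ are elliptic polynomials of order $4N+8$: they are entire, $\pi$-periodic, and $\mathcal B_-(\lambda+2\pi\omega|b)=(-e^{-2i\lambda}/q^2)^{4N+8}e^{8i\eta}\mathcal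 B_-(\lambda|b)$, $\mathcal A_-(\lambda+2\pi\omega|b)=(-e^{-2i\lambda}/q^2)^{4N+8}e^{4ib\eta}\mathcal A_-(\lambda|b)$. 3. Let $\zeta_{-1}=\frac\eta2$, $\zeta_{-2}=\frac{\eta-\pi}2$, $\zeta_{-3}=\frac{\eta-\pi\omega}2$, $\zeta_{-4}=\frac{\eta-\pi-\pi\omega}2$, $\zeta_{-a-4}=\zeta_{-a}+\pi\omega$, and $\zeta_a=\varphi_a(\xi_a+(h_a-\tfrac12)\eta)$ for $a=1,\dots,2N$, where $\xi_{N+n}=\xi_n$, $h_{N+n}=h_n$, $\varphi_a=1$ for $a\le N$ and $-1$ for $a>N$. If $\mathcal A_-^{(0)}(\lambda|\beta+2)$ is the operator with $$\langle\beta,\mathbf h|\mathcal A^{(0)}_-(\lambda|\beta+2)=\sum_{a=1}^8\frac{\theta_1(2(\beta+2)\eta-\lambda-\sum_{b\ne a}\zeta_{-b}|2\omega)}{\theta_1(2(\beta+2)\eta-\sum_{b}\zeta_{-b}|2\omega)}\frac{a_{\mathbf h}(\lambda)a_{\mathbf h}(-\lambda)}{a_{\mathbf h}(\zeta_{-a})a_{\mathbf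 h}(-\zeta_{-a})}\prod_{b\ne a}\frac{\theta_1(\lambda-\zeta_{-b}|2\omega)}{\theta_1(\zeta_{-a}-\zeta_{-b}|2\omega)}\langle\beta,\mathbf h|\mathcal A_-(\zeta_{-a}|\beta+2),$$ then $\widetilde{\mathcal A}_-=\mathcal A_--\mathcal A_-^{(0)}$ acts by $$\langle\beta,\mathbf h|\widetilde{\mathcal A}_-(\lambda|\beta+2)=\sum_{a=1}^{2N}\frac{\theta_4(2\lambda-\eta|2\omega)\theta_1(2\lambda-\eta|2\omega)\,\theta(\beta\eta+\zeta_a-\lambda)}{\theta_4(2\zeta_a-\eta|2\omega)\theta_1(2\zeta_a-\eta|2\omega)\,\theta(\beta\eta)}\,\frac{\theta(\lambda+\zeta_a)}{\theta(2\zeta_a)}\prod_{\substack{1\le b\le N\\ b\not\equiv a\,(N)}}\frac{\theta_4^2(\lambda)\theta_2^2(\zeta_b)-\theta_2^2(\lambda)\theta_4^2(\zeta_b)}{\theta_4^2(\zeta_a)\theta_2^2(\zeta_b)-\theta_2^2(\zeta_a)\theta_4^2(\zeta_b)}\;\mathsf A_-(\zeta_a)\,\langle\beta,\mathbf h|\mathrm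 T_a^{-\varphi_a},$$ where $\theta_2,\theta_4$ in the last product have modulus $\omega$, and $\mathrm T_a^{\pm}$ shifts $h_a$ (equivalently $h_n$ for $a=N+n$) by $\pm1$, a shift out of $\{0,1\}$ giving $0$. -/

import Mathlib

open Matrix

noncomputable section

namespace EightVertex

/-- Jacobi theta functions with quasi-periods `π` and `π τ`, nome `exp (i π τ)`:
`θ₁(x|τ) = 2 ∑ (-1)ⁿ q^((n+1/2)²) sin ((2n+1) x)`, and so on. -/
def th3 (x τ : ℂ) : ℂ := jacobiTheta₂ (x / Real.pi) τ

def th4 (x τ : ℂ) : ℂ := jacobiTheta₂ (x / Real.pi + 1 / 2) τ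

def th2 (x τ : ℂ) : ℂ :=
  Complex.exp (Complex.I * Real.pi * τ / 4 + Complex.I * x) * jacobiTheta₂ (x / Real.pi + τ / 2) τ

def th1 (x τ : ℂ) : ℂ :=
  -Complex.I * Complex.exp (Complex.I * Real.pi * τ / 4 + Complex.I * x) *
    jacobiTheta₂ (x / Real.pi + τ / 2 + 1 / 2) τ

/-- Operators on the `2^N`-dimensional space of the chain, in the spin basis. -/
abbrev Op (N : ℕ) := Matrix (Fin N → Fin 2) (Fin N → Fin 2) ℂ

/-- Parameters of the open inhomogeneous chain: elliptic parameter `ω`, crossing parameter `η`,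
gauge parameter `α`, left boundary parameters `ζ, κ, τ` and inhomogeneities `ξ`. -/
structure Chain (N : ℕ) where
  ω : ℂ
  η : ℂ
  α : ℂ
  ζ : ℂ
  κ : ℂ
  τ : ℂ
  ξ : Fin N → ℂ

namespace Chain

variable {N : ℕ} (c : Chain N)

/-- `θ(x) = θ₁(x|ω)`. -/
def θ (x : ℂ) : ℂ := th1 x c.ω

/-- Membership in the lattice `π ℤ + π ω ℤ`. -/
def InLattice (x : ℂ) : Prop := ∃ m n : ℤ, x = m * Real.pi + n * (Real.pi * c.ω)

/-! ### R-matrix and bulk monodromy -/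

def Rden : ℂ := th2 0 c.ω * th4 0 (2 * c.ω)

def Ra (x : ℂ) : ℂ :=
  2 * th4 c.η (2 * c.ω) * th1 (x + c.η) (2 * c.ω) * th4 x (2 * c.ω) / c.Rden

def Rb (x : ℂ) : ℂ :=
  2 * th4 c.η (2 * c.ω) * th1 x (2 * c.ω) * th4 (x + c.η) (2 * c.ω) / c.Rden

def Rc (x : ℂ) : ℂ :=
  2 * th1 c.η (2 * c.ω) * th4 x (2 * c.ω) * th4 (x + c.η) (2 * c.ω) / c.Rden

def Rd (x : ℂ) : ℂ :=
  2 * th1 c.η (2 * c.ω) * th1 (x + c.η) (2 * c.ω) * th1 x (2 * c.ω) / c.Rden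

/-- The 8-vertex R-matrix as a `2 × 2` block matrix over the auxiliary space; each block acts on
one quantum site. -/
def R (x : ℂ) : Matrix (Fin 2) (Fin 2) (Matrix (Fin 2) (Fin 2) ℂ) :=
  !![!![c.Ra x, 0; 0, c.Rb x], !![0, c.Rd x; c.Rc x, 0];
     !![0, c.Rc x; c.Rd x, 0], !![c.Rb x, 0; 0, c.Ra x]]

/-- A `2 × 2` matrix acting on site `n`. -/
def site (n : Fin N) (A : Matrix (Fin 2) (Fin 2) ℂ) : Op N :=
  fun h k => if ∀ m, m ≠ n → h m = k m then A (h n) (k n) else 0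

/-- `M(λ) = R_{0N}(λ - ξ_N - η/2) ⋯ R_{01}(λ - ξ_1 - η/2)`. -/
def M (x : ℂ) : Matrix (Fin 2) (Fin 2) (Op N) :=
  (List.ofFn fun n : Fin N => (c.R (x - c.ξ n - c.η / 2)).map (site n)).reverse.prod

/-- A scalar `2 × 2` matrix acting on the auxiliary space. -/
def aux (K : Matrix (Fin 2) (Fin 2) ℂ) : Matrix (Fin 2) (Fin 2) (Op N) :=
  K.map fun z => z • (1 : Op N)

def σy : Matrix (Fin 2) (Fin 2) ℂ := !![0, -Complex.I; Complex.I, 0]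

/-- `M̂(λ) = (-1)^N σ^y M(-λ)^{t₀} σ^y`. -/
def Mhat (x : ℂ) : Matrix (Fin 2) (Fin 2) (Op N) :=
  ((-1 : ℂ) ^ N) • (aux σy * (c.M (-x))ᵀ * aux σy)

/-! ### Boundary matrix -/

/-- The boundary matrix `K(x; ζ, κ, τ)`. -/
def K (x : ℂ) : Matrix (Fin 2) (Fin 2) ℂ :=
  let t1 := fun y => th1 y (2 * c.ω)
  let t4 := fun y => th4 y (2 * c.ω)
  !![t4 c.ζ * t4 (c.ζ - x) * t1 (x + c.ζ) / t1 c.ζ,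
     c.κ * Complex.exp c.τ * t1 (2 * x) * (t4 x ^ 2 - Complex.exp (-2 * c.τ) * t1 x ^ 2)
        * t4 c.ζ ^ 3 / (t1 c.ζ * t4 0 ^ 2 * t4 (2 * x));
     c.κ * Complex.exp (-c.τ) * t1 (2 * x) * (t4 x ^ 2 - Complex.exp (2 * c.τ) * t1 x ^ 2)
        * t4 c.ζ ^ 3 / (t1 c.ζ * t4 0 ^ 2 * t4 (2 * x)),
     t4 c.ζ * t1 (c.ζ - x) * t4 (x + c.ζ) / t1 c.ζ]

/-- The entire function `θ₄(2x|2ω) K(x)`. -/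
def Kreg (x : ℂ) : Matrix (Fin 2) (Fin 2) ℂ :=
  let t1 := fun y => th1 y (2 * c.ω)
  let t4 := fun y => th4 y (2 * c.ω)
  !![t4 (2 * x) * (t4 c.ζ * t4 (c.ζ - x) * t1 (x + c.ζ) / t1 c.ζ),
     c.κ * Complex.exp c.τ * t1 (2 * x) * (t4 x ^ 2 - Complex.exp (-2 * c.τ) * t1 x ^ 2)
        * t4 c.ζ ^ 3 / (t1 c.ζ * t4 0 ^ 2);
     c.κ * Complex.exp (-c.τ) * t1 (2 * x) * (t4 x ^ 2 - Complex.exp (2 * c.τ) * t1 x ^ 2)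
        * t4 c.ζ ^ 3 / (t1 c.ζ * t4 0 ^ 2),
     t4 (2 * x) * (t4 c.ζ * t1 (c.ζ - x) * t4 (x + c.ζ) / t1 c.ζ)]

theorem Kreg_eq (x : ℂ) (hx : th4 (2 * x) (2 * c.ω) ≠ 0) :
    c.Kreg x = th4 (2 * x) (2 * c.ω) • c.K x := by
  ext i j
  fin_cases i <;> fin_cases j <;> simp [Kreg, K] <;> field_simp

/-- `M(λ) K M̂(λ)` for a scalar matrix `K`; with `K = K_-(λ) = K(λ - η/2)` this is `𝒰_-(λ)`. -/
def dress (K : Matrix (Fin 2) (Fin 2) ℂ) (x : ℂ) : Matrix (Fin 2) (Fin 2) (Op N) :=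
  c.M x * aux K * c.Mhat x

/-- The boundary monodromy matrix `𝒰_-(λ)`. -/
def U (x : ℂ) : Matrix (Fin 2) (Fin 2) (Op N) := c.dress (c.K (x - c.η / 2)) x

/-! ### Gauge vectors -/

def X (b x : ℂ) : Fin 2 → ℂ :=
  ![th2 (x + (c.α + b) * c.η) (2 * c.ω), th3 (x + (c.α + b) * c.η) (2 * c.ω)]

def Y (b x : ℂ) : Fin 2 → ℂ :=
  ![th2 (x + (c.α - b) * c.η) (2 * c.ω), th3 (x + (c.α - b) * c.η) (2 * c.ω)]

/-- `θ(x + (α+1)η) Ỹ_b(x)`, entire in `x`. -/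
def Yreg (b x : ℂ) : Fin 2 → ℂ :=
  (c.θ ((b + 1) * c.η))⁻¹ •
    ![-th3 (x + (c.α - b) * c.η) (2 * c.ω), th2 (x + (c.α - b) * c.η) (2 * c.ω)]

/-- The covector `Ỹ_b(x)`. -/
def Yt (b x : ℂ) : Fin 2 → ℂ := (c.θ (x + (c.α + 1) * c.η))⁻¹ • c.Yreg b x

/-- `∑ l_i U_{ij} r_j`. -/
def sandwich (l : Fin 2 → ℂ) (V : Matrix (Fin 2) (Fin 2) (Op N)) (r : Fin 2 → ℂ) : Op N :=
  ∑ i, ∑ j, (l i * r j) • V i j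

/-! ### Gauge transformed boundary operators -/

/-- `r(λ) = θ₄(2λ-η|2ω) θ(λ + (α+1/2)η)`. -/
def r (x : ℂ) : ℂ := th4 (2 * x - c.η) (2 * c.ω) * c.θ (x + (c.α + 1 / 2) * c.η)

/-- Unrescaled operators `Ỹ_{b-3}(λ-η/2) 𝒰_-(λ) X_{b-1}(η/2-λ)` and
`Ỹ_{b-1}(λ-η/2) 𝒰_-(λ) Y_{b-1}(η/2-λ)`, meromorphic in `λ`. -/
def Ahat (x b : ℂ) : Op N :=
  sandwich (c.Yt (b - 3) (x - c.η / 2)) (c.U x) (c.X (b - 1) (c.η / 2 - x))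

def Bhat (x b : ℂ) : Op N :=
  sandwich (c.Yt (b - 1) (x - c.η / 2)) (c.U x) (c.Y (b - 1) (c.η / 2 - x))

/-- `𝒜_-(λ|b) = r(λ) Ahat(λ|b)`, with the poles of `Ahat` cancelled against the zeros of `r`
(see `A_eq`), so that it is an entire function of `λ`. -/
def A (x b : ℂ) : Op N :=
  sandwich (c.Yreg (b - 3) (x - c.η / 2)) (c.dress (c.Kreg (x - c.η / 2)) x)
    (c.X (b - 1) (c.η / 2 - x))

/-- `ℬ_-(λ|b) = r(λ) Bhat(λ|b)`, as an entire function of `λ`. -/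
def B (x b : ℂ) : Op N :=
  sandwich (c.Yreg (b - 1) (x - c.η / 2)) (c.dress (c.Kreg (x - c.η / 2)) x)
    (c.Y (b - 1) (c.η / 2 - x))

/-- `K_-(λ|b)_{12} = Ỹ_{b+N-1}(λ-η/2) K_-(λ) Y_{b+N-1}(η/2-λ)`. -/
def K12 (x b : ℂ) : ℂ :=
  c.Yt (b + N - 1) (x - c.η / 2) ⬝ᵥ (c.K (x - c.η / 2) *ᵥ c.Y (b + N - 1) (c.η / 2 - x))

/-- `r(λ) K_-(λ|b)_{12}` as an entire function of `λ` (see `rK12_eq`). -/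
def rK12 (x b : ℂ) : ℂ :=
  c.Yreg (b + N - 1) (x - c.η / 2) ⬝ᵥ
    (c.Kreg (x - c.η / 2) *ᵥ c.Y (b + N - 1) (c.η / 2 - x))

theorem dress_smul (z : ℂ) (K : Matrix (Fin 2) (Fin 2) ℂ) (x : ℂ) :
    c.dress (z • K) x = z • c.dress K x := by
  have : aux (N := N) (z • K) = z • aux K := by
    ext1 i j; simp [aux, smul_smul]
  simp [dress, this]

theorem sandwich_smul (y z : ℂ) (l : Fin 2 → ℂ) (V : Matrix (Fin 2) (Fin 2) (Op N))
    (r : Fin 2 → ℂ) : sandwich l (z • V) r = z • sandwich l V r ∧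
      sandwich (y • l) V r = y • sandwich l V r := by
  constructor <;> simp only [sandwich, Finset.smul_sum, Matrix.smul_apply, Pi.smul_apply, smul_smul,
    smul_eq_mul] <;> refine Finset.sum_congr rfl fun i _ => Finset.sum_congr rfl fun j _ => ?_ <;>
    congr 1 <;> ring

theorem reg_eq (b x : ℂ) (hx : c.r x ≠ 0) (v : Fin 2 → ℂ) :
    sandwich (c.Yreg b (x - c.η / 2)) (c.dress (c.Kreg (x - c.η / 2)) x) v =
      c.r x • sandwich (c.Yt b (x - c.η / 2)) (c.U x) v := by
  have h4 : th4 (2 * (x - c.η / 2)) (2 * c.ω) = th4 (2 * x - c.η) (2 * c.ω) := by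
    congr 1; ring
  have h1 : c.θ (x - c.η / 2 + (c.α + 1) * c.η) = c.θ (x + (c.α + 1 / 2) * c.η) := by
    congr 1; ring
  obtain ⟨ha, hb⟩ := mul_ne_zero_iff.mp hx
  rw [c.Kreg_eq _ (h4 ▸ ha), dress_smul, (sandwich_smul 1 _ _ _ _).1, Yt, U,
    (sandwich_smul _ 1 _ _ _).2, smul_smul, h1, h4, r, mul_assoc, mul_inv_cancel₀ hb, mul_one]

theorem A_eq (x b : ℂ) (hx : c.r x ≠ 0) : c.A x b = c.r x • c.Ahat x b := c.reg_eq _ x hx _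

theorem B_eq (x b : ℂ) (hx : c.r x ≠ 0) : c.B x b = c.r x • c.Bhat x b := c.reg_eq _ x hx _

theorem rK12_eq (x b : ℂ) (hx : c.r x ≠ 0) : c.rK12 x b = c.r x * c.K12 x b := by
  have h4 : th4 (2 * (x - c.η / 2)) (2 * c.ω) = th4 (2 * x - c.η) (2 * c.ω) := by
    congr 1; ring
  have h1 : c.θ (x - c.η / 2 + (c.α + 1) * c.η) = c.θ (x + (c.α + 1 / 2) * c.η) := by
    congr 1; ring
  obtain ⟨ha, hb⟩ := mul_ne_zero_iff.mp hx
  rw [rK12, K12, c.Kreg_eq _ (h4 ▸ ha), Yt, Matrix.smul_mulVec, dotProduct_smul, smul_dotProduct,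
    h1, h4, r, smul_eq_mul, smul_eq_mul, mul_assoc, mul_inv_cancel_left₀ hb]

/-- `P` is an elliptic polynomial of order `m` and characteristic `a` for the periods `π, 2πω`. -/
def IsEllipticPolynomial (m : ℕ) (a : ℂ) (P : ℂ → Op N) : Prop :=
  (∀ h k, Differentiable ℂ fun x => P x h k) ∧
  (∀ x, P (x + Real.pi) = ((-1 : ℂ) ^ m) • P x) ∧
  ∀ x, P (x + 2 * Real.pi * c.ω) =
    ((-Complex.exp (-2 * Complex.I * x) / Complex.exp (Complex.I * Real.pi * c.ω) ^ 2) ^ m *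
      Complex.exp (2 * Complex.I * a)) • P x

/-! ### The function `𝖠_-` -/

/-- `ρ₁, ρ₂` are even branches of the two square roots in `g_-`. -/
def IsRoots (ρ₁ ρ₂ : ℂ → ℂ) : Prop :=
  (∀ y, ρ₁ (-y) = ρ₁ y) ∧ (∀ y, ρ₂ (-y) = ρ₂ y) ∧
  (∀ y, ρ₁ y ^ 2 = th1 (c.ζ + y) (2 * c.ω) * th4 (c.ζ + y) (2 * c.ω) *
    (th1 (c.ζ - y) (2 * c.ω) * th4 (c.ζ - y) (2 * c.ω))) ∧
  ∀ y, ρ₂ y ^ 2 =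
    (th4 y (2 * c.ω) ^ 2 - Complex.exp (2 * c.τ) * th1 y (2 * c.ω) ^ 2) *
    (th4 y (2 * c.ω) ^ 2 - Complex.exp (-2 * c.τ) * th1 y (2 * c.ω) ^ 2)

/-- `g_-(λ)`, written with theta functions, `y = λ - η/2`. It satisfies
`g_-(η/2+y) g_-(η/2-y) = det K(y)`. -/
def g (ρ₁ ρ₂ : ℂ → ℂ) (x : ℂ) : ℂ :=
  let y := x - c.η / 2
  let t1 := fun y => th1 y (2 * c.ω)
  let t4 := fun y => th4 y (2 * c.ω)
  t4 c.ζ / t1 c.ζ * ρ₁ y +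
    c.κ * t1 (2 * y) * t4 c.ζ ^ 3 / (t1 c.ζ * t4 0 ^ 2 * t4 (2 * y)) * ρ₂ y

/-- `a(λ) = ∏ θ(λ - ξ_n + η/2)`; `d(λ) = a(λ - η)`. -/
def a (x : ℂ) : ℂ := ∏ n, c.θ (x - c.ξ n + c.η / 2)

/-- `𝖠_-(λ) = r(λ) g_-(λ) a(λ) d(-λ)`. -/
def As (ρ₁ ρ₂ : ℂ → ℂ) (x : ℂ) : ℂ := c.r x * c.g ρ₁ ρ₂ x * c.a x * c.a (-x - c.η)

/-! ### States -/

/-- The reference covector `⟨β| = N_β ⊗_n Ỹ_{β+N-n}(ξ_n)`, `N_β = 2^N ∏ θ((N-n+β+1)η)`; the site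
`n : Fin N` is the site number `n + 1`. -/
def ref (b : ℂ) : (Fin N → Fin 2) → ℂ := fun h =>
  (2 ^ N * ∏ n : Fin N, c.θ ((N - (n + 1) + b + 1) * c.η)) *
    ∏ n : Fin N, c.Yt (b + N - (n + 1)) (c.ξ n) (h n)

/-- `⟨β,h| = 𝗇_{β+2}⁻¹ ⟨β| ∏_n (𝒜_-(η/2-ξ_n|β+2)/𝖠_-(η/2-ξ_n))^{h_n}`, factors ordered from left
to right. -/
def state (ρ₁ ρ₂ : ℂ → ℂ) (nf : ℂ → ℂ) (b : ℂ) (h : Fin N → Fin 2) : (Fin N → Fin 2) → ℂ :=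
  (nf (b + 2))⁻¹ • (c.ref b ᵥ*
    (List.ofFn fun n : Fin N =>
      ((c.As ρ₁ ρ₂ (c.η / 2 - c.ξ n))⁻¹ • c.A (c.η / 2 - c.ξ n) (b + 2)) ^ (h n : ℕ)).prod)

/-- `a_h(λ) = ∏ θ(λ - ξ_n - (h_n - 1/2)η)`. -/
def ah (h : Fin N → Fin 2) (x : ℂ) : ℂ :=
  ∏ n, c.θ (x - c.ξ n - (((h n : ℕ) : ℂ) - 1 / 2) * c.η)

/-- The pseudo-eigenvalue `b_{β,h}(λ)`. -/
def eigB (nf : ℂ → ℂ) (b : ℂ) (h : Fin N → Fin 2) (x : ℂ) : ℂ :=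
  nf b / nf (b + 2) * (-1) ^ N * (c.θ ((N + b) * c.η) / c.θ (b * c.η)) * c.rK12 x b *
    c.ah h x * c.ah h (-x)

/-- The nodes `ζ_{-1}, …, ζ_{-8}`. -/
def node : Fin 8 → ℂ :=
  ![c.η / 2, (c.η - Real.pi) / 2, (c.η - Real.pi * c.ω) / 2,
    (c.η - Real.pi - Real.pi * c.ω) / 2,
    c.η / 2 + Real.pi * c.ω, (c.η - Real.pi) / 2 + Real.pi * c.ω,
    (c.η - Real.pi * c.ω) / 2 + Real.pi * c.ω,
    (c.η - Real.pi - Real.pi * c.ω) / 2 + Real.pi * c.ω]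

/-- The nodes `ζ_a^{(h_a)} = φ_a (ξ_a + (h_a - 1/2)η)`, `a = 1, …, 2N`: `true` is the half `a ≤ N`
with `φ_a = 1`, `false` the half `a > N` with `φ_a = -1`. -/
def zeta (h : Fin N → Fin 2) (n : Fin N) (s : Bool) : ℂ :=
  (if s then 1 else -1) * (c.ξ n + (((h n : ℕ) : ℂ) - 1 / 2) * c.η)

/-- `⟨β,h| T_a^{-φ_a}`: lowers `h_n` for `φ_a = 1`, raises it for `φ_a = -1`. A shift out of
`{0,1}` is set to zero; its coefficient `𝖠_-(ζ_a)` vanishes. -/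
def shifted (st : (Fin N → Fin 2) → (Fin N → Fin 2) → ℂ) (h : Fin N → Fin 2) (n : Fin N) (s : Bool) :
    (Fin N → Fin 2) → ℂ :=
  if s then (if h n = 1 then st (Function.update h n 0) else 0)
  else (if h n = 0 then st (Function.update h n 1) else 0)

/-- The covector `⟨β,h| 𝒜_-^{(0)}(λ|β+2)`, for `st = ⟨β,h|`. -/
def zeroPart (st : (Fin N → Fin 2) → ℂ) (b : ℂ) (h : Fin N → Fin 2) (x : ℂ) :
    (Fin N → Fin 2) → ℂ :=
  ∑ p : Fin 8,
    (th1 (2 * (b + 2) * c.η - x - ∑ q ∈ Finset.univ.erase p, c.node q) (2 * c.ω) /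
        th1 (2 * (b + 2) * c.η - ∑ q, c.node q) (2 * c.ω) *
      (c.ah h x * c.ah h (-x) / (c.ah h (c.node p) * c.ah h (-c.node p))) *
      ∏ q ∈ Finset.univ.erase p,
        th1 (x - c.node q) (2 * c.ω) / th1 (c.node p - c.node q) (2 * c.ω)) •
      (st ᵥ* c.A (c.node p) (b + 2))

/-- `θ₄²(x|ω) θ₂²(y|ω) - θ₂²(x|ω) θ₄²(y|ω)`, i.e. the difference of `θ₄²/θ₂²` at `x` and `y` with
denominators cleared. -/
def diff (x y : ℂ) : ℂ :=
  th4 x c.ω ^ 2 * th2 y c.ω ^ 2 - th2 x c.ω ^ 2 * th4 y c.ω ^ 2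

/-- The coefficient of `⟨β,h| T_a^{-φ_a}` in `⟨β,h| (𝒜_- - 𝒜_-^{(0)})(λ|β+2)`. -/
def coeff (ρ₁ ρ₂ : ℂ → ℂ) (b : ℂ) (h : Fin N → Fin 2) (x : ℂ) (n : Fin N) (s : Bool) : ℂ :=
  let z := c.zeta h n s
  th4 (2 * x - c.η) (2 * c.ω) * th1 (2 * x - c.η) (2 * c.ω) * c.θ (b * c.η + z - x) /
      (th4 (2 * z - c.η) (2 * c.ω) * th1 (2 * z - c.η) (2 * c.ω) * c.θ (b * c.η)) *
    (c.θ (x + z) / c.θ (2 * z)) *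
    (∏ m ∈ Finset.univ.erase n, c.diff x (c.zeta h m true) / c.diff z (c.zeta h m true)) *
    c.As ρ₁ ρ₂ z

end Chain

end EightVertex

end

noncomputable section

namespace EightVertex

open Complex

/-! ### Jacobi theta functions: symmetries and periods -/

/-! Put x = λ - η/2. Crossing turns 𝒰_- into a nested product in which the factors R(x - ξ_n) and
R(x + ξ_n) of each site surround the boundary matrix (`dress_eq_Ur`). The reflection equation
(`Ur_reflection`) and the fact that 𝒰(x)𝒰(-x) is a scalar (`Ur_unitarity`) then follow by induction
on the sites. The theta identities behind them all come from splitting a double theta series by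
parity (`jacobiTheta₂_mul`), and the position and simplicity of the zeros of θ₁ are deduced from the
same identities.

The vectors v = (θ₂, θ₃) and covectors w = (-θ₃, θ₂) are intertwined by R (`R_mul_vv`, `wv_mul_R`,
`wv_mul_R_mul_vv`), and w(y) spans the annihilator of v(y). Hence if Φ ℬ(x) = 0, the row Φ w(x+s)
𝒰(x) is a multiple χ of w(-x+s) (`exists_passes`), and Φ 𝒜(x) is a scalar times χ. Contracting the
reflection equation with such a Φ gives what is needed without the full dynamical algebra: operators
𝒜 commute on Φ (`Passes.comm`), 𝒜 can be exchanged with ℬ (`Passes.exchange`), and 𝒰(-x) takes χ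
back to Φ (`Passes.neg`).

The reference covector is a product of covectors w, which the site factors reproduce one after the
other; this makes it a pseudo-eigencovector of ℬ (`covOp_mul_gauged`). The eigenvalue vanishes at
-ξ_n, so `Passes.exchange` applies to 𝒜(-ξ_n), which merely moves the zeros belonging to site n
(`S_mul_gauged`). Raising a site twice or lowering an unraised one gives zero (`S_mul_Ag_upper`,
`S_mul_Ag_lower`), and lowering a raised site gives the quantum determinant (`S_cons_mul_Ag`), equal
to 𝖠_-(η/2+ξ_n) 𝖠_-(η/2-ξ_n) by `qdet_eq` and hence nonzero. So no covector vanishes, and N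
applications of ℬ at suitable points kill all covectors but a chosen one: they are independent.

For the formula for 𝒜, the components of ⟨β,h|𝒜(λ|β+2) and the coefficients of the shifted covectors
are theta functions of order 2N+4 with the same multipliers for the periods π and πω. Their
difference vanishes at the 2N separated points, where the action of 𝒜 is known (`state_vecMul_A`,
`coeff_zeta`). Dividing by ∏ θ(λ - ζ_a) leaves order 4 for πω, that is order 8 for 2πω, and
`IsThetaFun.lagrange` recovers the quotient from the eight nodes. The coefficients vanish at those
nodes, so only 𝒜_-^{(0)} remains; the nonresonance condition of the interpolation is θ₁(2βη|2ω) ≠ 0.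
-/

theorem pi_ne_zero_complex : (Real.pi : ℂ) ≠ 0 := by exact_mod_cast Real.pi_ne_zero

theorem th3_neg (x τ : ℂ) : th3 (-x) τ = th3 x τ := by
  rw [th3, th3, neg_div, jacobiTheta₂_neg_left]

theorem th4_neg (x τ : ℂ) : th4 (-x) τ = th4 x τ := by
  rw [th4, th4, ← jacobiTheta₂_neg_left, ← jacobiTheta₂_add_left]
  congr 1; ring

theorem th2_neg (x τ : ℂ) : th2 (-x) τ = th2 x τ := by
  have hπ := pi_ne_zero_complex
  have h := jacobiTheta₂_add_left' (-x / Real.pi - τ / 2) τ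
  have e1 : -x / Real.pi - τ / 2 + τ = -x / Real.pi + τ / 2 := by ring
  have e2 : -x / Real.pi - τ / 2 = -(x / Real.pi + τ / 2) := by ring
  rw [e1, e2, jacobiTheta₂_neg_left] at h
  rw [th2, th2, h, ← mul_assoc, ← Complex.exp_add]
  congr 2
  field_simp
  ring

theorem th1_neg (x τ : ℂ) : th1 (-x) τ = -th1 x τ := by
  have hπ := pi_ne_zero_complex
  have h := jacobiTheta₂_add_left' (-x / Real.pi - τ / 2 + 1 / 2) τ
  have e1 : -x / Real.pi - τ / 2 + 1 / 2 + τ = -x / Real.pi + τ / 2 + 1 / 2 := by ring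
  have e2 : -x / Real.pi - τ / 2 + 1 / 2 = -(x / Real.pi + τ / 2 + 1 / 2) + 1 := by ring
  rw [e1, e2, jacobiTheta₂_add_left, jacobiTheta₂_neg_left] at h
  rw [th1, th1, h]
  have : Complex.exp (-Real.pi * I * (τ + 2 * (-(x / Real.pi + τ / 2 + 1 / 2) + 1))) =
      -Complex.exp (2 * I * x) := by
    have : -Real.pi * I * (τ + 2 * (-(x / Real.pi + τ / 2 + 1 / 2) + 1)) =
        2 * I * x - Real.pi * I := by field_simp; ring
    rw [this, Complex.exp_sub, Complex.exp_pi_mul_I, div_neg, div_one]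
  rw [this, show I * Real.pi * τ / 4 + I * x = (I * Real.pi * τ / 4 + I * -x) + 2 * I * x by ring,
    Complex.exp_add _ (2 * I * x)]
  ring

theorem th1_zero (τ : ℂ) : th1 0 τ = 0 := by
  have := th1_neg 0 τ
  rw [neg_zero] at this
  linear_combination this / 2

theorem th3_add_half (x τ : ℂ) : th3 (x + Real.pi / 2) τ = th4 x τ := by
  have hπ := pi_ne_zero_complex
  rw [th3, th4]; congr 1; field_simp

theorem th4_add_half (x τ : ℂ) : th4 (x + Real.pi / 2) τ = th3 x τ := by
  have hπ := pi_ne_zero_complex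
  rw [th3, th4, ← jacobiTheta₂_add_left (x / Real.pi)]; congr 1; field_simp; ring

theorem exp_I_half_pi : Complex.exp (I * (Real.pi / 2)) = I := by
  rw [mul_comm, Complex.exp_pi_div_two_mul_I]

theorem th1_add_half (x τ : ℂ) : th1 (x + Real.pi / 2) τ = th2 x τ := by
  have hπ := pi_ne_zero_complex
  have e : (x + Real.pi / 2) / Real.pi + τ / 2 + 1 / 2 = x / Real.pi + τ / 2 + 1 := by
    field_simp; ring
  rw [th1, th2, e, jacobiTheta₂_add_left, mul_add I x, ← add_assoc, Complex.exp_add _ (I * (_ / _)),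
    exp_I_half_pi]
  linear_combination (-Complex.exp (I * Real.pi * τ / 4 + I * x) *
    jacobiTheta₂ (x / Real.pi + τ / 2) τ) * I_mul_I

theorem th2_add_half (x τ : ℂ) : th2 (x + Real.pi / 2) τ = -th1 x τ := by
  have hπ := pi_ne_zero_complex
  have e : (x + Real.pi / 2) / Real.pi + τ / 2 = x / Real.pi + τ / 2 + 1 / 2 := by
    field_simp; ring
  rw [th1, th2, e, mul_add I x, ← add_assoc, Complex.exp_add _ (I * (_ / _)), exp_I_half_pi]
  ring

theorem th1_add_pi (x τ : ℂ) : th1 (x + Real.pi) τ = -th1 x τ := by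
  rw [← th2_add_half, ← th1_add_half]; congr 1; ring

theorem th2_add_pi (x τ : ℂ) : th2 (x + Real.pi) τ = -th2 x τ := by
  rw [← th1_add_half x, ← th2_add_half]; congr 1; ring

theorem th3_add_pi (x τ : ℂ) : th3 (x + Real.pi) τ = th3 x τ := by
  rw [← th4_add_half x, ← th3_add_half]; congr 1; ring

theorem th4_add_pi (x τ : ℂ) : th4 (x + Real.pi) τ = th4 x τ := by
  rw [← th3_add_half x, ← th4_add_half]; congr 1; ring

/-- The multiplier of the theta functions under the shift by `π τ / 2`. -/
def halfMult (x τ : ℂ) : ℂ := Complex.exp (-(I * Real.pi * τ / 4) - I * x)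

theorem halfMult_ne_zero (x τ : ℂ) : halfMult x τ ≠ 0 := Complex.exp_ne_zero _

theorem th3_add_half_period (x τ : ℂ) :
    th3 (x + Real.pi * τ / 2) τ = halfMult x τ * th2 x τ := by
  have hπ := pi_ne_zero_complex
  rw [th3, th2, halfMult, ← mul_assoc, ← Complex.exp_add]
  have e : (x + Real.pi * τ / 2) / Real.pi = x / Real.pi + τ / 2 := by field_simp
  rw [e]
  ring_nf
  simp

theorem th2_add_half_period (x τ : ℂ) :
    th2 (x + Real.pi * τ / 2) τ = halfMult x τ * th3 x τ := by
  have hπ := pi_ne_zero_complex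
  have e : (x + Real.pi * τ / 2) / Real.pi + τ / 2 = x / Real.pi + τ := by field_simp; ring
  rw [th3, th2, halfMult, e, jacobiTheta₂_add_left', ← mul_assoc, ← Complex.exp_add]
  congr 2
  field_simp
  ring

theorem th4_add_half_period (x τ : ℂ) :
    th4 (x + Real.pi * τ / 2) τ = I * halfMult x τ * th1 x τ := by
  have hm : halfMult (x + Real.pi / 2) τ = -I * halfMult x τ := by
    rw [halfMult, halfMult, show -(I * Real.pi * τ / 4) - I * (x + Real.pi / 2) =
      (-(I * Real.pi * τ / 4) - I * x) - I * (Real.pi / 2) by ring, Complex.exp_sub, exp_I_half_pi,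
      Complex.div_I]
    ring
  rw [← th3_add_half, show x + Real.pi * τ / 2 + Real.pi / 2 = x + Real.pi / 2 + Real.pi * τ / 2 by
    ring, th3_add_half_period, th2_add_half, hm]
  ring

theorem th1_add_half_period (x τ : ℂ) :
    th1 (x + Real.pi * τ / 2) τ = I * halfMult x τ * th4 x τ := by
  have hm : halfMult (x + Real.pi / 2) τ = -I * halfMult x τ := by
    rw [halfMult, halfMult, show -(I * Real.pi * τ / 4) - I * (x + Real.pi / 2) =
      (-(I * Real.pi * τ / 4) - I * x) - I * (Real.pi / 2) by ring, Complex.exp_sub, exp_I_half_pi,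
      Complex.div_I]
    ring
  rw [← neg_neg (th1 _ _), ← th2_add_half, show x + Real.pi * τ / 2 + Real.pi / 2 =
    x + Real.pi / 2 + Real.pi * τ / 2 by ring, th2_add_half_period, th3_add_half, hm]
  ring

/-- The multiplier of the theta functions under the shift by `π τ`. -/
def perMult (x τ : ℂ) : ℂ := Complex.exp (-(I * Real.pi * τ) - 2 * I * x)

theorem perMult_ne_zero (x τ : ℂ) : perMult x τ ≠ 0 := Complex.exp_ne_zero _

theorem halfMult_mul (x τ : ℂ) :
    halfMult (x + Real.pi * τ / 2) τ * halfMult x τ = perMult x τ := by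
  rw [halfMult, halfMult, perMult, ← Complex.exp_add]; congr 1; ring

theorem th1_add_period (x τ : ℂ) : th1 (x + Real.pi * τ) τ = -perMult x τ * th1 x τ := by
  rw [show x + Real.pi * τ = x + Real.pi * τ / 2 + Real.pi * τ / 2 by ring, th1_add_half_period,
    th4_add_half_period, ← halfMult_mul]
  linear_combination (halfMult (x + Real.pi * τ / 2) τ * halfMult x τ * th1 x τ) * I_mul_I

theorem th4_add_period (x τ : ℂ) : th4 (x + Real.pi * τ) τ = -perMult x τ * th4 x τ := by
  rw [show x + Real.pi * τ = x + Real.pi * τ / 2 + Real.pi * τ / 2 by ring, th4_add_half_period,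
    th1_add_half_period, ← halfMult_mul]
  linear_combination (halfMult (x + Real.pi * τ / 2) τ * halfMult x τ * th4 x τ) * I_mul_I

theorem differentiable_th3 {τ : ℂ} (hτ : 0 < τ.im) : Differentiable ℂ fun x => th3 x τ := fun x =>
  (differentiableAt_jacobiTheta₂_fst (x / Real.pi) hτ).comp x
    (f := fun x : ℂ => x / Real.pi) (by fun_prop)

theorem differentiable_th4 {τ : ℂ} (hτ : 0 < τ.im) : Differentiable ℂ fun x => th4 x τ := fun x =>
  (differentiableAt_jacobiTheta₂_fst (x / Real.pi + 1 / 2) hτ).comp x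
    (f := fun x : ℂ => x / Real.pi + 1 / 2) (by fun_prop)

theorem differentiable_th1 {τ : ℂ} (hτ : 0 < τ.im) : Differentiable ℂ fun x => th1 x τ := by
  have h : Differentiable ℂ fun x : ℂ => jacobiTheta₂ (x / Real.pi + τ / 2 + 1 / 2) τ := fun x =>
    (differentiableAt_jacobiTheta₂_fst (x / Real.pi + τ / 2 + 1 / 2) hτ).comp x
      (f := fun x : ℂ => x / Real.pi + τ / 2 + 1 / 2) (by fun_prop)
  unfold th1
  fun_prop

theorem differentiable_th2 {τ : ℂ} (hτ : 0 < τ.im) : Differentiable ℂ fun x => th2 x τ := by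
  have h : Differentiable ℂ fun x : ℂ => jacobiTheta₂ (x / Real.pi + τ / 2) τ := fun x =>
    (differentiableAt_jacobiTheta₂_fst (x / Real.pi + τ / 2) hτ).comp x
      (f := fun x : ℂ => x / Real.pi + τ / 2) (by fun_prop)
  unfold th2
  fun_prop

/-! ### Products of two theta functions in terms of the doubled modulus -/

/-- Pairs of integers, split according to the parity of the sum. -/
def intPairEquiv : (ℤ × ℤ) ⊕ (ℤ × ℤ) ≃ ℤ × ℤ where
  toFun := Sum.elim (fun p => (p.1 + p.2, p.1 - p.2)) (fun p => (p.1 + p.2 + 1, p.1 - p.2))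
  invFun p := if (p.1 + p.2) % 2 = 0 then Sum.inl ((p.1 + p.2) / 2, (p.1 - p.2) / 2)
    else Sum.inr ((p.1 + p.2) / 2, (p.1 - p.2) / 2)
  left_inv := by
    rintro (⟨a, b⟩ | ⟨a, b⟩)
    · have h : (a + b + (a - b)) % 2 = 0 := by omega
      simp only [Sum.elim_inl, h, if_true, Sum.inl.injEq, Prod.mk.injEq]
      omega
    · have h : ¬ (a + b + 1 + (a - b)) % 2 = 0 := by omega
      simp only [Sum.elim_inr, h, if_false, Sum.inr.injEq, Prod.mk.injEq]
      omega
  right_inv := by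
    rintro ⟨a, b⟩
    by_cases h : (a + b) % 2 = 0
    · simp only [h, if_true, Sum.elim_inl, Prod.mk.injEq]; omega
    · simp only [h, if_false, Sum.elim_inr, Prod.mk.injEq]; omega

theorem hasSum_mul_prod {f g : ℤ → ℂ} {a b : ℂ} (hf : HasSum f a) (hg : HasSum g b)
    (hf' : Summable fun n => ‖f n‖) (hg' : Summable fun n => ‖g n‖) :
    HasSum (fun p : ℤ × ℤ => f p.1 * g p.2) (a * b) :=
  hf.mul hg (summable_mul_of_summable_norm hf' hg')

theorem hasSum_jacobiTheta₂_mul {σ : ℂ} (hσ : 0 < σ.im) (z w : ℂ) :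
    HasSum (fun p : ℤ × ℤ => jacobiTheta₂_term p.1 z σ * jacobiTheta₂_term p.2 w σ)
      (jacobiTheta₂ z σ * jacobiTheta₂ w σ) :=
  hasSum_mul_prod (f := fun n => jacobiTheta₂_term n z σ) (g := fun n => jacobiTheta₂_term n w σ)
    (hasSum_jacobiTheta₂_term z hσ) (hasSum_jacobiTheta₂_term w hσ)
    ((summable_jacobiTheta₂_term_iff z σ).mpr hσ).norm
    ((summable_jacobiTheta₂_term_iff w σ).mpr hσ).norm

/-- For (m, n) = (a+b, a-b) the quadratic form m² + n² becomes 2a² + 2b², which doubles the modulus.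
The pairs of odd sum, (a+b+1, a-b), give the shift of both arguments by τ and the exponential
prefactor. -/
theorem jacobiTheta₂_mul {τ : ℂ} (hτ : 0 < τ.im) (z w : ℂ) :
    jacobiTheta₂ z τ * jacobiTheta₂ w τ =
      jacobiTheta₂ (z + w) (2 * τ) * jacobiTheta₂ (z - w) (2 * τ) +
        Complex.exp (Real.pi * I * τ + 2 * Real.pi * I * z) *
          (jacobiTheta₂ (z + w + τ) (2 * τ) * jacobiTheta₂ (z - w + τ) (2 * τ)) := by
  have hτ2 : 0 < (2 * τ).im := by simpa using hτ
  have h1 := (Equiv.hasSum_iff intPairEquiv).mpr (hasSum_jacobiTheta₂_mul hτ z w)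
  have h2 := hasSum_jacobiTheta₂_mul hτ2 (z + w) (z - w)
  have h3 := (hasSum_jacobiTheta₂_mul hτ2 (z + w + τ) (z - w + τ)).mul_left
        (Complex.exp (Real.pi * I * τ + 2 * Real.pi * I * z))
  have h4 := HasSum.sum (f := (fun p : ℤ × ℤ =>
    jacobiTheta₂_term p.1 z τ * jacobiTheta₂_term p.2 w τ) ∘ intPairEquiv)
    (h2.congr_fun ?_) (h3.congr_fun ?_)
  · exact h1.unique h4
  · intro p
    simp only [Function.comp_apply, intPairEquiv, Equiv.coe_fn_mk, Sum.elim_inl, jacobiTheta₂_term,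
      ← Complex.exp_add]
    congr 1; push_cast; ring
  · intro p
    simp only [Function.comp_apply, intPairEquiv, Equiv.coe_fn_mk, Sum.elim_inr, jacobiTheta₂_term,
      ← Complex.exp_add]
    congr 1; push_cast; ring

/-- The product formulas below follow from this one by shifting arguments by π/2 and πτ/2. -/
theorem th3_mul_th3 {τ : ℂ} (hτ : 0 < τ.im) (x y : ℂ) : th3 x τ * th3 y τ =
    th3 (x + y) (2 * τ) * th3 (x - y) (2 * τ) + th2 (x + y) (2 * τ) * th2 (x - y) (2 * τ) := by
  have hπ := pi_ne_zero_complex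
  rw [th3, th3, jacobiTheta₂_mul hτ, th3, th3, th2, th2, add_div, sub_div,
    show 2 * τ / 2 = τ by ring]
  have : Complex.exp (Real.pi * I * τ + 2 * Real.pi * I * (x / Real.pi)) =
      Complex.exp (I * Real.pi * (2 * τ) / 4 + I * (x + y)) *
      Complex.exp (I * Real.pi * (2 * τ) / 4 + I * (x - y)) := by
    rw [← Complex.exp_add]; congr 1; field_simp; ring
  rw [this]; ring

theorem th4_mul_th4 {τ : ℂ} (hτ : 0 < τ.im) (x y : ℂ) : th4 x τ * th4 y τ =
    th3 (x + y) (2 * τ) * th3 (x - y) (2 * τ) - th2 (x + y) (2 * τ) * th2 (x - y) (2 * τ) := by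
  rw [← th3_add_half, ← th3_add_half, th3_mul_th3 hτ,
    show x + Real.pi / 2 + (y + Real.pi / 2) = x + y + Real.pi by ring,
    show x + Real.pi / 2 - (y + Real.pi / 2) = x - y by ring, th3_add_pi, th2_add_pi]
  ring

theorem th3_mul_th4 {τ : ℂ} (hτ : 0 < τ.im) (x y : ℂ) : th3 x τ * th4 y τ =
    th4 (x + y) (2 * τ) * th4 (x - y) (2 * τ) - th1 (x + y) (2 * τ) * th1 (x - y) (2 * τ) := by
  have h1 := th2_add_half (x - y - Real.pi) (2 * τ)
  have h2 := th3_add_half (x - y - Real.pi) (2 * τ)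
  have h3 := th1_add_pi (x - y - Real.pi) (2 * τ)
  have h4 := th4_add_pi (x - y - Real.pi) (2 * τ)
  rw [sub_add_cancel] at h3 h4
  rw [← th3_add_half y, th3_mul_th3 hτ, ← add_assoc x y,
    show x - (y + Real.pi / 2) = x - y - Real.pi + Real.pi / 2 by ring, h1, h2, th3_add_half,
    th2_add_half, h3, h4]
  ring

theorem th2_mul_th2 {τ : ℂ} (hτ : 0 < τ.im) (x y : ℂ) : th2 x τ * th2 y τ =
    th2 (x + y) (2 * τ) * th3 (x - y) (2 * τ) + th3 (x + y) (2 * τ) * th2 (x - y) (2 * τ) := by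
  have h := th3_mul_th3 hτ (x + Real.pi * τ / 2) (y + Real.pi * τ / 2)
  rw [th3_add_half_period, th3_add_half_period,
    show x + Real.pi * τ / 2 + (y + Real.pi * τ / 2) = x + y + Real.pi * (2 * τ) / 2 by ring,
    show x + Real.pi * τ / 2 - (y + Real.pi * τ / 2) = x - y by ring, th3_add_half_period,
    th2_add_half_period] at h
  have e : halfMult x τ * halfMult y τ = halfMult (x + y) (2 * τ) := by
    rw [halfMult, halfMult, halfMult, ← Complex.exp_add]; congr 1; ring
  have h0 := halfMult_ne_zero (x + y) (2 * τ)
  refine mul_left_cancel₀ h0 ?_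
  linear_combination h - th2 x τ * th2 y τ * e

theorem th1_mul_th1 {τ : ℂ} (hτ : 0 < τ.im) (x y : ℂ) : th1 x τ * th1 y τ =
    th3 (x + y) (2 * τ) * th2 (x - y) (2 * τ) - th2 (x + y) (2 * τ) * th3 (x - y) (2 * τ) := by
  have h := th2_mul_th2 hτ (x + Real.pi / 2) (y + Real.pi / 2)
  rw [th2_add_half, th2_add_half, show x + Real.pi / 2 + (y + Real.pi / 2) = x + y + Real.pi by ring,
    show x + Real.pi / 2 - (y + Real.pi / 2) = x - y by ring, th3_add_pi, th2_add_pi] at h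
  linear_combination h

theorem th1_mul_th2 {τ : ℂ} (hτ : 0 < τ.im) (x y : ℂ) : th1 x τ * th2 y τ =
    th1 (x + y) (2 * τ) * th4 (x - y) (2 * τ) + th4 (x + y) (2 * τ) * th1 (x - y) (2 * τ) := by
  have h := th2_mul_th2 hτ (x + Real.pi / 2) y
  rw [th2_add_half, show x + Real.pi / 2 + y = x + y + Real.pi / 2 by ring,
    show x + Real.pi / 2 - y = x - y + Real.pi / 2 by ring, th3_add_half, th2_add_half, th3_add_half,
    th2_add_half] at h
  linear_combination -h

/-! The same products read from the doubled modulus, at `a = x + y` and `b = x - y`. -/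

theorem th1_mul_th4_double {τ : ℂ} (hτ : 0 < τ.im) {a b : ℂ} (x y : ℂ) (ha : a = x + y) (hb : b = x - y) :
    th1 a (2 * τ) * th4 b (2 * τ) =
        (th1 x τ * th2 y τ + th2 x τ * th1 y τ) / 2 := by
  subst ha hb
  have h1 := th1_mul_th2 hτ x y
  have h2 := th1_mul_th2 hτ y x
  rw [add_comm y x, ← neg_sub x y, th1_neg, th4_neg] at h2
  linear_combination -h1 / 2 - h2 / 2

theorem th4_mul_th1_double {τ : ℂ} (hτ : 0 < τ.im) {a b : ℂ} (x y : ℂ) (ha : a = x + y) (hb : b = x - y) :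
    th4 a (2 * τ) * th1 b (2 * τ) =
        (th1 x τ * th2 y τ - th2 x τ * th1 y τ) / 2 := by
  subst ha hb
  have h1 := th1_mul_th2 hτ x y
  have h2 := th1_mul_th2 hτ y x
  rw [add_comm y x, ← neg_sub x y, th1_neg, th4_neg] at h2
  linear_combination -h1 / 2 + h2 / 2

theorem th4_mul_th4_double {τ : ℂ} (hτ : 0 < τ.im) {a b : ℂ} (x y : ℂ) (ha : a = x + y) (hb : b = x - y) :
    th4 a (2 * τ) * th4 b (2 * τ) =
        (th3 x τ * th4 y τ + th4 x τ * th3 y τ) / 2 := by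
  subst ha hb
  have h1 := th3_mul_th4 hτ x y
  have h2 := th3_mul_th4 hτ y x
  rw [add_comm y x, ← neg_sub x y, th1_neg, th4_neg] at h2
  linear_combination -h1 / 2 - h2 / 2

theorem th1_mul_th1_double {τ : ℂ} (hτ : 0 < τ.im) {a b : ℂ} (x y : ℂ) (ha : a = x + y) (hb : b = x - y) :
    th1 a (2 * τ) * th1 b (2 * τ) =
        (th4 x τ * th3 y τ - th3 x τ * th4 y τ) / 2 := by
  subst ha hb
  have h1 := th3_mul_th4 hτ x y
  have h2 := th3_mul_th4 hτ y x
  rw [add_comm y x, ← neg_sub x y, th1_neg, th4_neg] at h2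
  linear_combination h1 / 2 - h2 / 2

theorem th3_mul_th3_double {τ : ℂ} (hτ : 0 < τ.im) {a b : ℂ} (x y : ℂ) (ha : a = x + y) (hb : b = x - y) :
    th3 a (2 * τ) * th3 b (2 * τ) =
        (th3 x τ * th3 y τ + th4 x τ * th4 y τ) / 2 := by
  subst ha hb
  linear_combination -th3_mul_th3 hτ x y / 2 - th4_mul_th4 hτ x y / 2

theorem th2_mul_th2_double {τ : ℂ} (hτ : 0 < τ.im) {a b : ℂ} (x y : ℂ) (ha : a = x + y) (hb : b = x - y) :
    th2 a (2 * τ) * th2 b (2 * τ) =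
        (th3 x τ * th3 y τ - th4 x τ * th4 y τ) / 2 := by
  subst ha hb
  linear_combination -th3_mul_th3 hτ x y / 2 + th4_mul_th4 hτ x y / 2

theorem th2_mul_th3_double {τ : ℂ} (hτ : 0 < τ.im) {a b : ℂ} (x y : ℂ) (ha : a = x + y) (hb : b = x - y) :
    th2 a (2 * τ) * th3 b (2 * τ) =
        (th2 x τ * th2 y τ - th1 x τ * th1 y τ) / 2 := by
  subst ha hb
  linear_combination -th2_mul_th2 hτ x y / 2 + th1_mul_th1 hτ x y / 2

theorem th3_mul_th2_double {τ : ℂ} (hτ : 0 < τ.im) {a b : ℂ} (x y : ℂ) (ha : a = x + y) (hb : b = x - y) :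
    th3 a (2 * τ) * th2 b (2 * τ) =
        (th2 x τ * th2 y τ + th1 x τ * th1 y τ) / 2 := by
  subst ha hb
  linear_combination -th2_mul_th2 hτ x y / 2 - th1_mul_th1 hτ x y / 2

end EightVertex

end

noncomputable section

namespace EightVertex

open Complex

/-! ### Quartic identities between theta functions -/

theorem th1_two_mul_double {τ : ℂ} (hτ : 0 < τ.im) (x : ℂ) :
    th1 (2 * x) (2 * τ) * th4 0 (2 * τ) = th1 x τ * th2 x τ := by
  rw [th1_mul_th4_double hτ x x (by ring) (by ring)]; ring

theorem th4_two_mul_double {τ : ℂ} (hτ : 0 < τ.im) (x : ℂ) :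
    th4 (2 * x) (2 * τ) * th4 0 (2 * τ) = th3 x τ * th4 x τ := by
  rw [th4_mul_th4_double hτ x x (by ring) (by ring)]; ring

theorem th1_mul_th4_same {τ : ℂ} (hτ : 0 < τ.im) (x : ℂ) :
    2 * (th1 x (2 * τ) * th4 x (2 * τ)) = th2 0 τ * th1 x τ := by
  rw [th1_mul_th4_double hτ x 0 (by ring) (by ring), th1_zero]; ring

theorem th4_sq_sub_th1_sq {τ : ℂ} (hτ : 0 < τ.im) (x : ℂ) :
    th4 x (2 * τ) ^ 2 - th1 x (2 * τ) ^ 2 = th3 x τ * th4 0 τ := by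
  have h := th3_mul_th4 hτ x 0
  rw [sub_zero, add_zero] at h
  linear_combination -h

theorem th4_sq_add_th1_sq {τ : ℂ} (hτ : 0 < τ.im) (x : ℂ) :
    th4 x (2 * τ) ^ 2 + th1 x (2 * τ) ^ 2 = th4 x τ * th3 0 τ := by
  have h := th3_mul_th4 hτ 0 x
  rw [zero_sub, zero_add, th1_neg, th4_neg] at h
  linear_combination -h

theorem th4_zero_double_sq {τ : ℂ} (hτ : 0 < τ.im) : th4 0 (2 * τ) ^ 2 = th3 0 τ * th4 0 τ := by
  have h := th4_sq_sub_th1_sq hτ 0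
  rw [th1_zero] at h
  linear_combination h

/-- `θ₂(a)θ₃(b) - θ₃(a)θ₂(b)` of modulus `2τ` in terms of `θ₁` of modulus `τ`. -/
theorem th2_th3_wronskian {τ : ℂ} (hτ : 0 < τ.im) {a b : ℂ} (x y : ℂ) (ha : a = x + y) (hb : b = x - y) :
    th2 a (2 * τ) * th3 b (2 * τ) - th3 a (2 * τ) * th2 b (2 * τ) = -(th1 x τ * th1 y τ) := by
  rw [th2_mul_th3_double hτ x y ha hb, th3_mul_th2_double hτ x y ha hb]; ring

/-- Grouped in suitable pairs, the factors of modulus 2τ become products of modulus τ at p + r/2, q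
+ r/2 and r/2, and the identity becomes polynomial. -/
theorem th1_th4_product {τ : ℂ} (hτ : 0 < τ.im) (p q r : ℂ) :
    th1 (p + r) (2 * τ) * th1 (q + r) (2 * τ) * th4 p (2 * τ) * th4 q (2 * τ) -
      th1 p (2 * τ) * th1 q (2 * τ) * th4 (p + r) (2 * τ) * th4 (q + r) (2 * τ) =
    th1 r (2 * τ) * th1 (p + q + r) (2 * τ) * th4 0 (2 * τ) * th4 (p - q) (2 * τ) := by
  calc _ = (th1 (p + r) (2 * τ) * th4 p (2 * τ)) * (th1 (q + r) (2 * τ) * th4 q (2 * τ)) -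
      (th4 (p + r) (2 * τ) * th1 p (2 * τ)) * (th4 (q + r) (2 * τ) * th1 q (2 * τ)) := by ring
    _ = (th1 r (2 * τ) * th4 0 (2 * τ)) * (th1 (p + q + r) (2 * τ) * th4 (p - q) (2 * τ)) := by
      rw [th1_mul_th4_double hτ (p + r / 2) (r / 2) (by ring) (by ring),
        th1_mul_th4_double hτ (q + r / 2) (r / 2) (by ring) (by ring),
        th4_mul_th1_double hτ (p + r / 2) (r / 2) (by ring) (by ring),
        th4_mul_th1_double hτ (q + r / 2) (r / 2) (by ring) (by ring),
        th1_mul_th4_double hτ (r / 2) (r / 2) (by ring) (by ring),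
        th1_mul_th4_double hτ (p + r / 2) (q + r / 2) (by ring) (by ring)]
      ring
    _ = _ := by ring

theorem th4_th1_product {τ : ℂ} (hτ : 0 < τ.im) (p q r : ℂ) :
    th4 p (2 * τ) * th4 q (2 * τ) * th4 (p + r) (2 * τ) * th4 (q + r) (2 * τ) -
      th1 p (2 * τ) * th1 q (2 * τ) * th1 (p + r) (2 * τ) * th1 (q + r) (2 * τ) =
    th4 r (2 * τ) * th4 (p + q + r) (2 * τ) * th4 0 (2 * τ) * th4 (p - q) (2 * τ) := by
  calc _ = (th4 (p + r) (2 * τ) * th4 p (2 * τ)) * (th4 (q + r) (2 * τ) * th4 q (2 * τ)) -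
      (th1 (p + r) (2 * τ) * th1 p (2 * τ)) * (th1 (q + r) (2 * τ) * th1 q (2 * τ)) := by ring
    _ = (th4 r (2 * τ) * th4 0 (2 * τ)) * (th4 (p + q + r) (2 * τ) * th4 (p - q) (2 * τ)) := by
      rw [th4_mul_th4_double hτ (p + r / 2) (r / 2) (by ring) (by ring),
        th4_mul_th4_double hτ (q + r / 2) (r / 2) (by ring) (by ring),
        th1_mul_th1_double hτ (p + r / 2) (r / 2) (by ring) (by ring),
        th1_mul_th1_double hτ (q + r / 2) (r / 2) (by ring) (by ring),
        th4_mul_th4_double hτ (r / 2) (r / 2) (by ring) (by ring),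
        th4_mul_th4_double hτ (p + r / 2) (q + r / 2) (by ring) (by ring)]
      ring
    _ = _ := by ring

/-- The addition theorem behind the Yang-Baxter equation. -/
theorem th1_th4_addition {τ : ℂ} (hτ : 0 < τ.im) (p q r : ℂ) :
    th4 r (2 * τ) * th4 (p + q + r) (2 * τ) *
      (th1 (p + r) (2 * τ) * th1 (q + r) (2 * τ) * th4 p (2 * τ) * th4 q (2 * τ) -
        th1 p (2 * τ) * th1 q (2 * τ) * th4 (p + r) (2 * τ) * th4 (q + r) (2 * τ)) =
    th1 r (2 * τ) * th1 (p + q + r) (2 * τ) *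
      (th4 p (2 * τ) * th4 q (2 * τ) * th4 (p + r) (2 * τ) * th4 (q + r) (2 * τ) -
        th1 p (2 * τ) * th1 q (2 * τ) * th1 (p + r) (2 * τ) * th1 (q + r) (2 * τ)) := by
  rw [th1_th4_product hτ, th4_th1_product hτ]; ring

/-! Components of the intertwining relation. -/

theorem intertwine_even {τ : ℂ} (hτ : 0 < τ.im) (x u e : ℂ) :
    th4 e (2 * τ) * th4 u (2 * τ) * (th2 x (2 * τ) * th2 (x - u - e) (2 * τ)) +
      th1 e (2 * τ) * th1 u (2 * τ) * (th3 x (2 * τ) * th3 (x - u - e) (2 * τ)) =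
    th4 0 (2 * τ) * th4 (u + e) (2 * τ) * (th2 (x - e) (2 * τ) * th2 (x - u) (2 * τ)) := by
  rw [mul_comm (th4 0 _),
    th4_mul_th4_double hτ ((e + u) / 2) ((e - u) / 2) (by ring) (by ring),
    th1_mul_th1_double hτ ((e + u) / 2) ((e - u) / 2) (by ring) (by ring),
    th4_mul_th4_double hτ ((e + u) / 2) ((e + u) / 2) (by ring) (by ring),
    th2_mul_th2_double hτ (x - (e + u) / 2) ((e + u) / 2) (by ring) (by ring),
    th3_mul_th3_double hτ (x - (e + u) / 2) ((e + u) / 2) (by ring) (by ring),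
    mul_comm (th2 (x - e) _),
    th2_mul_th2_double hτ (x - (e + u) / 2) ((e - u) / 2) (by ring) (by ring)]
  ring

theorem intertwine_even' {τ : ℂ} (hτ : 0 < τ.im) (x u e : ℂ) :
    th4 e (2 * τ) * th4 u (2 * τ) * (th3 x (2 * τ) * th3 (x - u - e) (2 * τ)) +
      th1 e (2 * τ) * th1 u (2 * τ) * (th2 x (2 * τ) * th2 (x - u - e) (2 * τ)) =
    th4 0 (2 * τ) * th4 (u + e) (2 * τ) * (th3 (x - e) (2 * τ) * th3 (x - u) (2 * τ)) := by
  rw [mul_comm (th4 0 _),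
    th4_mul_th4_double hτ ((e + u) / 2) ((e - u) / 2) (by ring) (by ring),
    th1_mul_th1_double hτ ((e + u) / 2) ((e - u) / 2) (by ring) (by ring),
    th4_mul_th4_double hτ ((e + u) / 2) ((e + u) / 2) (by ring) (by ring),
    th2_mul_th2_double hτ (x - (e + u) / 2) ((e + u) / 2) (by ring) (by ring),
    th3_mul_th3_double hτ (x - (e + u) / 2) ((e + u) / 2) (by ring) (by ring),
    mul_comm (th3 (x - e) _),
    th3_mul_th3_double hτ (x - (e + u) / 2) ((e - u) / 2) (by ring) (by ring)]
  ring

theorem intertwine_odd {τ : ℂ} (hτ : 0 < τ.im) (x u e : ℂ) :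
    (th1 u (2 * τ) * th4 e (2 * τ)) * (th2 x (2 * τ) * th3 (x - u - e) (2 * τ)) +
      (th4 u (2 * τ) * th1 e (2 * τ)) * (th3 x (2 * τ) * th2 (x - u - e) (2 * τ)) =
    (th1 (u + e) (2 * τ) * th4 0 (2 * τ)) * (th3 (x - u) (2 * τ) * th2 (x - e) (2 * τ)) := by
  rw [th1_mul_th4_double hτ ((u + e) / 2) ((u - e) / 2) (by ring) (by ring),
    th4_mul_th1_double hτ ((u + e) / 2) ((u - e) / 2) (by ring) (by ring),
    th1_mul_th4_double hτ ((u + e) / 2) ((u + e) / 2) (by ring) (by ring),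
    th2_mul_th3_double hτ (x - (u + e) / 2) ((u + e) / 2) (by ring) (by ring),
    th3_mul_th2_double hτ (x - (u + e) / 2) ((u + e) / 2) (by ring) (by ring),
    th3_mul_th2_double hτ (x - (u + e) / 2) ((e - u) / 2) (by ring) (by ring),
    show (e - u) / 2 = -((u - e) / 2) by ring, th1_neg, th2_neg]
  ring

theorem intertwine_odd' {τ : ℂ} (hτ : 0 < τ.im) (x u e : ℂ) :
    (th1 u (2 * τ) * th4 e (2 * τ)) * (th3 x (2 * τ) * th2 (x - u - e) (2 * τ)) +
      (th4 u (2 * τ) * th1 e (2 * τ)) * (th2 x (2 * τ) * th3 (x - u - e) (2 * τ)) =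
    (th1 (u + e) (2 * τ) * th4 0 (2 * τ)) * (th2 (x - u) (2 * τ) * th3 (x - e) (2 * τ)) := by
  rw [th1_mul_th4_double hτ ((u + e) / 2) ((u - e) / 2) (by ring) (by ring),
    th4_mul_th1_double hτ ((u + e) / 2) ((u - e) / 2) (by ring) (by ring),
    th1_mul_th4_double hτ ((u + e) / 2) ((u + e) / 2) (by ring) (by ring),
    th2_mul_th3_double hτ (x - (u + e) / 2) ((u + e) / 2) (by ring) (by ring),
    th3_mul_th2_double hτ (x - (u + e) / 2) ((u + e) / 2) (by ring) (by ring),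
    th2_mul_th3_double hτ (x - (u + e) / 2) ((e - u) / 2) (by ring) (by ring),
    show (e - u) / 2 = -((u - e) / 2) by ring, th1_neg, th2_neg]
  ring

/-- The addition formulas at a single modulus, with the theta constants kept. -/
theorem add_th1_th2 {τ : ℂ} (hτ : 0 < τ.im) (x y : ℂ) : th1 (x + y) τ * th2 (x - y) τ * (th3 0 τ * th4 0 τ) =
    th1 x τ * th2 x τ * (th3 y τ * th4 y τ) + th3 x τ * th4 x τ * (th1 y τ * th2 y τ) := by
  rw [← th4_zero_double_sq hτ, th1_mul_th2 hτ, ← th1_two_mul_double hτ, ← th1_two_mul_double hτ,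
    ← th4_two_mul_double hτ, ← th4_two_mul_double hτ, show x + y + (x - y) = 2 * x by ring,
    show x + y - (x - y) = 2 * y by ring]
  ring

theorem add_th1_th3 {τ : ℂ} (hτ : 0 < τ.im) (x y : ℂ) : th1 (x + y) τ * th3 (x - y) τ * (th2 0 τ * th4 0 τ) =
    th1 x τ * th3 x τ * (th2 y τ * th4 y τ) + th2 x τ * th4 x τ * (th1 y τ * th3 y τ) := by
  calc _ = (th1 (x + y) τ * th2 0 τ) * (th3 (x - y) τ * th4 0 τ) := by ring
    _ = (th1 x τ * th2 y τ) * (th3 x τ * th4 y τ) + (th1 y τ * th2 x τ) * (th3 y τ * th4 x τ) := by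
      simp only [th1_mul_th2 hτ, th3_mul_th4 hτ, add_zero, sub_zero]
      rw [add_comm y x, ← neg_sub x y, th1_neg, th4_neg]
      ring
    _ = _ := by ring

theorem add_th1_th4 {τ : ℂ} (hτ : 0 < τ.im) (x y : ℂ) : th1 (x + y) τ * th4 (x - y) τ * (th2 0 τ * th3 0 τ) =
    th1 x τ * th4 x τ * (th2 y τ * th3 y τ) + th2 x τ * th3 x τ * (th1 y τ * th4 y τ) := by
  calc _ = (th1 (x + y) τ * th2 0 τ) * (th3 0 τ * th4 (x - y) τ) := by ring
    _ = (th1 x τ * th2 y τ) * (th3 y τ * th4 x τ) + (th1 y τ * th2 x τ) * (th3 x τ * th4 y τ) := by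
      simp only [th1_mul_th2 hτ, th3_mul_th4 hτ, add_zero, sub_zero, zero_add, zero_sub]
      rw [add_comm y x, ← neg_sub x y]
      simp only [th1_neg, th4_neg]
      ring
    _ = _ := by ring

theorem add_th3_th4 {τ : ℂ} (hτ : 0 < τ.im) (x y : ℂ) : th3 (x + y) τ * th4 (x - y) τ * (th3 0 τ * th4 0 τ) =
    th3 x τ * th4 x τ * (th3 y τ * th4 y τ) - th1 x τ * th2 x τ * (th1 y τ * th2 y τ) := by
  rw [← th4_zero_double_sq hτ, th3_mul_th4 hτ (x + y), ← th1_two_mul_double hτ,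
    ← th1_two_mul_double hτ, ← th4_two_mul_double hτ, ← th4_two_mul_double hτ,
    show x + y + (x - y) = 2 * x by ring, show x + y - (x - y) = 2 * y by ring]
  ring

theorem add_th2_th3 {τ : ℂ} (hτ : 0 < τ.im) (x y : ℂ) : th2 (x + y) τ * th3 (x - y) τ * (th2 0 τ * th3 0 τ) =
    th2 x τ * th3 x τ * (th2 y τ * th3 y τ) - th1 x τ * th4 x τ * (th1 y τ * th4 y τ) := by
  calc _ = (th2 (x + y) τ * th2 0 τ) * (th3 (x - y) τ * th3 0 τ) := by ring
    _ = (th2 x τ * th2 y τ) * (th3 x τ * th3 y τ) - (th1 x τ * th1 y τ) * (th4 x τ * th4 y τ) := by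
      simp only [th2_mul_th2 hτ, th3_mul_th3 hτ, th1_mul_th1 hτ, th4_mul_th4 hτ, add_zero, sub_zero]
      ring
    _ = _ := by ring

theorem add_th2_th4 {τ : ℂ} (hτ : 0 < τ.im) (x y : ℂ) : th2 (x + y) τ * th4 (x - y) τ * (th2 0 τ * th4 0 τ) =
    th2 x τ * th4 x τ * (th2 y τ * th4 y τ) - th1 x τ * th3 x τ * (th1 y τ * th3 y τ) := by
  calc _ = (th2 (x + y) τ * th2 0 τ) * (th4 (x - y) τ * th4 0 τ) := by ring
    _ = (th2 x τ * th2 y τ) * (th4 x τ * th4 y τ) - (th1 x τ * th1 y τ) * (th3 x τ * th3 y τ) := by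
      simp only [th2_mul_th2 hτ, th3_mul_th3 hτ, th1_mul_th1 hτ, th4_mul_th4 hτ, add_zero, sub_zero]
      ring
    _ = _ := by ring

/-- All squares, and the product on the right, expand in θ₂ and θ₃ of modulus 2τ at 2x, 2y and 0.
This factorization exhibits the zeros of `diff`. -/
theorem th4_th2_difference {τ : ℂ} (hτ : 0 < τ.im) (x y : ℂ) :
    th4 x τ ^ 2 * th2 y τ ^ 2 - th2 x τ ^ 2 * th4 y τ ^ 2 =
      th1 (x + y) τ * th1 (x - y) τ * th3 0 τ ^ 2 := by
  have h1 := th4_mul_th4 hτ x x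
  have h2 := th4_mul_th4 hτ y y
  have h3 := th2_mul_th2 hτ x x
  have h4 := th2_mul_th2 hτ y y
  have h5 := th1_mul_th1 hτ (x + y) (x - y)
  have h6 := th3_mul_th3 hτ 0 0
  rw [show x + y + (x - y) = x + x by ring, show x + y - (x - y) = y + y by ring] at h5
  rw [sub_self] at h1 h2 h3 h4
  rw [sub_zero, add_zero] at h6
  rw [sq, sq, sq, sq, sq, h1, h2, h3, h4, h5, h6]
  ring

/-- This identity controls the zeros of θ₁: differentiated at x = y it bounds the order of the zero
at 0, and with y a zero it compares the zeros at y and at 0. -/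
theorem th1_th4_difference {τ : ℂ} (hτ : 0 < τ.im) (x y : ℂ) :
    th1 x τ ^ 2 * th4 y τ ^ 2 - th4 x τ ^ 2 * th1 y τ ^ 2 =
      th1 (x + y) τ * th1 (x - y) τ * th4 0 τ ^ 2 := by
  have h1 := th4_mul_th4 hτ x x
  have h2 := th4_mul_th4 hτ y y
  have h3 := th1_mul_th1 hτ x x
  have h4 := th1_mul_th1 hτ y y
  have h5 := th1_mul_th1 hτ (x + y) (x - y)
  have h6 := th4_mul_th4 hτ 0 0
  rw [show x + y + (x - y) = x + x by ring, show x + y - (x - y) = y + y by ring] at h5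
  rw [sub_self] at h1 h2 h3 h4
  rw [sub_zero, add_zero] at h6
  rw [sq, sq, sq, sq, sq, h1, h2, h3, h4, h5, h6]
  ring

end EightVertex

end

noncomputable section

namespace EightVertex

open Complex Filter Topology

/-! ### Entire functions: division and quasi-periodicity -/

/-- A product of entire functions vanishes only if a factor does. -/
theorem entire_mul_eq_zero {f g : ℂ → ℂ} (hf : Differentiable ℂ f) (hg : Differentiable ℂ g)
    (h : ∀ x, f x * g x = 0) : (∀ x, f x = 0) ∨ ∀ x, g x = 0 := by
  have hf' : AnalyticOnNhd ℂ f Set.univ := hf.differentiableOn.analyticOnNhd isOpen_univ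
  have hg' : AnalyticOnNhd ℂ g Set.univ := hg.differentiableOn.analyticOnNhd isOpen_univ
  have := AnalyticOnNhd.eq_zero_or_eq_zero_of_mul_eq_zero hf' hg' (fun x _ => h x)
    isPreconnected_univ
  simpa using this

/-- Entire functions form a domain, so a common factor may be cancelled even at the points where it
vanishes. -/
theorem entire_cancel {f g h : ℂ → ℂ} (hf : Differentiable ℂ f) (hg : Differentiable ℂ g)
    (hh : Differentiable ℂ h) (hf0 : ∃ x, f x ≠ 0) (e : ∀ x, f x * g x = f x * h x) (x : ℂ) :
    g x = h x := by
  obtain ⟨x₀, hx₀⟩ := hf0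
  rcases entire_mul_eq_zero (g := fun x => g x - h x) hf (hg.sub hh)
    (fun x => by linear_combination e x) with h1 | h1
  · exact absurd (h1 x₀) hx₀
  · exact sub_eq_zero.mp (h1 x)

theorem differentiable_dslope {f : ℂ → ℂ} (hf : Differentiable ℂ f) (p : ℂ) :
    Differentiable ℂ (dslope f p) := by
  have := (differentiableOn_dslope (c := p) (s := Set.univ) (f := f) univ_mem).mpr
    hf.differentiableOn
  exact differentiableOn_univ.mp this

/-- An entire function vanishing at the zeros of `h`, all of them simple, is divisible by `h`. -/
theorem exists_entire_quotient {f h : ℂ → ℂ} (hf : Differentiable ℂ f) (hh : Differentiable ℂ h)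
    (hs : ∀ x, h x = 0 → deriv h x ≠ 0) (hz : ∀ x, h x = 0 → f x = 0) :
    ∃ g : ℂ → ℂ, Differentiable ℂ g ∧ ∀ x, f x = g x * h x := by
  refine ⟨fun x => if h x = 0 then deriv f x / deriv h x else f x / h x, fun p => ?_, fun x => ?_⟩
  · by_cases hp : h p = 0
    · have hd : dslope h p p ≠ 0 := by rw [dslope_same]; exact hs p hp
      have hne : ∀ᶠ x in 𝓝 p, dslope h p x ≠ 0 :=
        (differentiable_dslope hh p).continuous.continuousAt.eventually_ne hd
      refine DifferentiableAt.congr_of_eventuallyEq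
        (f := fun x => dslope f p x / dslope h p x)
        ((differentiable_dslope hf p p).div (differentiable_dslope hh p p) hd) ?_
      filter_upwards [hne] with x hx
      have e1 : ∀ {k : ℂ → ℂ}, k p = 0 → k x = (x - p) * dslope k p x := fun {k} hk => by
        have := sub_smul_dslope k p x
        rw [smul_eq_mul, hk, sub_zero] at this
        exact this.symm
      rcases eq_or_ne x p with rfl | hxp
      · simp [hp, dslope_same]
      · have hx0 : h x ≠ 0 := by rw [e1 hp]; exact mul_ne_zero (sub_ne_zero.mpr hxp) hx
        simp only [hx0, if_false]
        rw [e1 hp, e1 (hz p hp), mul_div_mul_left _ _ (sub_ne_zero.mpr hxp)]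
    · have hne : ∀ᶠ x in 𝓝 p, h x ≠ 0 := hh.continuous.continuousAt.eventually_ne hp
      refine DifferentiableAt.congr_of_eventuallyEq (f := fun x => f x / h x)
        ((hf p).div (hh p) hp) ?_
      filter_upwards [hne] with x hx
      simp [hx]
  · by_cases hx : h x = 0
    · simp [hx, hz x hx]
    · simp [hx]

/-- A multiple of T brings the imaginary part into [0, Im T); a multiple of π then adjusts the real
part alone. A rectangle thus suffices, even when T is not purely imaginary. -/
theorem bounded_of_periodic {F : ℂ → ℝ} (hF : Continuous F) {T : ℂ} (hT : 0 < T.im)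
    (h1 : ∀ x, F (x + Real.pi) = F x) (h2 : ∀ x, F (x + T) = F x) : ∃ B, ∀ x, F x ≤ B := by
  have hz1 : ∀ (n : ℤ) x, F (x + n * Real.pi) = F x := by
    intro n
    have hp : Function.Periodic F (Real.pi : ℂ) := h1
    exact fun x => hp.int_mul n x
  have hz2 : ∀ (n : ℤ) x, F (x + n * T) = F x := by
    intro n
    have hp : Function.Periodic F T := h2
    exact fun x => hp.int_mul n x
  have hK : IsCompact (Set.Icc (0 : ℝ) Real.pi ×ℂ Set.Icc (0 : ℝ) T.im) :=
    isCompact_Icc.reProdIm isCompact_Icc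
  obtain ⟨B, hB⟩ := (hK.image hF).bddAbove
  refine ⟨B, fun x => ?_⟩
  set n : ℤ := ⌊x.im / T.im⌋ with hn
  set y := x - n * T with hy
  set m : ℤ := ⌊y.re / Real.pi⌋ with hm
  have hyim : y.im = Int.fract (x.im / T.im) * T.im := by
    rw [hy, ← Int.self_sub_floor, sub_mul, div_mul_cancel₀ _ hT.ne']
    simp [hn]
  have e : F x = F (y - m * Real.pi) := by
    rw [← hz1 m (y - m * Real.pi), sub_add_cancel, ← hz2 n y, hy, sub_add_cancel]
  rw [e]
  refine hB ⟨_, ?_, rfl⟩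
  have hre : (y - m * Real.pi).re = Int.fract (y.re / Real.pi) * Real.pi := by
    rw [← Int.self_sub_floor, sub_mul, div_mul_cancel₀ _ Real.pi_ne_zero]
    simp [hm]
  have him : (y - m * Real.pi).im = Int.fract (x.im / T.im) * T.im := by
    rw [← hyim]; simp
  rw [Complex.mem_reProdIm, hre, him]
  refine ⟨⟨mul_nonneg (Int.fract_nonneg _) Real.pi_pos.le, ?_⟩,
    ⟨mul_nonneg (Int.fract_nonneg _) hT.le, ?_⟩⟩
  · exact mul_le_of_le_one_left Real.pi_pos.le (Int.fract_lt_one _).le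
  · exact mul_le_of_le_one_left hT.le (Int.fract_lt_one _).le

/-- An entire function multiplied by constants under the shifts by `π` and `T` is an exponential. -/
theorem quasi_periodic_eq_exp {G : ℂ → ℂ} (hG : Differentiable ℂ G) {T a c : ℂ} (hT : 0 < T.im)
    (ha : ‖a‖ = 1) (hc : c ≠ 0) (h1 : ∀ x, G (x + Real.pi) = a * G x)
    (h2 : ∀ x, G (x + T) = c * G x) : ∃ (k : ℝ) (C : ℂ), ∀ x, G x = C * Complex.exp (I * k * x) := by
  -- With this k the modulus exp(k Im x) of exp(-ikx) is divided by ‖c‖ under x ↦ x + T, so the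
  -- twisted function has doubly periodic modulus and Liouville's theorem applies.
  set k : ℝ := -Real.log ‖c‖ / T.im with hk
  have hn : ∀ x, ‖Complex.exp (-(I * k * x))‖ = Real.exp (k * x.im) := fun x => by
    rw [Complex.norm_exp]; simp
  have hH : Differentiable ℂ fun x => G x * Complex.exp (-(I * k * x)) := by fun_prop
  obtain ⟨B, hB⟩ := bounded_of_periodic (F := fun x => ‖G x * Complex.exp (-(I * k * x))‖)
    hH.continuous.norm hT (fun x => by
      simp only [norm_mul, hn, h1, ha]
      simp) (fun x => by
      have : Real.exp (k * T.im) = ‖c‖⁻¹ := by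
        rw [hk, div_mul_cancel₀ _ hT.ne', Real.exp_neg, Real.exp_log (norm_pos_iff.mpr hc)]
      have hc' : ‖c‖ ≠ 0 := norm_ne_zero_iff.mpr hc
      have e : Real.exp (k * (x + T).im) = Real.exp (k * x.im) * ‖c‖⁻¹ := by
        rw [add_im, mul_add, Real.exp_add, this]
      simp only [norm_mul, hn, h2, e]
      field_simp)
  have hbd : Bornology.IsBounded (Set.range fun x => G x * Complex.exp (-(I * k * x))) := by
    rw [isBounded_iff_forall_norm_le]
    exact ⟨B, by rintro _ ⟨x, rfl⟩; exact hB x⟩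
  refine ⟨k, G 0, fun x => ?_⟩
  have := hH.apply_eq_apply_of_bounded hbd x 0
  simp only [mul_zero, neg_zero, Complex.exp_zero, mul_one] at this
  rw [← this, mul_assoc, ← Complex.exp_add, neg_add_cancel, Complex.exp_zero, mul_one]

/-- If `G` picks up factors `1` and `exp (2iz)` under `π` and `T`, with `z` off the lattice of
periods, it vanishes. -/
theorem eq_zero_of_quasi_periodic {G : ℂ → ℂ} (hG : Differentiable ℂ G) {T z : ℂ} (hT : 0 < T.im)
    (h1 : ∀ x, G (x + Real.pi) = G x) (h2 : ∀ x, G (x + T) = Complex.exp (2 * I * z) * G x)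
    (hz : ∀ m n : ℤ, z ≠ m * Real.pi + n * T) (x : ℂ) : G x = 0 := by
  obtain ⟨k, C, hC⟩ := quasi_periodic_eq_exp hG hT (a := 1) (by simp) (Complex.exp_ne_zero _)
    (by simpa using h1) h2
  by_contra hx
  have hC0 : C ≠ 0 := by rintro rfl; simp [hC] at hx
  have e1 := h1 0
  have e2 := h2 0
  rw [hC, hC] at e1 e2
  rw [zero_add, mul_zero, Complex.exp_zero, mul_one] at e1 e2
  have e1' : Complex.exp (I * k * Real.pi) = 1 := mul_left_cancel₀ hC0 (by rw [e1, mul_one])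
  have e2' : Complex.exp (I * k * T) = Complex.exp (2 * I * z) :=
    mul_left_cancel₀ hC0 (by rw [e2, mul_comm])
  obtain ⟨n, hn⟩ := Complex.exp_eq_one_iff.mp e1'
  obtain ⟨m, hm⟩ := Complex.exp_eq_exp_iff_exists_int.mp e2'
  have hk : (k : ℂ) = 2 * n := by
    have hπ := pi_ne_zero_complex
    have : I * Real.pi * (k - 2 * n) = 0 := by linear_combination hn
    rcases mul_eq_zero.mp this with h | h
    · exact absurd h (mul_ne_zero I_ne_zero hπ)
    · linear_combination h
  refine hz (-m) n ?_
  have : 2 * I * (z - ((-m : ℤ) * Real.pi + n * T)) = 0 := by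
    push_cast
    rw [hk] at hm
    linear_combination -hm
  rcases mul_eq_zero.mp this with h | h
  · exact absurd h (by simp)
  · linear_combination h

/-! ### Zeros of the theta functions -/

theorem im_two_pow_mul {τ : ℂ} (k : ℕ) : (2 ^ k * τ).im = 2 ^ k * τ.im := by
  have : ((2 : ℂ) ^ k) = (((2 : ℝ) ^ k : ℝ) : ℂ) := by push_cast; rfl
  rw [this, Complex.im_ofReal_mul]

theorem tendsto_th3_zero_two_pow {τ : ℂ} (hτ : 0 < τ.im) :
    Tendsto (fun k : ℕ => th3 0 (2 ^ k * τ)) atTop (𝓝 1) := by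
  have h : Tendsto (fun k : ℕ => 2 ^ k * τ) atTop (comap im atTop) := by
    rw [tendsto_comap_iff]
    refine Tendsto.congr (fun k => (im_two_pow_mul (τ := τ) k).symm) ?_
    exact (tendsto_pow_atTop_atTop_of_one_lt one_lt_two).atTop_mul_const hτ
  have h0 : Tendsto (fun τ : ℂ => Real.exp (-Real.pi * τ.im)) (comap im atTop) (𝓝 0) := by
    refine Real.tendsto_exp_atBot.comp ?_
    exact (tendsto_comap (f := im) (x := atTop)).const_mul_atTop_of_neg (by simp [Real.pi_pos])
  have h1 := (isBigO_at_im_infty_jacobiTheta_sub_one.trans_tendsto h0).comp h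
  have h2 := h1.add_const 1
  simp only [Function.comp_def, sub_add_cancel, zero_add] at h2
  simpa [th3, jacobiTheta_eq_jacobiTheta₂] using h2

/-- If θ₄(0|τ) vanished, duplication would carry the zero to every modulus 2^k τ and give θ₃(0|2^k
τ)² = 2 θ₃(0|2^(k+1) τ)², while both theta values tend to 1. -/
theorem th4_zero_ne_zero {τ : ℂ} (hτ : 0 < τ.im) : th4 0 τ ≠ 0 := by
  intro h0
  have hk : ∀ k : ℕ, 0 < (2 ^ k * τ).im := fun k => by
    rw [im_two_pow_mul]; positivity
  have e : ∀ k : ℕ, (2 : ℂ) ^ (k + 1) * τ = 2 * (2 ^ k * τ) := fun k => by ring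
  have h4 : ∀ k : ℕ, th4 0 (2 ^ k * τ) = 0 := by
    intro k
    induction k with
    | zero => simpa using h0
    | succ k ih =>
      have := th4_zero_double_sq (hk k)
      rw [ih, mul_zero, ← e] at this
      exact pow_eq_zero_iff (two_ne_zero) |>.mp this
  have h3 : ∀ k : ℕ, th3 0 (2 ^ k * τ) ^ 2 = 2 * th3 0 (2 ^ (k + 1) * τ) ^ 2 := by
    intro k
    have := th3_mul_th3_double (hk k) 0 0 (a := 0) (b := 0) (by simp) (by simp)
    rw [h4, ← e] at this
    linear_combination -2 * this
  have t := tendsto_th3_zero_two_pow hτ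
  have t1 : Tendsto (fun k : ℕ => th3 0 (2 ^ k * τ) ^ 2) atTop (𝓝 (1 ^ 2)) := t.pow 2
  have t2 : Tendsto (fun k : ℕ => 2 * th3 0 (2 ^ (k + 1) * τ) ^ 2) atTop (𝓝 (2 * 1 ^ 2)) :=
    (((tendsto_add_atTop_iff_nat 1).mpr t).pow 2).const_mul 2
  have := tendsto_nhds_unique t1 (t2.congr fun k => (h3 k).symm)
  norm_num at this

theorem th3_zero_ne_zero {τ : ℂ} (hτ : 0 < τ.im) : th3 0 τ ≠ 0 := by
  intro h0
  have := th4_zero_double_sq hτ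
  rw [h0, zero_mul] at this
  exact th4_zero_ne_zero (τ := 2 * τ) (by simpa using hτ) (pow_eq_zero_iff (two_ne_zero) |>.mp this)

theorem exists_th1_ne_zero {τ : ℂ} (hτ : 0 < τ.im) : ∃ x, th1 x τ ≠ 0 := by
  refine ⟨0 + Real.pi * τ / 2, ?_⟩
  rw [th1_add_half_period]
  exact mul_ne_zero (mul_ne_zero I_ne_zero (halfMult_ne_zero _ _)) (th4_zero_ne_zero hτ)

/-- Differentiating `th1_th4_difference` at x = y expresses θ₁θ₄ times the Wronskian of θ₁ and θ₄ by
θ₁'(0). If that were zero, θ₁/θ₄ would be constant near 0, hence zero because θ₁(0) = 0. -/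
theorem deriv_th1_zero_ne_zero {τ : ℂ} (hτ : 0 < τ.im) : deriv (fun x => th1 x τ) 0 ≠ 0 := by
  intro h0
  set f := fun x => th1 x τ with hf
  set g := fun x => th4 x τ with hg
  have df : Differentiable ℂ f := differentiable_th1 hτ
  have dg : Differentiable ℂ g := differentiable_th4 hτ
  have key : ∀ y, (f y * g y) * (deriv f y * g y - deriv g y * f y) = 0 := by
    intro y
    have l : HasDerivAt (fun x => f x ^ 2 * g y ^ 2 - g x ^ 2 * f y ^ 2)
        ((2 * f y * deriv f y) * g y ^ 2 - (2 * g y * deriv g y) * f y ^ 2) y := by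
      have a := ((df y).hasDerivAt.pow 2).mul_const (g y ^ 2)
      have b := ((dg y).hasDerivAt.pow 2).mul_const (f y ^ 2)
      exact (a.sub b).congr_deriv (by norm_num)
    have r : HasDerivAt (fun x => f (x + y) * f (x - y) * g 0 ^ 2)
        ((deriv f (y + y) * f (y - y) + f (y + y) * deriv f (y - y)) * g 0 ^ 2) y := by
      have a : HasDerivAt (fun x => f (x + y)) (deriv f (y + y)) y :=
        (df (y + y)).hasDerivAt.comp_add_const y y
      have b : HasDerivAt (fun x => f (x - y)) (deriv f (y - y)) y :=
        (df (y - y)).hasDerivAt.comp_sub_const y y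
      exact (a.mul b).mul_const _
    have e : (fun x => f x ^ 2 * g y ^ 2 - g x ^ 2 * f y ^ 2) =
        fun x => f (x + y) * f (x - y) * g 0 ^ 2 := by
      funext x; exact th1_th4_difference hτ x y
    rw [e] at l
    have := l.unique r
    have f0 : f 0 = 0 := th1_zero τ
    rw [sub_self, h0, f0] at this
    linear_combination this / 2
  have hf0 := exists_th1_ne_zero hτ
  have hg0 : g 0 ≠ 0 := th4_zero_ne_zero hτ
  rcases entire_mul_eq_zero (df.mul dg) ((df.deriv.mul dg).sub (dg.deriv.mul df)) key with h1 | h1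
  · rcases entire_mul_eq_zero df dg h1 with h2 | h2
    · exact hf0.elim fun x hx => hx (h2 x)
    · exact hg0 (h2 0)
  obtain ⟨ε, hε, hb⟩ := Metric.eventually_nhds_iff_ball.mp
    (dg.continuous.continuousAt.eventually_ne hg0)
  have hd : ∀ x ∈ Metric.ball (0 : ℂ) ε, HasDerivAt (fun x => f x / g x) 0 x := fun x hx => by
    have := (df x).hasDerivAt.div (dg x).hasDerivAt (hb x hx)
    have e := h1 x
    simp only [Pi.sub_apply, Pi.mul_apply] at e
    exact this.congr_deriv (by rw [mul_comm (f x), e, zero_div])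
  have hconst : ∀ x ∈ Metric.ball (0 : ℂ) ε, f x = 0 := fun x hx => by
    have h2 := (convex_ball (0 : ℂ) ε).is_const_of_fderivWithin_eq_zero (𝕜 := ℂ)
      (f := fun x => f x / g x) (fun y hy => (hd y hy).differentiableAt.differentiableWithinAt)
      (fun y hy => by
        rw [fderivWithin_of_isOpen Metric.isOpen_ball hy, (hd y hy).hasFDerivAt.fderiv]
        ext; simp) hx (Metric.mem_ball_self hε)
    have f0 : f 0 = 0 := th1_zero τ
    simp only [f0, zero_div, div_eq_zero_iff] at h2
    exact h2.resolve_right (hb x hx)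
  have hf' : AnalyticOnNhd ℂ f Set.univ := df.differentiableOn.analyticOnNhd isOpen_univ
  have := hf'.eqOn_zero_of_preconnected_of_eventuallyEq_zero isPreconnected_univ (Set.mem_univ 0)
    (Filter.mem_of_superset (Metric.ball_mem_nhds 0 hε) hconst)
  exact hf0.elim fun x hx => hx (this (Set.mem_univ x))

/-- Products of shifted `θ₁` at a zero `z`. -/
theorem th1_shift_product {τ : ℂ} (hτ : 0 < τ.im) {z : ℂ} (hz : th1 z τ = 0) (x : ℂ) :
    th1 (x + z) τ * th1 (x - z) τ * th4 0 τ ^ 2 = th1 x τ ^ 2 * th4 z τ ^ 2 := by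
  have := th1_th4_difference hτ x z
  rw [hz] at this
  linear_combination -this

/-- A common zero z would make θ₁(x+z) θ₁(x-z) vanish for all x. -/
theorem th4_ne_zero_of_th1_eq_zero {τ : ℂ} (hτ : 0 < τ.im) {z : ℂ} (hz : th1 z τ = 0) : th4 z τ ≠ 0 := by
  intro h4
  obtain ⟨x₀, hx₀⟩ := exists_th1_ne_zero hτ
  have df := differentiable_th1 hτ
  rcases entire_mul_eq_zero (f := fun x => th1 (x + z) τ) (g := fun x => th1 (x - z) τ)
    (df.comp (differentiable_id.add_const z)) (df.comp (differentiable_id.sub_const z))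
    (fun x => by
      have := th1_shift_product hτ hz x
      rw [h4] at this
      have h40 := th4_zero_ne_zero hτ
      have h5 : th1 (x + z) τ * th1 (x - z) τ * th4 0 τ ^ 2 = 0 := by linear_combination this
      exact (mul_eq_zero.mp h5).resolve_right (pow_ne_zero 2 h40)) with h | h
  · exact hx₀ (by simpa using h (x₀ - z))
  · exact hx₀ (by simpa using h (x₀ + z))

/-- Both sides of `th1_shift_product` are divisible by x². At x = 0 the quotients give θ₁'(z)²
θ₄(0)² = θ₁'(0)² θ₄(z)². -/
theorem deriv_th1_ne_zero {τ : ℂ} (hτ : 0 < τ.im) {z : ℂ} (hz : th1 z τ = 0) : deriv (fun x => th1 x τ) z ≠ 0 := by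
  set f := fun x => th1 x τ with hf
  have df : Differentiable ℂ f := differentiable_th1 hτ
  have h40 := th4_zero_ne_zero hτ
  have h4z := th4_ne_zero_of_th1_eq_zero hτ hz
  have s1 : ∀ x, f (x + z) = x * dslope f z (x + z) := fun x => by
    have := sub_smul_dslope f z (x + z)
    have fz : f z = 0 := hz
    rw [smul_eq_mul, fz, sub_zero, add_sub_cancel_right] at this
    exact this.symm
  have s0 : ∀ x, f x = x * dslope f 0 x := fun x => by
    have := sub_smul_dslope f 0 x
    have f0 : f 0 = 0 := th1_zero τ
    rw [smul_eq_mul, f0, sub_zero, sub_zero] at this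
    exact this.symm
  have e : ∀ x, x ^ 2 * (dslope f z (x + z) * dslope f z (-x + z) * th4 0 τ ^ 2) =
      x ^ 2 * (dslope f 0 x ^ 2 * th4 z τ ^ 2) := fun x => by
    have h := th1_shift_product hτ hz x
    have h' : th1 (x - z) τ = -f (-x + z) := by
      rw [← th1_neg]; congr 1; ring
    have h1 : th1 (x + z) τ = f (x + z) := rfl
    have h2 : th1 x τ = f x := rfl
    rw [h', h1, h2, s1, s1, s0] at h
    linear_combination h
  have d1 := differentiable_dslope df z
  have d0 := differentiable_dslope df 0
  have d1' : Differentiable ℂ fun x => dslope f z (x + z) :=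
    d1.comp (differentiable_id.add_const z)
  have d1'' : Differentiable ℂ fun x => dslope f z (-x + z) :=
    d1.comp (differentiable_id.neg.add_const z)
  have := entire_cancel (f := fun x => x ^ 2)
    (g := fun x => dslope f z (x + z) * dslope f z (-x + z) * th4 0 τ ^ 2)
    (h := fun x => dslope f 0 x ^ 2 * th4 z τ ^ 2) (by fun_prop) (by fun_prop) (by fun_prop)
    ⟨1, by simp⟩ e 0
  simp only [zero_add, neg_zero, dslope_same] at this
  intro hd
  rw [hd] at this
  have h0 := deriv_th1_zero_ne_zero hτ
  have : deriv f 0 ^ 2 * th4 z τ ^ 2 = 0 := by rw [← this]; ring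
  exact mul_ne_zero (pow_ne_zero 2 h0) (pow_ne_zero 2 h4z) this

/-- If θ₁(w+z) were nonzero, then θ₁(w-z) = 0 by `th1_shift_product`, and w would be a simple zero
of its left side, whereas its right side vanishes doubly there. -/
theorem th1_add_zero_eq_zero {τ : ℂ} (hτ : 0 < τ.im) {z w : ℂ} (hz : th1 z τ = 0) (hw : th1 w τ = 0) :
    th1 (w + z) τ = 0 := by
  by_contra hne
  set f := fun x => th1 x τ with hf
  have df : Differentiable ℂ f := differentiable_th1 hτ
  have h40 := th4_zero_ne_zero hτ
  have h0 := th1_shift_product hτ hz w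
  rw [hw] at h0
  have hwz : f (w - z) = 0 := by
    have h5 : th1 (w + z) τ * (f (w - z) * th4 0 τ ^ 2) = 0 := by linear_combination h0
    exact (mul_eq_zero.mp ((mul_eq_zero.mp h5).resolve_left hne)).resolve_right (pow_ne_zero 2 h40)
  have a : HasDerivAt (fun x => f (x + z)) (deriv f (w + z)) w :=
    (df (w + z)).hasDerivAt.comp_add_const w z
  have b : HasDerivAt (fun x => f (x - z)) (deriv f (w - z)) w :=
    (df (w - z)).hasDerivAt.comp_sub_const w z
  have l := (a.mul b).mul_const (th4 0 τ ^ 2)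
  have r := ((df w).hasDerivAt.pow 2).mul_const (th4 z τ ^ 2)
  have e : (fun x => f (x + z) * f (x - z) * th4 0 τ ^ 2) = fun x => f x ^ 2 * th4 z τ ^ 2 := by
    funext x; exact th1_shift_product hτ hz x
  have := l.unique (e ▸ r)
  have fw : f w = 0 := hw
  rw [hwz, fw] at this
  have h6 : f (w + z) * deriv f (w - z) * th4 0 τ ^ 2 = 0 := by
    norm_num at this
    simpa [mul_eq_zero] using this
  exact mul_ne_zero (mul_ne_zero hne (deriv_th1_ne_zero hτ hwz)) (pow_ne_zero 2 h40) h6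

/-- The zeros of `θ₁` are the points of the lattice of periods. -/
theorem th1_eq_zero_iff {τ : ℂ} (hτ : 0 < τ.im) {z : ℂ} :
    th1 z τ = 0 ↔ ∃ m n : ℤ, z = m * Real.pi + n * (Real.pi * τ) := by
  have hT : 0 < (Real.pi * τ).im := by
    rw [Complex.im_ofReal_mul]; exact mul_pos Real.pi_pos hτ
  have df := differentiable_th1 hτ
  constructor
  · intro hz
    by_contra hcon
    push Not at hcon
    -- The quotient θ₁(x+z)/θ₁(x) is entire because the zeros of θ₁ are simple and closed under
    -- addition. Its multipliers are 1 and exp(-2iz), so off the lattice it would be zero.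
    obtain ⟨G, hG, hGe⟩ := exists_entire_quotient (f := fun x => th1 (x + z) τ)
      (h := fun x => th1 x τ) (df.comp (differentiable_id.add_const z)) df
      (fun x hx => deriv_th1_ne_zero hτ hx) (fun x hx => th1_add_zero_eq_zero hτ hz hx)
    have hne := exists_th1_ne_zero hτ
    have h1 : ∀ x, G (x + Real.pi) = G x := entire_cancel (f := fun x => th1 x τ) df
      (hG.comp (differentiable_id.add_const _)) hG hne (fun x => by
        have e1 := hGe (x + Real.pi)
        have e2 := hGe x
        simp only [th1_add_pi, add_right_comm x (Real.pi : ℂ)] at e1 e2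
        linear_combination e1 + e2)
    have h2 : ∀ x, G (x + Real.pi * τ) = Complex.exp (2 * I * -z) * G x :=
      entire_cancel (f := fun x => th1 x τ) df (hG.comp (differentiable_id.add_const _))
      (hG.const_mul _) hne (fun x => by
        have e1 := hGe (x + Real.pi * τ)
        have e2 := hGe x
        simp only [th1_add_period, add_right_comm x (Real.pi * τ)] at e1 e2
        have hm : perMult (x + z) τ = Complex.exp (2 * I * -z) * perMult x τ := by
          rw [perMult, perMult, ← Complex.exp_add]; congr 1; ring
        rw [hm] at e1
        have h0 := perMult_ne_zero x τ
        refine mul_left_cancel₀ h0 ?_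
        linear_combination e1 + Complex.exp (2 * I * -z) * perMult x τ * e2)
    have hG0 := eq_zero_of_quasi_periodic hG hT h1 h2 (fun m n h => hcon (-m) (-n) (by
      push_cast; linear_combination -h))
    obtain ⟨x₀, hx₀⟩ := hne
    apply hx₀
    have := hGe (x₀ - z)
    simpa [hG0] using this
  · have hl : ∀ (x : ℂ), th1 x τ = 0 → ∀ n : ℤ, th1 (x + n * Real.pi) τ = 0 := by
      intro x hx n
      induction n using Int.induction_on with
      | zero => simpa using hx
      | succ n ih =>
        have := th1_add_pi (x + n * Real.pi) τ
        push_cast at ih ⊢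
        rw [ih, neg_zero] at this
        rw [← this]; congr 1; ring
      | pred n ih =>
        have := th1_add_pi (x + (-n - 1) * Real.pi) τ
        push_cast at ih ⊢
        rw [show x + (-n - 1) * Real.pi + Real.pi = x + -n * Real.pi by ring, ih] at this
        linear_combination this
    have hl2 : ∀ (x : ℂ), th1 x τ = 0 → ∀ n : ℤ, th1 (x + n * (Real.pi * τ)) τ = 0 := by
      intro x hx n
      induction n using Int.induction_on with
      | zero => simpa using hx
      | succ n ih =>
        have := th1_add_period (x + n * (Real.pi * τ)) τ
        push_cast at ih ⊢
        rw [ih, mul_zero] at this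
        rw [← this]; congr 1; ring
      | pred n ih =>
        have := th1_add_period (x + (-n - 1) * (Real.pi * τ)) τ
        push_cast at ih ⊢
        rw [show x + (-n - 1) * (Real.pi * τ) + Real.pi * τ = x + -n * (Real.pi * τ) by ring, ih]
          at this
        exact (mul_eq_zero.mp this.symm).resolve_left (neg_ne_zero.mpr (perMult_ne_zero _ _))
    rintro ⟨m, n, rfl⟩
    have := hl2 _ (hl 0 (th1_zero τ) m) n
    rwa [zero_add] at this

theorem th2_zero_ne_zero {τ : ℂ} (hτ : 0 < τ.im) : th2 0 τ ≠ 0 := by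
  rw [← th1_add_half, Ne, th1_eq_zero_iff hτ]
  rintro ⟨m, n, h⟩
  have him := congrArg Complex.im h
  have hre := congrArg Complex.re h
  simp at him hre
  rcases him with h0 | h0
  · subst h0
    have : (2 * m : ℝ) = 1 := by
      have hπ := Real.pi_ne_zero
      simp at hre
      field_simp at hre
      linarith
    have h2 : (2 * m : ℤ) = 1 := by exact_mod_cast this
    omega
  · exact hτ.ne' h0

end EightVertex

end

/-! ### The Yang-Baxter equation for the eight-vertex weights. -/

noncomputable section

namespace EightVertex

theorem th1_th4_product' {τ : ℂ} (hτ : 0 < τ.im) (p q r : ℂ) :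
    th1 (p + r) (2 * τ) * th4 p (2 * τ) * th1 q (2 * τ) * th4 (q + r) (2 * τ) -
      th1 p (2 * τ) * th4 (p + r) (2 * τ) * th1 (q + r) (2 * τ) * th4 q (2 * τ) =
    -(th1 r (2 * τ) * th4 (p + q + r) (2 * τ) * th4 0 (2 * τ) * th1 (p - q) (2 * τ)) := by
  calc _ = (th1 (p + r) (2 * τ) * th4 p (2 * τ)) * (th4 (q + r) (2 * τ) * th1 q (2 * τ)) -
      (th4 (p + r) (2 * τ) * th1 p (2 * τ)) * (th1 (q + r) (2 * τ) * th4 q (2 * τ)) := by ring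
    _ = -((th1 r (2 * τ) * th4 0 (2 * τ)) * (th4 (p + q + r) (2 * τ) * th1 (p - q) (2 * τ))) := by
      rw [th1_mul_th4_double hτ (p + r / 2) (r / 2) (by ring) (by ring),
        th1_mul_th4_double hτ (q + r / 2) (r / 2) (by ring) (by ring),
        th4_mul_th1_double hτ (q + r / 2) (r / 2) (by ring) (by ring),
        th4_mul_th1_double hτ (p + r / 2) (r / 2) (by ring) (by ring),
        th1_mul_th4_double hτ (r / 2) (r / 2) (by ring) (by ring),
        th4_mul_th1_double hτ (p + r / 2) (q + r / 2) (by ring) (by ring)]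
      ring
    _ = _ := by ring

theorem th4_th1_product' {τ : ℂ} (hτ : 0 < τ.im) (p q r : ℂ) :
    th4 p (2 * τ) * th4 (p + r) (2 * τ) * th1 q (2 * τ) * th1 (q + r) (2 * τ) -
      th1 p (2 * τ) * th1 (p + r) (2 * τ) * th4 q (2 * τ) * th4 (q + r) (2 * τ) =
    -(th4 r (2 * τ) * th1 (p + q + r) (2 * τ) * th4 0 (2 * τ) * th1 (p - q) (2 * τ)) := by
  calc _ = (th4 (p + r) (2 * τ) * th4 p (2 * τ)) * (th1 (q + r) (2 * τ) * th1 q (2 * τ)) -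
      (th1 (p + r) (2 * τ) * th1 p (2 * τ)) * (th4 (q + r) (2 * τ) * th4 q (2 * τ)) := by ring
    _ = -((th4 r (2 * τ) * th4 0 (2 * τ)) * (th1 (p + q + r) (2 * τ) * th1 (p - q) (2 * τ))) := by
      rw [th4_mul_th4_double hτ (p + r / 2) (r / 2) (by ring) (by ring),
        th4_mul_th4_double hτ (q + r / 2) (r / 2) (by ring) (by ring),
        th1_mul_th1_double hτ (q + r / 2) (r / 2) (by ring) (by ring),
        th1_mul_th1_double hτ (p + r / 2) (r / 2) (by ring) (by ring),
        th4_mul_th4_double hτ (r / 2) (r / 2) (by ring) (by ring),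
        th1_mul_th1_double hτ (p + r / 2) (q + r / 2) (by ring) (by ring)]
      ring
    _ = _ := by ring

theorem th1_th4_addition' {τ : ℂ} (hτ : 0 < τ.im) (p q r : ℂ) :
    th4 r (2 * τ) * th1 (p + q + r) (2 * τ) *
      (th1 (p + r) (2 * τ) * th4 p (2 * τ) * th1 q (2 * τ) * th4 (q + r) (2 * τ) -
        th1 p (2 * τ) * th4 (p + r) (2 * τ) * th1 (q + r) (2 * τ) * th4 q (2 * τ)) =
    th1 r (2 * τ) * th4 (p + q + r) (2 * τ) *
      (th4 p (2 * τ) * th4 (p + r) (2 * τ) * th1 q (2 * τ) * th1 (q + r) (2 * τ) -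
        th1 p (2 * τ) * th1 (p + r) (2 * τ) * th4 q (2 * τ) * th4 (q + r) (2 * τ)) := by
  rw [th1_th4_product' hτ, th4_th1_product' hτ]; ring

/-! ### Two auxiliary spaces -/

section TwoSpaces

variable {𝒜 : Type*} [Ring 𝒜]

/-- A matrix acting on the first of two auxiliary spaces. -/
def inFst (T : Matrix (Fin 2) (Fin 2) 𝒜) : Matrix (Fin 2 × Fin 2) (Fin 2 × Fin 2) 𝒜 :=
  fun p q => if p.2 = q.2 then T p.1 q.1 else 0

/-- A matrix acting on the second of two auxiliary spaces. -/
def inSnd (T : Matrix (Fin 2) (Fin 2) 𝒜) : Matrix (Fin 2 × Fin 2) (Fin 2 × Fin 2) 𝒜 :=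
  fun p q => if p.1 = q.1 then T p.2 q.2 else 0

/-- A scalar matrix with entries in the algebra. -/
def scal (𝒜 : Type*) [Ring 𝒜] [Algebra ℂ 𝒜] {ι : Type*} (S : Matrix ι ι ℂ) : Matrix ι ι 𝒜 :=
  S.map fun z => z • (1 : 𝒜)

theorem inFst_mul (A B : Matrix (Fin 2) (Fin 2) 𝒜) : inFst (A * B) = inFst A * inFst B := by
  ext ⟨i, j⟩ ⟨k, l⟩
  fin_cases j <;> fin_cases l <;>
    simp [inFst, Matrix.mul_apply, Fintype.sum_prod_type, Fin.sum_univ_two]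

theorem inSnd_mul (A B : Matrix (Fin 2) (Fin 2) 𝒜) : inSnd (A * B) = inSnd A * inSnd B := by
  ext ⟨i, j⟩ ⟨k, l⟩
  fin_cases i <;> fin_cases k <;>
    simp [inSnd, Matrix.mul_apply, Fintype.sum_prod_type, Fin.sum_univ_two]

theorem inFst_inSnd_comm {A B : Matrix (Fin 2) (Fin 2) 𝒜} (h : ∀ i j k l, Commute (A i j) (B k l)) :
    inFst A * inSnd B = inSnd B * inFst A := by
  ext ⟨i, j⟩ ⟨k, l⟩
  fin_cases j <;> fin_cases k <;>
    simp [inFst, inSnd, Matrix.mul_apply, Fintype.sum_prod_type, h _ _ _ _ |>.eq]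

end TwoSpaces

/-- The eight-vertex pattern on two spaces. -/
def eightVertex (a b c d : ℂ) : Matrix (Fin 2 × Fin 2) (Fin 2 × Fin 2) ℂ :=
  fun p q => (!![!![a, 0; 0, b], !![0, d; c, 0]; !![0, c; d, 0], !![b, 0; 0, a]] :
    Matrix (Fin 2) (Fin 2) (Matrix (Fin 2) (Fin 2) ℂ)) p.1 q.1 p.2 q.2

/-- The eight-vertex pattern as a block matrix. -/
def eightBlock (a b c d : ℂ) : Matrix (Fin 2) (Fin 2) (Matrix (Fin 2) (Fin 2) ℂ) :=
  !![!![a, 0; 0, b], !![0, d; c, 0]; !![0, c; d, 0], !![b, 0; 0, a]]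

/-- The six equations between three sets of eight-vertex weights that amount to the Yang-Baxter
equation. -/
structure YBWeights (a b c d a' b' c' d' a'' b'' c'' d'' : ℂ) : Prop where
  e1 : a * c' * a'' + d * a' * d'' = b * c' * b'' + c * a' * c''
  e2 : a * b' * c'' + d * d' * b'' = b * a' * c'' + c * c' * b''
  e3 : c * b' * a'' + b * d' * d'' = c * a' * b'' + b * c' * c''
  e4 : a * d' * b'' + d * b' * c'' = b * d' * a'' + c * b' * d''
  e5 : a * a' * d'' + d * c' * a'' = b * b' * d'' + c * d' * a''
  e6 : d * a' * a'' + a * c' * d'' = d * b' * b'' + a * d' * c''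

-- This is the form R₁₂ L₁ L₂ = L₂ L₁ R₁₂; `YBWeights.mul_fst_scal_snd` reads the same six equations
-- as L₁ R₁₂ L₂ = L₂ R₁₂ L₁. The induction on the sites of a reflected chain needs both. Each of the
-- 64 entries is trivial or one of the six equations up to sign.
set_option maxHeartbeats 4000000 in
theorem YBWeights.mul_fst_snd {a b c d a' b' c' d' a'' b'' c'' d'' : ℂ}
    (h : YBWeights a b c d a' b' c' d' a'' b'' c'' d'') :
    scal _ (eightVertex a b c d) * inFst (eightBlock a' b' c' d') *
        inSnd (eightBlock a'' b'' c'' d'') =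
      inSnd (eightBlock a'' b'' c'' d'') * inFst (eightBlock a' b' c' d') *
        scal _ (eightVertex a b c d) := by
  obtain ⟨h1, h2, h3, h4, h5, h6⟩ := h
  ext ⟨i, j⟩ ⟨k, l⟩ m n
  fin_cases i <;> fin_cases j <;> fin_cases k <;> fin_cases l <;> fin_cases m <;> fin_cases n <;>
    simp [scal, eightVertex, eightBlock, inFst, inSnd, Matrix.mul_apply, Fintype.sum_prod_type,
      Fin.sum_univ_two, Matrix.add_apply] <;>
    first
    | ring1
    | linear_combination h1
    | linear_combination h2
    | linear_combination h3
    | linear_combination h4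
    | linear_combination h5
    | linear_combination h6
    | linear_combination -h1
    | linear_combination -h2
    | linear_combination -h3
    | linear_combination -h4
    | linear_combination -h5
    | linear_combination -h6

set_option maxHeartbeats 4000000 in
theorem YBWeights.mul_fst_scal_snd {a b c d a' b' c' d' a'' b'' c'' d'' : ℂ}
    (h : YBWeights a b c d a' b' c' d' a'' b'' c'' d'') :
    inFst (eightBlock a b c d) * scal _ (eightVertex a' b' c' d') *
        inSnd (eightBlock a'' b'' c'' d'') =
      inSnd (eightBlock a'' b'' c'' d'') * scal _ (eightVertex a' b' c' d') *
        inFst (eightBlock a b c d) := by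
  obtain ⟨h1, h2, h3, h4, h5, h6⟩ := h
  ext ⟨i, j⟩ ⟨k, l⟩ m n
  fin_cases i <;> fin_cases j <;> fin_cases k <;> fin_cases l <;> fin_cases m <;> fin_cases n <;>
    simp [scal, eightVertex, eightBlock, inFst, inSnd, Matrix.mul_apply, Fintype.sum_prod_type,
      Fin.sum_univ_two, Matrix.add_apply] <;>
    first
    | ring1
    | linear_combination h1
    | linear_combination h2
    | linear_combination h3
    | linear_combination h4
    | linear_combination h5
    | linear_combination h6
    | linear_combination -h1
    | linear_combination -h2
    | linear_combination -h3
    | linear_combination -h4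
    | linear_combination -h5
    | linear_combination -h6

namespace Chain

variable {N : ℕ} (c : Chain N)

/-- The R-matrix on two auxiliary spaces. -/
def R₂ (x : ℂ) : Matrix (Fin 2 × Fin 2) (Fin 2 × Fin 2) ℂ :=
  eightVertex (c.Ra x) (c.Rb x) (c.Rc x) (c.Rd x)

theorem R₂_apply (x : ℂ) (i j k l : Fin 2) : c.R₂ x (i, j) (k, l) = c.R x i k j l := rfl

/-- The three arguments u, v and -(u+v)-η enter symmetrically: the two addition theorems, each taken
at the three pairs formed from them, give the six equations. -/
theorem ybWeights (hω : 0 < c.ω.im) (u v : ℂ) :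
    YBWeights (c.Ra u) (c.Rb u) (c.Rc u) (c.Rd u) (c.Ra (u + v)) (c.Rb (u + v)) (c.Rc (u + v))
      (c.Rd (u + v)) (c.Ra v) (c.Rb v) (c.Rc v) (c.Rd v) := by
  have I1 := th1_th4_addition hω u v c.η
  have I2 := th1_th4_addition hω u (-(u + v) - c.η) c.η
  have I3 := th1_th4_addition hω v (-(u + v) - c.η) c.η
  have J1 := th1_th4_addition' hω u v c.η
  have J2 := th1_th4_addition' hω u (-(u + v) - c.η) c.η
  have J3 := th1_th4_addition' hω v (-(u + v) - c.η) c.η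
  have n1 : -(u + v) - c.η = -(u + v + c.η) := by ring
  have n2 : -(u + v) - c.η + c.η = -(u + v) := by ring
  have n3 : u + (-(u + v) - c.η) + c.η = -v := by ring
  have n4 : v + (-(u + v) - c.η) + c.η = -u := by ring
  rw [n3, n2, n1] at I2 J2
  rw [n4, n2, n1] at I3 J3
  simp only [th1_neg, th4_neg] at I2 I3 J2 J3
  unfold Ra Rb Rc Rd
  generalize c.Rden = D at *
  generalize th1 c.η (2 * c.ω) = s at *
  generalize th4 c.η (2 * c.ω) = f at *
  generalize th1 u (2 * c.ω) = su at *
  generalize th4 u (2 * c.ω) = fu at *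
  generalize th1 v (2 * c.ω) = sv at *
  generalize th4 v (2 * c.ω) = fv at *
  generalize th1 (u + v) (2 * c.ω) = sw at *
  generalize th4 (u + v) (2 * c.ω) = fw at *
  generalize th1 (u + c.η) (2 * c.ω) = su' at *
  generalize th4 (u + c.η) (2 * c.ω) = fu' at *
  generalize th1 (v + c.η) (2 * c.ω) = sv' at *
  generalize th4 (v + c.η) (2 * c.ω) = fv' at *
  generalize th1 (u + v + c.η) (2 * c.ω) = sw' at *
  generalize th4 (u + v + c.η) (2 * c.ω) = fw' at *
  constructor
  · linear_combination (8 / D ^ 3 * s * f * fw) * I1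
  · linear_combination (-8 / D ^ 3 * s * f * fv') * I2
  · linear_combination (-8 / D ^ 3 * s * f * fu') * I3
  · linear_combination (8 / D ^ 3 * s * f * sw) * J1
  · linear_combination (8 / D ^ 3 * s * f * sv') * J2
  · linear_combination (8 / D ^ 3 * s * f * su') * J3

end Chain

end EightVertex

end

noncomputable section

namespace EightVertex

/-! ### The reflection equation for the boundary matrix -/

/-- A `2 × 2` matrix in terms of its components along `1, σˣ, iσʸ, σᶻ`. -/
def pauliMatrix (k0 kx ky kz : ℂ) : Matrix (Fin 2) (Fin 2) ℂ := !![k0 + kz, kx + ky; kx - ky, k0 - kz]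

/-- The eight-vertex pattern in terms of its components along `σ ⊗ σ`. -/
def pauliVertex (W0 Wx Wy Wz : ℂ) : Matrix (Fin 2 × Fin 2) (Fin 2 × Fin 2) ℂ :=
  eightVertex (W0 + Wz) (W0 - Wz) (Wx + Wy) (Wx - Wy)

-- The difference of the two sides is expanded in products of Pauli matrices. The four components
-- along equal matrices cancel identically; each hypothesis, named by its component, removes one of
-- the other twelve.
set_option maxHeartbeats 1000000 in
theorem reflection_of_weights {W0 Wx Wy Wz V0 Vx Vy Vz k0 kx ky kz l0 lx ly lz : ℂ}
    (h0x : ky * lz * (W0 * Vy + Wy * V0 + Wz * Vx + Wx * Vz) =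
      (kz * ly * (W0 * Vz + Wz * V0 + Wy * Vx + Wx * Vy)))
    (h0y : kx * lz * (W0 * Vx + Wx * V0 + Wz * Vy + Wy * Vz) =
      (kz * lx * (W0 * Vz + Wz * V0 + Wy * Vx + Wx * Vy)))
    (h0z : kx * ly * (W0 * Vx + Wx * V0 + Wz * Vy + Wy * Vz) =
      (ky * lx * (W0 * Vy + Wy * V0 + Wz * Vx + Wx * Vz)))
    (hx0 : kz * ly * (W0 * Vy - Wy * V0 - Wz * Vx + Wx * Vz) =
      (ky * lz * (W0 * Vz - Wz * V0 - Wy * Vx + Wx * Vy)))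
    (hxy : k0 * lz * (W0 * Vx + Wx * V0 - Wz * Vy - Wy * Vz) =
      -(kz * l0 * (W0 * Vy - Wy * V0 - Wz * Vx + Wx * Vz)))
    (hxz : k0 * ly * (W0 * Vx + Wx * V0 - Wz * Vy - Wy * Vz) =
      -(ky * l0 * (W0 * Vz - Wz * V0 - Wy * Vx + Wx * Vy)))
    (hy0 : kz * lx * (W0 * Vx - Wx * V0 - Wz * Vy + Wy * Vz) =
      (kx * lz * (W0 * Vz - Wz * V0 + Wy * Vx - Wx * Vy)))
    (hyx : kz * l0 * (W0 * Vx - Wx * V0 - Wz * Vy + Wy * Vz) =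
      -(k0 * lz * (W0 * Vy + Wy * V0 - Wz * Vx - Wx * Vz)))
    (hyz : k0 * lx * (W0 * Vy + Wy * V0 - Wz * Vx - Wx * Vz) =
      -(kx * l0 * (W0 * Vz - Wz * V0 + Wy * Vx - Wx * Vy)))
    (hz0 : ky * lx * (W0 * Vx - Wx * V0 + Wz * Vy - Wy * Vz) =
      (kx * ly * (W0 * Vy - Wy * V0 + Wz * Vx - Wx * Vz)))
    (hzx : ky * l0 * (W0 * Vx - Wx * V0 + Wz * Vy - Wy * Vz) =
      -(k0 * ly * (W0 * Vz + Wz * V0 - Wy * Vx - Wx * Vy)))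
    (hzy : kx * l0 * (W0 * Vy - Wy * V0 + Wz * Vx - Wx * Vz) =
      -(k0 * lx * (W0 * Vz + Wz * V0 - Wy * Vx - Wx * Vy))) :
    pauliVertex W0 Wx Wy Wz * inFst (pauliMatrix k0 kx ky kz) * pauliVertex V0 Vx Vy Vz *
        inSnd (pauliMatrix l0 lx ly lz) =
      inSnd (pauliMatrix l0 lx ly lz) * pauliVertex V0 Vx Vy Vz *
        inFst (pauliMatrix k0 kx ky kz) * pauliVertex W0 Wx Wy Wz := by
  ext ⟨i, j⟩ ⟨k, l⟩
  fin_cases i <;> fin_cases j <;> fin_cases k <;> fin_cases l <;>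
    simp [pauliVertex, pauliMatrix, eightVertex, inFst, inSnd, Matrix.mul_apply,
      Fintype.sum_prod_type, Fin.sum_univ_two]
  · linear_combination -2 * h0z + 2 * hz0
  · linear_combination -2 * h0x - 2 * h0y + 2 * hzx + 2 * hzy
  · linear_combination 2 * hx0 - 2 * hxz + 2 * hy0 - 2 * hyz
  · linear_combination -2 * hxy + 2 * hyx
  · linear_combination -2 * h0x + 2 * h0y + 2 * hzx - 2 * hzy
  · linear_combination 2 * h0z + 2 * hz0
  · linear_combination 2 * hxy + 2 * hyx
  · linear_combination 2 * hx0 + 2 * hxz + 2 * hy0 + 2 * hyz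
  · linear_combination 2 * hx0 - 2 * hxz - 2 * hy0 + 2 * hyz
  · linear_combination -2 * hxy - 2 * hyx
  · linear_combination -2 * h0z - 2 * hz0
  · linear_combination -2 * h0x - 2 * h0y - 2 * hzx - 2 * hzy
  · linear_combination 2 * hxy - 2 * hyx
  · linear_combination 2 * hx0 + 2 * hxz - 2 * hy0 - 2 * hyz
  · linear_combination -2 * h0x + 2 * h0y - 2 * hzx + 2 * hzy
  · linear_combination 2 * h0z - 2 * hz0

/-- Bilinear combinations of shifted weights factorize. Here `f₁` is odd, the other functions are
even, and they satisfy the addition formulas of theta functions. -/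
theorem weight_factorization {f₁ fi fj fk : ℂ → ℂ} {q : ℂ} (hq : q ≠ 0)
    (o1 : ∀ x, f₁ (-x) = -f₁ x) (oi : ∀ x, fi (-x) = fi x) (oj : ∀ x, fj (-x) = fj x)
    (ok : ∀ x, fk (-x) = fk x)
    (A : ∀ x y, f₁ (x + y) * fi (x - y) * q = f₁ x * fi x * (fj y * fk y) + fj x * fk x * (f₁ y * fi y))
    (B : ∀ x y, fj (x + y) * fk (x - y) * q = fj x * fk x * (fj y * fk y) - f₁ x * fi x * (f₁ y * fi y))
    (u v e : ℂ) :
    let W0 := f₁ (u - v + e) * (fi e * fj e * fk e)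
    let V0 := f₁ (u + v + e) * (fi e * fj e * fk e)
    let Wi := fi (u - v + e) * (f₁ e * fj e * fk e)
    let Vi := fi (u + v + e) * (f₁ e * fj e * fk e)
    let Wj := fj (u - v + e) * (f₁ e * fi e * fk e)
    let Vj := fj (u + v + e) * (f₁ e * fi e * fk e)
    let Wk := fk (u - v + e) * (f₁ e * fi e * fj e)
    let Vk := fk (u + v + e) * (f₁ e * fi e * fj e)
    let P := 2 * (f₁ e * fi e * fj e * fk e)
    (W0 * Vi + Wi * V0 + Wj * Vk + Wk * Vj = P * (fj v * fk v * (f₁ (u + 2 * e) * fi u))) ∧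
    (W0 * Vi + Wi * V0 - Wj * Vk - Wk * Vj = P * (fj v * fk v * (f₁ u * fi (u + 2 * e)))) ∧
    (W0 * Vi - Wi * V0 + Wj * Vk - Wk * Vj = -P * (f₁ v * fi v * (fj (u + 2 * e) * fk u))) ∧
    (W0 * Vi - Wi * V0 - Wj * Vk + Wk * Vj = -P * (f₁ v * fi v * (fj u * fk (u + 2 * e)))) := by
  have a1 := A (u + e) v
  have a2 := A (u + e) (-v)
  have a3 := A (u + e) e
  have a4 := A (u + e) (-e)
  have b1 := B (u + e) v
  have b2 := B (u + e) (-v)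
  have b3 := B (u + e) e
  have b4 := B (u + e) (-e)
  simp only [o1, oi, oj, ok] at a1 a2 a3 a4 b1 b2 b3 b4
  rw [show u + e + v = u + v + e by ring, show u + e - v = u - v + e by ring] at a1 b1
  rw [show u + e + -v = u - v + e by ring, show u + e - -v = u + v + e by ring] at a2 b2
  rw [show u + e + e = u + 2 * e by ring, show u + e - e = u by ring] at a3 b3
  rw [show u + e + -e = u by ring, show u + e - -e = u + 2 * e by ring] at a4 b4
  intro W0 V0 Wi Vi Wj Vj Wk Vk P
  simp only [W0, V0, Wi, Vi, Wj, Vj, Wk, Vk, P]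
  refine ⟨?_, ?_, ?_, ?_⟩ <;> refine mul_right_cancel₀ hq ?_
  · linear_combination (f₁ e * fi e * (fj e * fk e) ^ 2) * (a1 + a2) +
      ((f₁ e * fi e) ^ 2 * (fj e * fk e)) * (b1 + b2) -
      2 * (f₁ e * fi e * fj e * fk e) * (fj v * fk v) * a3
  · linear_combination (f₁ e * fi e * (fj e * fk e) ^ 2) * (a1 + a2) -
      ((f₁ e * fi e) ^ 2 * (fj e * fk e)) * (b1 + b2) -
      2 * (f₁ e * fi e * fj e * fk e) * (fj v * fk v) * a4
  · linear_combination (f₁ e * fi e * (fj e * fk e) ^ 2) * (a2 - a1) +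
      ((f₁ e * fi e) ^ 2 * (fj e * fk e)) * (b2 - b1) +
      2 * (f₁ e * fi e * fj e * fk e) * (f₁ v * fi v) * b3
  · linear_combination (f₁ e * fi e * (fj e * fk e) ^ 2) * (a2 - a1) -
      ((f₁ e * fi e) ^ 2 * (fj e * fk e)) * (b2 - b1) +
      2 * (f₁ e * fi e * fj e * fk e) * (f₁ v * fi v) * b4

/-- The weights of the eight-vertex model at modulus `τ`. -/
def weightVertex (τ e x : ℂ) : Matrix (Fin 2 × Fin 2) (Fin 2 × Fin 2) ℂ :=
  pauliVertex (th1 (x + e) τ * (th2 e τ * th3 e τ * th4 e τ))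
    (th4 (x + e) τ * (th1 e τ * th2 e τ * th3 e τ))
    (th3 (x + e) τ * (th1 e τ * th2 e τ * th4 e τ))
    (th2 (x + e) τ * (th1 e τ * th3 e τ * th4 e τ))

/-- The three-parameter family of solutions of the reflection equation. -/
def boundaryMatrix (τ c0 cx cy cz x : ℂ) : Matrix (Fin 2) (Fin 2) ℂ :=
  pauliMatrix (c0 * (th2 x τ * th3 x τ * th4 x τ)) (cx * (th1 x τ * th2 x τ * th3 x τ))
    (cy * (th1 x τ * th2 x τ * th4 x τ)) (cz * (th1 x τ * th3 x τ * th4 x τ))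

/-- `weight_factorization` is used with θ₂, θ₄ and θ₃ in turn as the distinguished even function,
for the z, x and y components. In every Pauli component two factorized terms then cancel whatever
the constants are, whence a linear family of solutions. -/
theorem boundaryMatrix_reflection {τ : ℂ} (hτ : 0 < τ.im) (e c0 cx cy cz u v : ℂ) :
    weightVertex τ e (u - v) * inFst (boundaryMatrix τ c0 cx cy cz u) * weightVertex τ e (u + v) *
        inSnd (boundaryMatrix τ c0 cx cy cz v) =
      inSnd (boundaryMatrix τ c0 cx cy cz v) * weightVertex τ e (u + v) *
        inFst (boundaryMatrix τ c0 cx cy cz u) * weightVertex τ e (u - v) := by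
  have z2 := th2_zero_ne_zero hτ
  have z3 := th3_zero_ne_zero hτ
  have z4 := th4_zero_ne_zero hτ
  obtain ⟨zS, zD, zP, zM⟩ := weight_factorization (f₁ := fun x => th1 x τ) (fi := fun x => th2 x τ)
    (fj := fun x => th3 x τ) (fk := fun x => th4 x τ) (mul_ne_zero z3 z4) (fun x => th1_neg x τ)
    (fun x => th2_neg x τ) (fun x => th3_neg x τ) (fun x => th4_neg x τ) (add_th1_th2 hτ)
    (add_th3_th4 hτ) u v e
  obtain ⟨xS, xD, xP, xM⟩ := weight_factorization (f₁ := fun x => th1 x τ) (fi := fun x => th4 x τ)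
    (fj := fun x => th2 x τ) (fk := fun x => th3 x τ) (mul_ne_zero z2 z3) (fun x => th1_neg x τ)
    (fun x => th4_neg x τ) (fun x => th2_neg x τ) (fun x => th3_neg x τ) (add_th1_th4 hτ)
    (add_th2_th3 hτ) u v e
  obtain ⟨yS, yD, yP, yM⟩ := weight_factorization (f₁ := fun x => th1 x τ) (fi := fun x => th3 x τ)
    (fj := fun x => th2 x τ) (fk := fun x => th4 x τ) (mul_ne_zero z2 z4) (fun x => th1_neg x τ)
    (fun x => th3_neg x τ) (fun x => th2_neg x τ) (fun x => th4_neg x τ) (add_th1_th3 hτ)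
    (add_th2_th4 hτ) u v e
  unfold weightVertex boundaryMatrix
  generalize th1 (u - v + e) τ = m1 at *
  generalize th2 (u - v + e) τ = m2 at *
  generalize th3 (u - v + e) τ = m3 at *
  generalize th4 (u - v + e) τ = m4 at *
  generalize th1 (u + v + e) τ = p1 at *
  generalize th2 (u + v + e) τ = p2 at *
  generalize th3 (u + v + e) τ = p3 at *
  generalize th4 (u + v + e) τ = p4 at *
  generalize th1 (u + 2 * e) τ = w1 at *
  generalize th2 (u + 2 * e) τ = w2 at *
  generalize th3 (u + 2 * e) τ = w3 at *
  generalize th4 (u + 2 * e) τ = w4 at *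
  generalize th1 u τ = u1 at *
  generalize th2 u τ = u2 at *
  generalize th3 u τ = u3 at *
  generalize th4 u τ = u4 at *
  generalize th1 v τ = v1 at *
  generalize th2 v τ = v2 at *
  generalize th3 v τ = v3 at *
  generalize th4 v τ = v4 at *
  generalize th1 e τ = e1 at *
  generalize th2 e τ = e2 at *
  generalize th3 e τ = e3 at *
  generalize th4 e τ = e4 at *
  refine reflection_of_weights ?_ ?_ ?_ ?_ ?_ ?_ ?_ ?_ ?_ ?_ ?_ ?_
  · linear_combination (cy * (u1 * u2 * u4)) * (cz * (v1 * v3 * v4)) * yS -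
      (cz * (u1 * u3 * u4)) * (cy * (v1 * v2 * v4)) * zS
  · linear_combination (cx * (u1 * u2 * u3)) * (cz * (v1 * v3 * v4)) * xS -
      (cz * (u1 * u3 * u4)) * (cx * (v1 * v2 * v3)) * zS
  · linear_combination (cx * (u1 * u2 * u3)) * (cy * (v1 * v2 * v4)) * xS -
      (cy * (u1 * u2 * u4)) * (cx * (v1 * v2 * v3)) * yS
  · linear_combination (cz * (u1 * u3 * u4)) * (cy * (v1 * v2 * v4)) * yM -
      (cy * (u1 * u2 * u4)) * (cz * (v1 * v3 * v4)) * zM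
  · linear_combination (c0 * (u2 * u3 * u4)) * (cz * (v1 * v3 * v4)) * xD +
      (cz * (u1 * u3 * u4)) * (c0 * (v2 * v3 * v4)) * yM
  · linear_combination (c0 * (u2 * u3 * u4)) * (cy * (v1 * v2 * v4)) * xD +
      (cy * (u1 * u2 * u4)) * (c0 * (v2 * v3 * v4)) * zM
  · linear_combination (cz * (u1 * u3 * u4)) * (cx * (v1 * v2 * v3)) * xM -
      (cx * (u1 * u2 * u3)) * (cz * (v1 * v3 * v4)) * zP
  · linear_combination (cz * (u1 * u3 * u4)) * (c0 * (v2 * v3 * v4)) * xM +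
      (c0 * (u2 * u3 * u4)) * (cz * (v1 * v3 * v4)) * yD
  · linear_combination (c0 * (u2 * u3 * u4)) * (cx * (v1 * v2 * v3)) * yD +
      (cx * (u1 * u2 * u3)) * (c0 * (v2 * v3 * v4)) * zP
  · linear_combination (cy * (u1 * u2 * u4)) * (cx * (v1 * v2 * v3)) * xP -
      (cx * (u1 * u2 * u3)) * (cy * (v1 * v2 * v4)) * yP
  · linear_combination (cy * (u1 * u2 * u4)) * (c0 * (v2 * v3 * v4)) * xP +
      (c0 * (u2 * u3 * u4)) * (cy * (v1 * v2 * v4)) * zD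
  · linear_combination (cx * (u1 * u2 * u3)) * (c0 * (v2 * v3 * v4)) * yP +
      (c0 * (u2 * u3 * u4)) * (cx * (v1 * v2 * v3)) * zD

end EightVertex

end

/-! ### The R-matrix and boundary matrix at modulus ω, and the intertwining vectors. -/

noncomputable section

namespace EightVertex

namespace Chain

variable {N : ℕ} (c : Chain N)

/-- The transpose conjugated with `σʸ`. -/
def adjTwo {𝒜 : Type*} [Ring 𝒜] (T : Matrix (Fin 2) (Fin 2) 𝒜) : Matrix (Fin 2) (Fin 2) 𝒜 :=
  !![T 1 1, -T 0 1; -T 1 0, T 0 0]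

theorem two_im_pos {τ : ℂ} (hτ : 0 < τ.im) : 0 < (2 * τ).im := by
  simpa using hτ

theorem Rden_ne_zero (hω : 0 < c.ω.im) : c.Rden ≠ 0 :=
  mul_ne_zero (th2_zero_ne_zero hω) (th4_zero_ne_zero (two_im_pos hω))

/-- At modulus ω the combinations a ± b and c ± d are, up to a common constant, single products of
theta functions, with x entering only through x + η/2. -/
theorem R₂_eq_weightVertex (hω : 0 < c.ω.im) (x : ℂ) :
    c.R₂ x = (c.Rden * th4 0 (2 * c.ω))⁻¹ • weightVertex c.ω (c.η / 2) x := by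
  have h0 := th4_zero_ne_zero (two_im_pos hω)
  have hD := c.Rden_ne_zero hω
  have e1 := th1_two_mul_double hω (c.η / 2)
  have e4 := th4_two_mul_double hω (c.η / 2)
  rw [show 2 * (c.η / 2) = c.η by ring] at e1 e4
  have h14 := th1_mul_th4_double hω (x + c.η / 2) (c.η / 2) (a := x + c.η) (b := x) (by ring) (by ring)
  have h41 := th4_mul_th1_double hω (x + c.η / 2) (c.η / 2) (a := x + c.η) (b := x) (by ring) (by ring)
  have h44 := th4_mul_th4_double hω (x + c.η / 2) (c.η / 2) (a := x + c.η) (b := x) (by ring) (by ring)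
  have h11 := th1_mul_th1_double hω (x + c.η / 2) (c.η / 2) (a := x + c.η) (b := x) (by ring) (by ring)
  have ea : c.Ra x * (c.Rden * th4 0 (2 * c.ω)) =
      2 * (th4 c.η (2 * c.ω) * th4 0 (2 * c.ω)) * (th1 (x + c.η) (2 * c.ω) * th4 x (2 * c.ω)) := by
    unfold Ra; field_simp
  have eb : c.Rb x * (c.Rden * th4 0 (2 * c.ω)) =
      2 * (th4 c.η (2 * c.ω) * th4 0 (2 * c.ω)) * (th4 (x + c.η) (2 * c.ω) * th1 x (2 * c.ω)) := by
    unfold Rb; field_simp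
  have ec : c.Rc x * (c.Rden * th4 0 (2 * c.ω)) =
      2 * (th1 c.η (2 * c.ω) * th4 0 (2 * c.ω)) * (th4 (x + c.η) (2 * c.ω) * th4 x (2 * c.ω)) := by
    unfold Rc; field_simp
  have ed : c.Rd x * (c.Rden * th4 0 (2 * c.ω)) =
      2 * (th1 c.η (2 * c.ω) * th4 0 (2 * c.ω)) * (th1 (x + c.η) (2 * c.ω) * th1 x (2 * c.ω)) := by
    unfold Rd; field_simp
  rw [e4, h14] at ea
  rw [e4, h41] at eb
  rw [e1, h44] at ec
  rw [e1, h11] at ed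
  rw [eq_inv_smul_iff₀ (mul_ne_zero hD h0)]
  ext ⟨i, j⟩ ⟨k, l⟩
  fin_cases i <;> fin_cases j <;> fin_cases k <;> fin_cases l <;>
    simp [R₂, weightVertex, pauliVertex, eightVertex] <;>
    first
    | linear_combination ea
    | linear_combination eb
    | linear_combination ec
    | linear_combination ed

/-- Only membership in the linear family matters afterwards: it gives both the reflection equation
and the entire dependence on x. -/
theorem Kreg_eq_boundaryMatrix (hω : 0 < c.ω.im) : ∃ c0 cx cy cz : ℂ, ∀ x,
    c.Kreg x = boundaryMatrix c.ω c0 cx cy cz x := by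
  have h0 := th4_zero_ne_zero (two_im_pos hω)
  set f := th4 0 (2 * c.ω) with hf
  set Z := th4 c.ζ (2 * c.ω) / th1 c.ζ (2 * c.ω) with hZ
  set Q := c.κ * th4 c.ζ (2 * c.ω) ^ 3 / (th1 c.ζ (2 * c.ω) * f ^ 2) with hQ
  set E := Complex.exp c.τ with hE
  set E' := Complex.exp (-c.τ) with hE'
  have hEE : E * E' = 1 := by rw [hE, hE', ← Complex.exp_add]; simp
  have h2 : Complex.exp (2 * c.τ) = E * E := by rw [hE, ← Complex.exp_add]; ring_nf
  have h2' : Complex.exp (-2 * c.τ) = E' * E' := by rw [hE', ← Complex.exp_add]; ring_nf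
  -- The diagonal entries split by the addition formulas at ζ ± x. The off-diagonal ones split into
  -- their cosh τ and sinh τ parts, in which θ₄² ∓ θ₁² of modulus 2ω are multiples of θ₃ and θ₄ of
  -- modulus ω.
  refine ⟨th1 c.ζ c.ω * Z / (2 * f), Q / f * ((E + E') / 2) * th4 0 c.ω,
    Q / f * ((E - E') / 2) * th3 0 c.ω, th2 c.ζ c.ω * Z / (2 * f), fun x => ?_⟩
  have g1 := th1_two_mul_double hω x
  have g4 := th4_two_mul_double hω x
  have s1 := th4_sq_sub_th1_sq hω x
  have s2 := th4_sq_add_th1_sq hω x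
  have p1 := th1_mul_th4_double hω c.ζ x (a := x + c.ζ) (b := c.ζ - x) (by ring) (by ring)
  have p2 := th4_mul_th1_double hω c.ζ x (a := x + c.ζ) (b := c.ζ - x) (by ring) (by ring)
  rw [← hf, ← eq_div_iff h0] at g1 g4
  have q1 : ∀ k l A : ℂ, c.κ * k * th1 (2 * x) (2 * c.ω) * A * th4 c.ζ (2 * c.ω) ^ 3 /
      (th1 c.ζ (2 * c.ω) * f ^ 2) = Q * k * A * th1 (2 * x) (2 * c.ω) := by
    intros; rw [hQ]; ring
  ext i j
  fin_cases i <;> fin_cases j <;>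
    simp [Kreg, boundaryMatrix, pauliMatrix, ← hf, ← hE, ← hE']
  · rw [g4]
    linear_combination (th3 x c.ω * th4 x c.ω / f * Z) * p1
  · rw [q1 _ 0, g1, show Complex.exp (-(2 * c.τ)) = E' * E' by rw [← h2']; ring_nf]
    linear_combination (Q * (th1 x c.ω * th2 x c.ω) / f) * ((E + E') / 2 * s1 + (E - E') / 2 * s2) -
      Q * (th1 x c.ω * th2 x c.ω) / f * E' * th1 x (2 * c.ω) ^ 2 * hEE
  · rw [q1 _ 0, g1, h2]
    linear_combination (Q * (th1 x c.ω * th2 x c.ω) / f) * ((E + E') / 2 * s1 - (E - E') / 2 * s2) -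
      Q * (th1 x c.ω * th2 x c.ω) / f * E * th1 x (2 * c.ω) ^ 2 * hEE
  · rw [g4]
    linear_combination (th3 x c.ω * th4 x c.ω / f * Z) * p2

theorem Kreg_reflection (hω : 0 < c.ω.im) (u v : ℂ) :
    c.R₂ (u - v) * inFst (c.Kreg u) * c.R₂ (u + v) * inSnd (c.Kreg v) =
      inSnd (c.Kreg v) * c.R₂ (u + v) * inFst (c.Kreg u) * c.R₂ (u - v) := by
  obtain ⟨c0, cx, cy, cz, h⟩ := c.Kreg_eq_boundaryMatrix hω
  have := boundaryMatrix_reflection hω (c.η / 2) c0 cx cy cz u v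
  simp only [R₂_eq_weightVertex c hω, h, Matrix.smul_mul, Matrix.mul_smul, this]

/-! ### Intertwining vectors -/

/-- The vector `(θ₂, θ₃)` of modulus `2ω`. -/
def vv (y : ℂ) : Fin 2 → ℂ := ![th2 y (2 * c.ω), th3 y (2 * c.ω)]

/-- The covector `(-θ₃, θ₂)` of modulus `2ω`. -/
def wv (y : ℂ) : Fin 2 → ℂ := ![-th3 y (2 * c.ω), th2 y (2 * c.ω)]

theorem vv_neg (y : ℂ) : c.vv (-y) = c.vv y := by simp [vv, th2_neg, th3_neg]

theorem wv_neg (y : ℂ) : c.wv (-y) = c.wv y := by simp [wv, th2_neg, th3_neg]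

theorem θ_neg (y : ℂ) : c.θ (-y) = -c.θ y := th1_neg _ _

theorem θ_zero : c.θ 0 = 0 := th1_zero _

theorem wv_dot_vv (hω : 0 < c.ω.im) {a b : ℂ} (x y : ℂ) (ha : a = x + y) (hb : b = x - y) :
    ∑ i, c.wv a i * c.vv b i = -(c.θ x * c.θ y) := by
  rw [θ, θ, ← th2_th3_wronskian hω x y ha hb]
  simp [Fin.sum_univ_two, wv, vv]; ring

theorem θ_eq (hω : 0 < c.ω.im) (u : ℂ) : c.θ u * c.Rden =
    2 * (th1 u (2 * c.ω) * th4 u (2 * c.ω)) * th4 0 (2 * c.ω) := by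
  rw [th1_mul_th4_same hω, θ, Rden]; ring

/-- This is the vertex-face correspondence: under the condition on q the tensor product of two gauge
vectors stays decomposable under R. Since v is even, negating all arguments gives `R_mul_vv'`. -/
theorem R_mul_vv (hω : 0 < c.ω.im) {u p q p' q' : ℂ} (hq : q = p - (u + c.η)) (hp' : p' = p - c.η)
    (hq' : q' = p - u) (i j : Fin 2) :
    ∑ k, ∑ m, c.R u i k j m * (c.vv p k * c.vv q m) = c.θ (u + c.η) * (c.vv p' i * c.vv q' j) := by
  subst hq hp' hq'
  have hD := c.Rden_ne_zero hω
  have e1 := intertwine_even hω p u c.η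
  have e2 := intertwine_even' hω p u c.η
  have o1 := intertwine_odd hω p u c.η
  have o2 := intertwine_odd' hω p u c.η
  have ht := c.θ_eq hω (u + c.η)
  rw [← eq_div_iff hD] at ht
  rw [ht, sub_add_eq_sub_sub]
  fin_cases i <;> fin_cases j <;> simp [R, vv, Fin.sum_univ_two, Ra, Rb, Rc, Rd] <;> field_simp
  · linear_combination th1 (u + c.η) (2 * c.ω) * e1
  · linear_combination th4 (u + c.η) (2 * c.ω) * o1
  · linear_combination th4 (u + c.η) (2 * c.ω) * o2
  · linear_combination th1 (u + c.η) (2 * c.ω) * e2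

theorem R_mul_vv' (hω : 0 < c.ω.im) {u p q p' q' : ℂ} (hq : q = p + (u + c.η)) (hp' : p' = p + c.η)
    (hq' : q' = p + u) (i j : Fin 2) :
    ∑ k, ∑ m, c.R u i k j m * (c.vv p k * c.vv q m) = c.θ (u + c.η) * (c.vv p' i * c.vv q' j) := by
  have := c.R_mul_vv hω (u := u) (p := -p) (q := -q) (p' := -p') (q' := -q')
    (by rw [hq]; ring) (by rw [hp']; ring) (by rw [hq']; ring) i j
  simpa only [vv_neg] using this

theorem wv_mul_R (hω : 0 < c.ω.im) {u p q p' q' : ℂ} (hq : q = p - (u + c.η)) (hp' : p' = p - c.η)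
    (hq' : q' = p - u) (k m : Fin 2) :
    ∑ i, ∑ j, c.wv p i * c.wv q j * c.R u i k j m = c.θ (u + c.η) * (c.wv p' k * c.wv q' m) := by
  subst hq hp' hq'
  have hD := c.Rden_ne_zero hω
  have e1 := intertwine_even hω p u c.η
  have e2 := intertwine_even' hω p u c.η
  have o1 := intertwine_odd hω p u c.η
  have o2 := intertwine_odd' hω p u c.η
  have ht := c.θ_eq hω (u + c.η)
  rw [← eq_div_iff hD] at ht
  rw [ht, sub_add_eq_sub_sub]
  fin_cases k <;> fin_cases m <;> simp [R, wv, Fin.sum_univ_two, Ra, Rb, Rc, Rd] <;> field_simp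
  · linear_combination th1 (u + c.η) (2 * c.ω) * e2
  · linear_combination -th4 (u + c.η) (2 * c.ω) * o2
  · linear_combination -th4 (u + c.η) (2 * c.ω) * o1
  · linear_combination th1 (u + c.η) (2 * c.ω) * e1

/-- Here the covector acts in the second space and the vector in the first. -/
theorem wv_mul_R_mul_vv (hω : 0 < c.ω.im) {u p q p' q' : ℂ} (hq : q = p + u) (hp' : p' = p - c.η)
    (hq' : q' = q + c.η) (i m : Fin 2) :
    ∑ j, ∑ k, c.wv q j * c.R u i k j m * c.vv p k = c.θ u * (c.vv p' i * c.wv q' m) := by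
  subst hq hp' hq'
  have hD := c.Rden_ne_zero hω
  -- Crossing: the mixed relation rests on the same four identities, taken at -u - η instead of u.
  have e1 := intertwine_even hω p (-u - c.η) c.η
  have e2 := intertwine_even' hω p (-u - c.η) c.η
  have o1 := intertwine_odd hω p (-u - c.η) c.η
  have o2 := intertwine_odd' hω p (-u - c.η) c.η
  have ht := c.θ_eq hω u
  rw [← eq_div_iff hD] at ht
  rw [ht]
  rw [show p - (-u - c.η) - c.η = p + u by ring, show p - (-u - c.η) = p + u + c.η by ring,
    show -u - c.η + c.η = -u by ring, show -u - c.η = -(u + c.η) by ring] at e1 e2 o1 o2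
  simp only [th1_neg, th4_neg] at e1 e2 o1 o2
  fin_cases i <;> fin_cases m <;> simp [R, vv, wv, Fin.sum_univ_two, Ra, Rb, Rc, Rd] <;> field_simp
  · linear_combination th4 u (2 * c.ω) * o1
  · linear_combination th1 u (2 * c.ω) * e1
  · linear_combination -th1 u (2 * c.ω) * e2
  · linear_combination -th4 u (2 * c.ω) * o2

theorem R_swap (u : ℂ) (i j k m : Fin 2) : c.R u i k j m = c.R u j m i k := by
  fin_cases i <;> fin_cases j <;> fin_cases k <;> fin_cases m <;> rfl

/-- At u = 0 the weights b and d vanish and a = c, so R is a multiple of the permutation. This is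
used to move an auxiliary index onto a site. -/
theorem R_zero (hω : 0 < c.ω.im) (i j k m : Fin 2) :
    c.R 0 i k j m = if i = m ∧ j = k then c.θ c.η else 0 := by
  have hD := c.Rden_ne_zero hω
  have ht := c.θ_eq hω c.η
  rw [← eq_div_iff hD] at ht
  rw [ht]
  fin_cases i <;> fin_cases j <;> fin_cases k <;> fin_cases m <;>
    simp [R, Ra, Rb, Rc, Rd, th1_zero] <;> ring

theorem R_crossing (u : ℂ) : adjTwo (c.R (-u - c.η)) = -c.R u := by
  have e1 : -u - c.η + c.η = -u := by ring
  have e2 : -u - c.η = -(u + c.η) := by ring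
  ext i k j m
  fin_cases i <;> fin_cases k <;> fin_cases j <;> fin_cases m <;>
    simp [adjTwo, R, Ra, Rb, Rc, Rd, e1] <;> simp only [e2, th1_neg, th4_neg] <;> ring

theorem R_unitarity (hω : 0 < c.ω.im) (u : ℂ) :
    c.R u * c.R (-u) = (c.θ (c.η + u) * c.θ (c.η - u)) • 1 := by
  have hD := c.Rden_ne_zero hω
  have t1 := c.θ_eq hω (c.η + u)
  have t2 := c.θ_eq hω (c.η - u)
  rw [← eq_div_iff hD] at t1 t2
  have p1 := th4_th1_product hω c.η u 0
  have p2 := th1_th4_difference (two_im_pos hω) c.η u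
  simp only [add_zero] at p1
  rw [t1, t2]
  ext i k j m
  fin_cases i <;> fin_cases k <;> fin_cases j <;> fin_cases m <;>
    simp [Matrix.mul_apply, Fin.sum_univ_two, R, Ra, Rb, Rc, Rd, th1_neg, th4_neg,
      show -u + c.η = c.η - u by ring, show u + c.η = c.η + u by ring] <;> field_simp
  all_goals first
    | ring1
    | linear_combination th1 (c.η + u) (2 * c.ω) * th1 (c.η - u) (2 * c.ω) * p1
    | linear_combination th4 (c.η + u) (2 * c.ω) * th4 (c.η - u) (2 * c.ω) * p2

end Chain

end EightVertex

end

noncomputable section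

namespace EightVertex

namespace Chain

variable {N : ℕ} (c : Chain N)

/-! ### Operators acting on one site -/

theorem site_transpose (n : Fin N) (A : Matrix (Fin 2) (Fin 2) ℂ) (h k : Fin N → Fin 2) :
    site n A h k = site n Aᵀ k h := by
  simp only [site, transpose_apply]
  congr 1
  simp only [eq_comm]

theorem sum_mul_site (n : Fin N) (A : Matrix (Fin 2) (Fin 2) ℂ) (f : (Fin N → Fin 2) → ℂ)
    (k : Fin N → Fin 2) :
    ∑ h, f h * site n A h k = ∑ i, f (Function.update k n i) * A i (k n) := by
  symm
  refine Finset.sum_of_injOn (fun i => Function.update k n i)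
    (fun i _ j _ h => by simpa using congrFun h n) (fun _ _ => Finset.mem_coe.2 (Finset.mem_univ _))
    ?_ ?_
  · intro h _ hh
    rw [site, if_neg, mul_zero]
    intro hc
    refine hh ⟨h n, by simp, ?_⟩
    ext m : 1
    by_cases hm : m = n
    · subst hm; simp
    · simp [hm, hc m hm]
  · intro i _
    simp only [site]
    rw [if_pos]
    · simp
    · intro m hm; simp [hm]

theorem sum_site_mul (n : Fin N) (A : Matrix (Fin 2) (Fin 2) ℂ) (f : (Fin N → Fin 2) → ℂ)
    (h : Fin N → Fin 2) :
    ∑ k, site n A h k * f k = ∑ i, A (h n) i * f (Function.update h n i) := by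
  have := sum_mul_site n Aᵀ f h
  simpa only [← site_transpose, transpose_apply, mul_comm] using this

theorem site_mul (n : Fin N) (A B : Matrix (Fin 2) (Fin 2) ℂ) :
    site n (A * B) = site n A * site n B := by
  ext h k
  rw [Matrix.mul_apply, sum_site_mul]
  have : ∀ i, (∀ m, m ≠ n → Function.update h n i m = k m) ↔ ∀ m, m ≠ n → h m = k m := fun i =>
    forall₂_congr fun m hm => by rw [Function.update_of_ne hm]
  simp only [site, this, Function.update_self]
  split_ifs <;> simp [Matrix.mul_apply]

theorem site_one (n : Fin N) : site n 1 = 1 := by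
  ext h k
  simp only [site, Matrix.one_apply]
  by_cases e : h = k
  · subst e; simp
  · rw [if_neg e]
    split_ifs with h1 h2
    · exact absurd (funext fun m => if hm : m = n then hm ▸ h2 else h1 m hm) e
    · rfl
    · rfl

/-- `site n` as an algebra homomorphism. -/
def siteAlg (n : Fin N) : Matrix (Fin 2) (Fin 2) ℂ →ₐ[ℂ] Op N :=
  AlgHom.ofLinearMap
    { toFun := site n
      map_add' := fun A B => by ext h k; simp only [site, Matrix.add_apply]; split_ifs <;> simp
      map_smul' := fun z A => by
        ext h k; simp only [site, Matrix.smul_apply, RingHom.id_apply]; split_ifs <;> simp }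
    (site_one n) (fun A B => site_mul n A B)

theorem siteAlg_apply (n : Fin N) (A : Matrix (Fin 2) (Fin 2) ℂ) : siteAlg n A = site n A := rfl

theorem site_mul_site {n m : Fin N} (hnm : n ≠ m) (A B : Matrix (Fin 2) (Fin 2) ℂ)
    (h k : Fin N → Fin 2) : (site n A * site m B) h k =
      if ∀ p, p ≠ n → p ≠ m → h p = k p then A (h n) (k n) * B (h m) (k m) else 0 := by
  rw [Matrix.mul_apply, sum_site_mul]
  have h1 : ∀ i, site m B (Function.update h n i) k =
      if i = k n then (if ∀ p, p ≠ n → p ≠ m → h p = k p then B (h m) (k m) else 0) else 0 := by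
    intro i
    simp only [site, Function.update_of_ne hnm.symm]
    rw [← ite_and]
    congr 1
    refine propext ⟨fun H => ⟨by simpa using H n hnm, fun p hn hm => ?_⟩, fun H p hm => ?_⟩
    · simpa [hn] using H p hm
    · by_cases hp : p = n
      · subst hp; simpa using H.1
      · simpa [hp] using H.2 p hp hm
  simp only [h1]
  simp

theorem site_commute {n m : Fin N} (hnm : n ≠ m) (A B : Matrix (Fin 2) (Fin 2) ℂ) :
    Commute (site n A) (site m B) := by
  ext h k
  rw [site_mul_site hnm, site_mul_site hnm.symm]
  simp only [mul_comm (A _ _)]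
  congr 1
  exact propext ⟨fun H p h1 h2 => H p h2 h1, fun H p h1 h2 => H p h2 h1⟩

/-- A product covector. -/
def cov (w : Fin N → Fin 2 → ℂ) : (Fin N → Fin 2) → ℂ := fun h => ∏ n, w n (h n)

theorem cov_update (w : Fin N → Fin 2 → ℂ) (n : Fin N) (z : Fin 2 → ℂ) (h : Fin N → Fin 2) :
    cov (Function.update w n z) h = z (h n) * ∏ m ∈ Finset.univ.erase n, w m (h m) := by
  rw [cov, ← Finset.mul_prod_erase _ _ (Finset.mem_univ n), Function.update_self]
  congr 1
  refine Finset.prod_congr rfl fun m hm => ?_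
  rw [Function.update_of_ne (Finset.ne_of_mem_erase hm)]

theorem cov_vecMul_site (w : Fin N → Fin 2 → ℂ) (n : Fin N) (A : Matrix (Fin 2) (Fin 2) ℂ) :
    cov w ᵥ* site n A = cov (Function.update w n (w n ᵥ* A)) := by
  ext k
  have h1 : ∀ i, cov w (Function.update k n i) = w n i * ∏ m ∈ Finset.univ.erase n, w m (k m) := by
    intro i
    rw [cov, ← Finset.mul_prod_erase _ _ (Finset.mem_univ n), Function.update_self]
    congr 1
    refine Finset.prod_congr rfl fun m hm => ?_
    rw [Function.update_of_ne (Finset.ne_of_mem_erase hm)]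
  change ∑ h, cov w h * site n A h k = _
  rw [sum_mul_site, cov_update]
  change _ = (∑ i, w n i * A i (k n)) * _
  rw [Finset.sum_mul]
  refine Finset.sum_congr rfl fun i _ => ?_
  rw [h1]; ring

/-! ### The boundary monodromy matrix, site by site -/

/-- The factor of the monodromy matrix at the site `n`. -/
def lax (n : Fin N) (u : ℂ) : Matrix (Fin 2) (Fin 2) (Op N) := (c.R u).map (site n)

/-- The boundary monodromy matrix of the sites in a list, in the variable `x = λ - η/2`. -/
def Ur (x : ℂ) : List (Fin N) → Matrix (Fin 2) (Fin 2) (Op N)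
  | [] => aux (c.Kreg x)
  | n :: l => c.lax n (x - c.ξ n) * Ur x l * c.lax n (x + c.ξ n)

theorem commute_mul_apply {𝒜 : Type*} [Ring 𝒜] {A B : Matrix (Fin 2) (Fin 2) 𝒜} {X : 𝒜}
    (hA : ∀ i j, Commute X (A i j)) (hB : ∀ i j, Commute X (B i j)) (i j : Fin 2) :
    Commute X ((A * B) i j) := by
  rw [Matrix.mul_apply]
  exact Commute.sum_right _ _ _ fun k _ => (hA i k).mul_right (hB k j)

theorem aux_commute (X : Op N) (S : Matrix (Fin 2) (Fin 2) ℂ) (i j : Fin 2) :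
    Commute X (aux (N := N) S i j) := by
  simp only [aux, Matrix.map_apply]
  exact (Commute.one_right X).smul_right _

theorem site_commute_Ur {m : Fin N} (A : Matrix (Fin 2) (Fin 2) ℂ) (x : ℂ) :
    ∀ {l : List (Fin N)}, m ∉ l → ∀ i j, Commute (site m A) (c.Ur x l i j)
  | [], _, i, j => aux_commute _ _ i j
  | n :: l, h, i, j => by
    have hmn : m ≠ n := fun e => h (e ▸ List.mem_cons_self)
    exact commute_mul_apply (commute_mul_apply (fun _ _ => site_commute hmn _ _)
      (site_commute_Ur A x fun hl => h (List.mem_cons_of_mem _ hl)))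
      (fun _ _ => site_commute hmn _ _) i j

theorem aux_eq_scal (S : Matrix (Fin 2) (Fin 2) ℂ) : aux (N := N) S = scal (Op N) S := rfl

theorem inFst_map {𝒜 ℬ : Type*} [Ring 𝒜] [Ring ℬ] (f : 𝒜 →+* ℬ) (T : Matrix (Fin 2) (Fin 2) 𝒜) :
    inFst (T.map f) = (inFst T).map f := by
  ext p q; simp only [inFst, Matrix.map_apply]; split_ifs <;> simp

theorem inSnd_map {𝒜 ℬ : Type*} [Ring 𝒜] [Ring ℬ] (f : 𝒜 →+* ℬ) (T : Matrix (Fin 2) (Fin 2) 𝒜) :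
    inSnd (T.map f) = (inSnd T).map f := by
  ext p q; simp only [inSnd, Matrix.map_apply]; split_ifs <;> simp

theorem scal_map {𝒜 ℬ : Type*} [Ring 𝒜] [Ring ℬ] [Algebra ℂ 𝒜] [Algebra ℂ ℬ] (f : 𝒜 →ₐ[ℂ] ℬ)
    {ι : Type*} (S : Matrix ι ι ℂ) : (scal 𝒜 S).map f = scal ℬ S := by
  ext p q; simp [scal]

theorem scal_mul {𝒜 : Type*} [Ring 𝒜] [Algebra ℂ 𝒜] {ι : Type*} [Fintype ι] (S T : Matrix ι ι ℂ) :
    scal 𝒜 (S * T) = scal 𝒜 S * scal 𝒜 T := by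
  ext p q; simp [scal, Matrix.mul_apply, Finset.sum_smul, smul_smul, mul_comm]

theorem inFst_scal {𝒜 : Type*} [Ring 𝒜] [Algebra ℂ 𝒜] (S : Matrix (Fin 2) (Fin 2) ℂ) :
    inFst (scal 𝒜 S) = scal 𝒜 (inFst S) := by
  ext p q; simp only [inFst, scal, Matrix.map_apply]; split_ifs <;> simp

theorem inSnd_scal {𝒜 : Type*} [Ring 𝒜] [Algebra ℂ 𝒜] (S : Matrix (Fin 2) (Fin 2) ℂ) :
    inSnd (scal 𝒜 S) = scal 𝒜 (inSnd S) := by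
  ext p q; simp only [inSnd, scal, Matrix.map_apply]; split_ifs <;> simp

/-- The R-matrix between the two auxiliary spaces. -/
def R₂' (u : ℂ) : Matrix (Fin 2 × Fin 2) (Fin 2 × Fin 2) (Op N) := scal (Op N) (c.R₂ u)

theorem R₂_lax_lax (hω : 0 < c.ω.im) (n : Fin N) {u v w : ℂ} (h : v = u + w) :
    c.R₂' u * inFst (c.lax n v) * inSnd (c.lax n w) =
      inSnd (c.lax n w) * inFst (c.lax n v) * c.R₂' u := by
  subst h
  have := congrArg (fun T => T.map (siteAlg n)) (c.ybWeights hω u w).mul_fst_snd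
  simp only [Matrix.map_mul, scal_map] at this
  have e1 := inFst_map (siteAlg n : _ →+* Op N) (c.R (u + w))
  have e2 := inSnd_map (siteAlg n : _ →+* Op N) (c.R w)
  rw [lax, lax, R₂']
  exact (congrArg₂ (fun a b => scal (Op N) (c.R₂ u) * a * b) e1 e2).trans
    (this.trans (congrArg₂ (fun a b => a * b * scal (Op N) (c.R₂ u)) e2.symm e1.symm))

theorem lax_R₂_lax (hω : 0 < c.ω.im) (n : Fin N) {u v w : ℂ} (h : v = u + w) :
    inFst (c.lax n u) * c.R₂' v * inSnd (c.lax n w) =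
      inSnd (c.lax n w) * c.R₂' v * inFst (c.lax n u) := by
  subst h
  have := congrArg (fun T => T.map (siteAlg n)) (c.ybWeights hω u w).mul_fst_scal_snd
  simp only [Matrix.map_mul, scal_map] at this
  have e1 := inFst_map (siteAlg n : _ →+* Op N) (c.R u)
  have e2 := inSnd_map (siteAlg n : _ →+* Op N) (c.R w)
  rw [lax, lax, R₂']
  exact (congrArg₂ (fun a b => a * scal (Op N) (c.R₂ (u + w)) * b) e1 e2).trans
    (this.trans (congrArg₂ (fun a b => a * scal (Op N) (c.R₂ (u + w)) * b) e2.symm e1.symm))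

/-- Sklyanin's dressing: the factors of the outer site pass the R-matrices by the Yang-Baxter
equation and commute with the inner monodromy, whose sites are different. What remains in the middle
is the induction hypothesis. -/
theorem Ur_reflection (hω : 0 < c.ω.im) (u v : ℂ) : ∀ {l : List (Fin N)}, l.Nodup →
    c.R₂' (u - v) * inFst (c.Ur u l) * c.R₂' (u + v) * inSnd (c.Ur v l) =
      inSnd (c.Ur v l) * c.R₂' (u + v) * inFst (c.Ur u l) * c.R₂' (u - v)
  | [], _ => by
    simp only [Ur, R₂', aux_eq_scal, inFst_scal, inSnd_scal, ← scal_mul, c.Kreg_reflection hω u v]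
  | n :: l, hl => by
    obtain ⟨hn, hl⟩ := List.nodup_cons.1 hl
    have IH := Ur_reflection hω u v hl
    simp only [Ur, inFst_mul, inSnd_mul]
    have y1 := c.R₂_lax_lax hω n (u := u - v) (v := u - c.ξ n) (w := v - c.ξ n) (by ring)
    have y2 := c.R₂_lax_lax hω n (u := u - v) (v := u + c.ξ n) (w := v + c.ξ n) (by ring)
    have y3 := c.lax_R₂_lax hω n (u := u + c.ξ n) (v := u + v) (w := v - c.ξ n) (by ring)
    have y4 := c.lax_R₂_lax hω n (u := u - c.ξ n) (v := u + v) (w := v + c.ξ n) (by ring)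
    have k1 : inFst (c.Ur u l) * inSnd (c.lax n (v - c.ξ n)) =
        inSnd (c.lax n (v - c.ξ n)) * inFst (c.Ur u l) :=
      inFst_inSnd_comm fun i j k m => (c.site_commute_Ur _ u hn i j).symm
    have k2 : inFst (c.lax n (u + c.ξ n)) * inSnd (c.Ur v l) =
        inSnd (c.Ur v l) * inFst (c.lax n (u + c.ξ n)) :=
      inFst_inSnd_comm fun i j k m => c.site_commute_Ur _ v hn k m
    have k3 : inFst (c.lax n (u - c.ξ n)) * inSnd (c.Ur v l) =
        inSnd (c.Ur v l) * inFst (c.lax n (u - c.ξ n)) :=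
      inFst_inSnd_comm fun i j k m => c.site_commute_Ur _ v hn k m
    have k4 : inFst (c.Ur u l) * inSnd (c.lax n (v + c.ξ n)) =
        inSnd (c.lax n (v + c.ξ n)) * inFst (c.Ur u l) :=
      inFst_inSnd_comm fun i j k m => (c.site_commute_Ur _ u hn i j).symm
    generalize c.R₂' (u - v) = Rm at *
    generalize c.R₂' (u + v) = Rp at *
    generalize inFst (c.lax n (u - c.ξ n)) = L1 at *
    generalize inSnd (c.lax n (v - c.ξ n)) = L2 at *
    generalize inFst (c.lax n (u + c.ξ n)) = M1 at *
    generalize inSnd (c.lax n (v + c.ξ n)) = M2 at *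
    generalize inFst (c.Ur u l) = U1 at *
    generalize inSnd (c.Ur v l) = U2 at *
    calc Rm * (L1 * U1 * M1) * Rp * (L2 * U2 * M2)
        = Rm * L1 * U1 * (M1 * Rp * L2) * U2 * M2 := by simp only [mul_assoc]
      _ = Rm * L1 * (U1 * L2) * Rp * (M1 * U2) * M2 := by rw [y3]; simp only [mul_assoc]
      _ = (Rm * L1 * L2) * U1 * Rp * U2 * M1 * M2 := by rw [k1, k2]; simp only [mul_assoc]
      _ = L2 * L1 * (Rm * U1 * Rp * U2) * M1 * M2 := by rw [y1]; simp only [mul_assoc]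
      _ = L2 * L1 * U2 * Rp * U1 * (Rm * M1 * M2) := by rw [IH]; simp only [mul_assoc]
      _ = L2 * (L1 * U2) * Rp * (U1 * M2) * M1 * Rm := by rw [y2]; simp only [mul_assoc]
      _ = L2 * U2 * (L1 * Rp * M2) * U1 * M1 * Rm := by rw [k3, k4]; simp only [mul_assoc]
      _ = L2 * U2 * M2 * Rp * (L1 * U1 * M1) * Rm := by rw [y4]; simp only [mul_assoc]

/-- This makes K(x)K(-x) the scalar det K(x), the innermost step of `Ur_unitarity`; the Lax factors
around it then cancel in pairs. -/
theorem Kreg_neg (x : ℂ) : c.Kreg (-x) = (c.Kreg x).adjugate := by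
  rw [Matrix.adjugate_fin_two]
  ext i j
  fin_cases i <;> fin_cases j <;>
    simp [Kreg, mul_neg, th1_neg, th4_neg, sub_eq_add_neg, add_comm, neg_div, mul_right_comm]

/-- The scalar `𝒰(x) 𝒰(-x)`. -/
def qdet (x : ℂ) (l : List (Fin N)) : ℂ :=
  (c.Kreg x).det * (l.map fun n => c.θ (c.η + (x - c.ξ n)) * c.θ (c.η - (x - c.ξ n)) *
    (c.θ (c.η + (x + c.ξ n)) * c.θ (c.η - (x + c.ξ n)))).prod

theorem lax_unitarity (hω : 0 < c.ω.im) (n : Fin N) {u v : ℂ} (h : v = -u) :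
    c.lax n u * c.lax n v = (c.θ (c.η + u) * c.θ (c.η - u)) • 1 := by
  subst h
  have := congrArg (fun T => T.map (siteAlg n)) (c.R_unitarity hω u)
  simp only [Matrix.map_mul] at this
  refine this.trans ?_
  ext1 i j
  simp only [Matrix.map_apply, Matrix.smul_apply, map_smul, Matrix.one_apply]
  split_ifs <;> simp

theorem Ur_unitarity (hω : 0 < c.ω.im) (x : ℂ) : ∀ l : List (Fin N),
    c.Ur x l * c.Ur (-x) l = c.qdet x l • 1
  | [] => by
    rw [Ur, Ur, Kreg_neg, aux_eq_scal, aux_eq_scal, ← scal_mul, Matrix.mul_adjugate, qdet]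
    ext1 i j
    simp only [scal, Matrix.map_apply, Matrix.smul_apply, Matrix.one_apply]
    split_ifs <;> simp
  | n :: l => by
    have IH := Ur_unitarity hω x l
    have h1 := c.lax_unitarity hω n (u := x + c.ξ n) (v := -x - c.ξ n) (by ring)
    have h2 := c.lax_unitarity hω n (u := x - c.ξ n) (v := -x + c.ξ n) (by ring)
    calc c.Ur x (n :: l) * c.Ur (-x) (n :: l)
        = c.lax n (x - c.ξ n) * (c.Ur x l * (c.lax n (x + c.ξ n) * c.lax n (-x - c.ξ n)) *
          c.Ur (-x) l) * c.lax n (-x + c.ξ n) := by simp only [Ur, mul_assoc]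
      _ = _ := by
        rw [h1, mul_smul_comm, mul_one, smul_mul_assoc, IH, mul_smul_comm, mul_smul_comm, mul_one,
          smul_mul_assoc, smul_mul_assoc, h2, smul_smul, smul_smul]
        congr 1
        simp only [qdet, List.map_cons, List.prod_cons]
        ring

/-! ### Crossing -/

theorem adjTwo_mul {𝒜 : Type*} [Ring 𝒜] {A B : Matrix (Fin 2) (Fin 2) 𝒜}
    (h : ∀ i j k l, Commute (A i j) (B k l)) : adjTwo (A * B) = adjTwo B * adjTwo A := by
  ext i j
  fin_cases i <;> fin_cases j <;>
    simp [adjTwo, Matrix.mul_apply, Fin.sum_univ_two, (h _ _ _ _).eq] <;> abel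

theorem lax_crossing (n : Fin N) {u v : ℂ} (h : v = -u - c.η) :
    adjTwo (c.lax n v) = -c.lax n u := by
  subst h
  have := congrArg (fun T => T.map (siteAlg n)) (c.R_crossing u)
  ext1 i j
  have := congrFun (congrFun this i) j
  fin_cases i <;> fin_cases j <;>
    simpa [adjTwo, lax, ← siteAlg_apply n] using this

theorem lax_commute_prod {m : Fin N} (v : ℂ) (f : Fin N → ℂ) :
    ∀ {l : List (Fin N)}, m ∉ l → ∀ i j k p, Commute (c.lax m v i j)
      ((l.map fun n => c.lax n (f n)).prod k p)
  | [], _, i, j, k, p => by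
    simp only [List.map_nil, List.prod_nil, Matrix.one_apply]
    split_ifs <;> simp
  | n :: l, h, i, j, k, p => by
    have hmn : m ≠ n := fun e => h (e ▸ List.mem_cons_self)
    rw [List.map_cons, List.prod_cons]
    exact commute_mul_apply (fun _ _ => site_commute hmn _ _)
      (fun _ _ => lax_commute_prod v f (fun hl => h (List.mem_cons_of_mem _ hl)) _ _ _ _) k p

/-- Entries at different sites commute, so conjugated transposition reverses products. Each factor
contributes the sign -1 of crossing, which the factor (-1)^N in M̂ absorbs. -/
theorem adjTwo_prod (f g : Fin N → ℂ) (hfg : ∀ n, f n = -g n - c.η) :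
    ∀ {l : List (Fin N)}, l.Nodup → adjTwo (l.map fun n => c.lax n (f n)).prod =
      ((-1 : ℂ) ^ l.length) • (l.reverse.map fun n => c.lax n (g n)).prod
  | [], _ => by
    ext1 i j
    fin_cases i <;> fin_cases j <;> simp [adjTwo]
  | n :: l, hl => by
    obtain ⟨hn, hl⟩ := List.nodup_cons.1 hl
    rw [List.map_cons, List.prod_cons, adjTwo_mul fun i j k p => c.lax_commute_prod _ f hn i j k p,
      adjTwo_prod f g hfg hl, c.lax_crossing n (hfg n)]
    simp [pow_succ]

theorem Ur_eq_prod (x : ℂ) : ∀ l : List (Fin N), c.Ur x l =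
    (l.map fun n => c.lax n (x - c.ξ n)).prod * aux (c.Kreg x) *
      (l.reverse.map fun n => c.lax n (x + c.ξ n)).prod
  | [] => by simp [Ur]
  | n :: l => by simp [Ur, Ur_eq_prod x l, mul_assoc]

theorem σy_conj (T : Matrix (Fin 2) (Fin 2) (Op N)) : aux σy * Tᵀ * aux σy = adjTwo T := by
  ext1 i j
  fin_cases i <;> fin_cases j <;>
    simp [aux, σy, adjTwo, Matrix.mul_apply, Fin.sum_univ_two, smul_smul]

theorem M_eq_prod (x : ℂ) : c.M x =
    ((List.finRange N).reverse.map fun n => c.lax n (x - c.ξ n - c.η / 2)).prod := by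
  rw [M, List.map_reverse, List.ofFn_eq_map]; rfl

/-- The sites from the top to the bottom. -/
def sites (N : ℕ) : List (Fin N) := (List.finRange N).reverse

theorem sites_nodup : (sites N).Nodup := List.nodup_reverse.2 (List.nodup_finRange N)

theorem mem_sites (n : Fin N) : n ∈ sites N := by simp [sites]

theorem dress_eq_Ur (x : ℂ) : c.dress (c.Kreg (x - c.η / 2)) x = c.Ur (x - c.η / 2) (sites N) := by
  rw [Ur_eq_prod, dress, Mhat, σy_conj, M_eq_prod, M_eq_prod, ← sites]
  rw [c.adjTwo_prod _ (fun n => x - c.η / 2 + c.ξ n) (fun n => by ring) sites_nodup]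
  have hl : (sites N).length = N := by simp [sites]
  rw [hl, smul_smul, ← mul_pow]
  simp only [mul_neg, mul_one, neg_neg, one_pow, one_smul]
  congr 4
  ext n : 1
  congr 1; ring

end Chain

end EightVertex

end

noncomputable section

namespace EightVertex

namespace Chain

variable {N : ℕ} (c : Chain N)

/-! ### Contractions of the reflection equation -/

/-- The covector `w T` with operator components. -/
def row (w : Fin 2 → ℂ) (T : Matrix (Fin 2) (Fin 2) (Op N)) (j : Fin 2) : Op N := ∑ i, w i • T i j

theorem sandwich_eq_row (w v : Fin 2 → ℂ) (T : Matrix (Fin 2) (Fin 2) (Op N)) :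
    sandwich w T v = ∑ j, v j • row w T j := by
  simp only [sandwich, row, Finset.smul_sum, smul_smul]
  rw [Finset.sum_comm]
  simp only [mul_comm]

theorem differentiable_θ (hω : 0 < c.ω.im) : Differentiable ℂ c.θ := differentiable_th1 hω

theorem exists_θ_ne_zero (hω : 0 < c.ω.im) : ∃ x, c.θ x ≠ 0 := exists_th1_ne_zero hω

/-- If v(b) were zero, its pairing with w(2x-b) would be zero for every x, yet this pairing is
-θ(x)θ(x-b). -/
theorem vv_ne_zero (hω : 0 < c.ω.im) (b : ℂ) : c.vv b ≠ 0 := by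
  intro h
  obtain ⟨x₀, hx₀⟩ := c.exists_θ_ne_zero hω
  have dθ := c.differentiable_θ hω
  have key : ∀ x, c.θ x * c.θ (x - b) = 0 := fun x => by
    have := c.wv_dot_vv hω (a := 2 * x - b) (b := b) x (x - b) (by ring) (by ring)
    rw [h] at this
    simpa using this
  rcases entire_mul_eq_zero dθ (g := fun x => c.θ (x - b)) (by fun_prop) key with h1 | h1
  · exact hx₀ (h1 _)
  · exact hx₀ (by simpa using h1 (x₀ + b))

theorem wv_ne_zero (hω : 0 < c.ω.im) (b : ℂ) : c.wv b ≠ 0 := fun h =>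
  c.vv_ne_zero hω b <| by
    have h0 : -th3 b (2 * c.ω) = 0 := congrFun h 0
    have h1 : th2 b (2 * c.ω) = 0 := congrFun h 1
    ext i
    fin_cases i
    · exact h1
    · exact neg_eq_zero.1 h0

/-- `Φ w(x+s) 𝒰(x) = χ w(-x+s)`: the covector space spanned by `w(x+s)` passes through `𝒰`. -/
def Passes (l : List (Fin N)) (s x : ℂ) (Φ χ : Op N) : Prop :=
  ∀ j, Φ * row (c.wv (x + s)) (c.Ur x l) j = c.wv (-x + s) j • χ

/-- Unnormalised gauge transformed operators. -/
def gauged (l : List (Fin N)) (s t x : ℂ) : Op N := sandwich (c.wv (x + s)) (c.Ur x l) (c.vv (-x + t))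

theorem gauged_eq (l : List (Fin N)) (s t x : ℂ) :
    c.gauged l s t x = ∑ j, c.vv (-x + t) j • row (c.wv (x + s)) (c.Ur x l) j :=
  sandwich_eq_row _ _ _

theorem mul_gauged (l : List (Fin N)) (s t x : ℂ) (Φ : Op N) :
    Φ * c.gauged l s t x = ∑ j, c.vv (-x + t) j • (Φ * row (c.wv (x + s)) (c.Ur x l) j) := by
  rw [gauged_eq, Finset.mul_sum]
  simp only [mul_smul_comm]

/-- The hypothesis says that the two-component row kills v(-x+s). In dimension two such rows are
exactly the multiples of w(-x+s), with an operator as multiplier. -/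
theorem exists_passes (hω : 0 < c.ω.im) {l : List (Fin N)} {s x : ℂ} {Φ : Op N}
    (h : Φ * c.gauged l s s x = 0) : ∃ χ, c.Passes l s x Φ χ := by
  rw [mul_gauged, Fin.sum_univ_two] at h
  unfold Passes
  set r := fun j => Φ * row (c.wv (x + s)) (c.Ur x l) j with hr
  change c.vv (-x + s) 0 • r 0 + c.vv (-x + s) 1 • r 1 = 0 at h
  change ∃ χ, ∀ j, r j = c.wv (-x + s) j • χ
  have hv := c.vv_ne_zero hω (-x + s)
  have w0 : c.wv (-x + s) 0 = -c.vv (-x + s) 1 := rfl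
  have w1 : c.wv (-x + s) 1 = c.vv (-x + s) 0 := rfl
  simp only [Fin.forall_fin_two, w0, w1]
  by_cases h0 : c.vv (-x + s) 0 = 0
  · have h1 : c.vv (-x + s) 1 ≠ 0 := fun h1 => hv (by ext i; fin_cases i <;> assumption)
    rw [h0, zero_smul, zero_add, smul_eq_zero] at h
    refine ⟨(-(c.vv (-x + s) 1)⁻¹) • r 0, ?_, ?_⟩
    · rw [smul_smul, neg_mul_neg, mul_inv_cancel₀ h1, one_smul]
    · rw [h0, zero_smul, h.resolve_left h1]
  · refine ⟨(c.vv (-x + s) 0)⁻¹ • r 1, ?_, ?_⟩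
    · rw [← eq_neg_iff_add_eq_zero, ← eq_inv_smul_iff₀ h0] at h
      rw [h, smul_neg, neg_smul, smul_comm]
    · rw [smul_smul, mul_inv_cancel₀ h0, one_smul]

/-- The gauge parameter t enters only through a scalar pairing, so all operators 𝒜 at x produce the
same χ from Φ. -/
theorem Passes.mul_gauged {c : Chain N} (hω : 0 < c.ω.im) {l : List (Fin N)} {s x : ℂ} {Φ χ : Op N}
    (h : c.Passes l s x Φ χ) (t p q : ℂ) (hp : -x + s = p + q) (hq : -x + t = p - q) :
    Φ * c.gauged l s t x = (-(c.θ p * c.θ q)) • χ := by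
  rw [Chain.mul_gauged, ← c.wv_dot_vv hω p q hp hq, Finset.sum_smul]
  refine Finset.sum_congr rfl fun j _ => ?_
  rw [h j, smul_smul, mul_comm]

/-- Multiplying the defining relation by 𝒰(-x) on the right replaces 𝒰(x) by the quantum
determinant, and the roles of Φ and χ are interchanged. -/
theorem Passes.neg {c : Chain N} (hω : 0 < c.ω.im) {l : List (Fin N)} {s x : ℂ} {Φ χ : Op N}
    (h : c.Passes l s x Φ χ) : c.Passes l s (-x) χ (c.qdet x l • Φ) := by
  intro j
  have h1 : ∑ k, (Φ * row (c.wv (x + s)) (c.Ur x l) k) * c.Ur (-x) l k j =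
      c.qdet x l • c.wv (x + s) j • Φ := by
    have e : ∀ k, (Φ * row (c.wv (x + s)) (c.Ur x l) k) * c.Ur (-x) l k j =
        Φ * ∑ i, c.wv (x + s) i • (c.Ur x l i k * c.Ur (-x) l k j) := fun k => by
      rw [mul_assoc, row, Finset.sum_mul]; simp only [smul_mul_assoc]
    simp only [e]
    rw [← Finset.mul_sum, Finset.sum_comm]
    have e2 : ∀ i, ∑ k, c.wv (x + s) i • (c.Ur x l i k * c.Ur (-x) l k j) =
        c.wv (x + s) i • (c.Ur x l * c.Ur (-x) l) i j := fun i => by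
      rw [Matrix.mul_apply, Finset.smul_sum]
    simp only [e2, c.Ur_unitarity hω, Matrix.smul_apply, Matrix.one_apply]
    simp only [smul_ite, smul_zero, Finset.sum_ite_eq', Finset.mem_univ, if_true, mul_smul_comm,
      mul_one, smul_smul, mul_comm]
  rw [neg_neg, smul_comm, ← h1, row, Finset.mul_sum]
  refine Finset.sum_congr rfl fun k _ => ?_
  rw [h k, mul_smul_comm, smul_mul_assoc]

theorem vecMul_R₂ (hω : 0 < c.ω.im) {u p q p' q' : ℂ} (hq : q = p - (u + c.η)) (hp' : p' = p - c.η)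
    (hq' : q' = p - u) (X : Op N) :
    (fun r : Fin 2 × Fin 2 => (c.wv p r.1 * c.wv q r.2) • X) ᵥ* c.R₂' u =
      fun r => (c.wv p' r.1 * c.wv q' r.2) • (c.θ (u + c.η) • X) := by
  ext1 ⟨k, m⟩
  have := c.wv_mul_R hω hq hp' hq' k m
  simp only [vecMul, dotProduct, R₂', scal, Matrix.map_apply, Fintype.sum_prod_type, mul_smul_comm,
    mul_one, smul_smul, R₂_apply]
  simp only [← Finset.sum_smul]
  rw [← smul_smul, smul_smul, mul_comm _ (c.θ _), ← this]
  simp only [mul_comm]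

theorem vecMul_R₂_swap (hω : 0 < c.ω.im) {u p q p' q' : ℂ} (hq : q = p + (u + c.η))
    (hp' : p' = p + c.η) (hq' : q' = p + u) (X : Op N) :
    (fun r : Fin 2 × Fin 2 => (c.wv p r.1 * c.wv q r.2) • X) ᵥ* c.R₂' u =
      fun r => (c.wv p' r.1 * c.wv q' r.2) • (c.θ (u + c.η) • X) := by
  have := c.vecMul_R₂ hω (u := u) (p := -p) (q := -q) (p' := -p') (q' := -q')
    (by rw [hq]; ring) (by rw [hp']; ring) (by rw [hq']; ring) X
  simpa only [wv_neg] using this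

theorem vecMul_inFst (w₁ w₂ : Fin 2 → ℂ) (X : Op N) (T : Matrix (Fin 2) (Fin 2) (Op N)) :
    (fun r : Fin 2 × Fin 2 => (w₁ r.1 * w₂ r.2) • X) ᵥ* inFst T =
      fun r => w₂ r.2 • (X * row w₁ T r.1) := by
  ext1 ⟨k, m⟩
  simp only [vecMul, dotProduct, inFst, Fintype.sum_prod_type, mul_ite, mul_zero,
    Finset.sum_ite_eq', Finset.mem_univ, if_true, row, Finset.mul_sum, Finset.smul_sum]
  refine Finset.sum_congr rfl fun i _ => ?_
  rw [mul_smul_comm, smul_mul_assoc, smul_smul, mul_comm]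

theorem vecMul_inSnd (w₁ w₂ : Fin 2 → ℂ) (X : Op N) (T : Matrix (Fin 2) (Fin 2) (Op N)) :
    (fun r : Fin 2 × Fin 2 => (w₁ r.1 * w₂ r.2) • X) ᵥ* inSnd T =
      fun r => w₁ r.1 • (X * row w₂ T r.2) := by
  ext1 ⟨k, m⟩
  simp only [vecMul, dotProduct, inSnd, Fintype.sum_prod_type_right, mul_ite, mul_zero,
    Finset.sum_ite_eq', Finset.mem_univ, if_true, row, Finset.mul_sum, Finset.smul_sum]
  refine Finset.sum_congr rfl fun i _ => ?_
  rw [mul_smul_comm, smul_mul_assoc, smul_smul]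

/-- Contraction with a vector of the two auxiliary spaces. -/
def con (ρ : Fin 2 × Fin 2 → Op N) (V : Fin 2 × Fin 2 → ℂ) : Op N := ∑ p, V p • ρ p

theorem con_vecMul_R₂ (ρ : Fin 2 × Fin 2 → Op N) (u : ℂ) (V : Fin 2 × Fin 2 → ℂ) :
    con (ρ ᵥ* c.R₂' u) V = con ρ (c.R₂ u *ᵥ V) := by
  simp only [con, vecMul, mulVec, dotProduct, R₂', scal, Matrix.map_apply, mul_smul_comm, mul_one,
    Finset.smul_sum, Finset.sum_smul, smul_smul]
  rw [Finset.sum_comm]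
  simp only [mul_comm]

theorem R₂_mulVec (hω : 0 < c.ω.im) {u p q p' q' : ℂ} (hq : q = p - (u + c.η)) (hp' : p' = p - c.η)
    (hq' : q' = p - u) : (c.R₂ u *ᵥ fun r => c.vv p r.1 * c.vv q r.2) =
      fun r => c.θ (u + c.η) * (c.vv p' r.1 * c.vv q' r.2) := by
  ext1 ⟨i, j⟩
  simp only [mulVec, dotProduct, Fintype.sum_prod_type, R₂_apply]
  exact c.R_mul_vv hω hq hp' hq' i j

theorem R₂_mulVec_swap (hω : 0 < c.ω.im) {u p q p' q' : ℂ} (hq : q = p + (u + c.η))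
    (hp' : p' = p + c.η) (hq' : q' = p + u) : (c.R₂ u *ᵥ fun r => c.vv p r.1 * c.vv q r.2) =
      fun r => c.θ (u + c.η) * (c.vv p' r.1 * c.vv q' r.2) := by
  ext1 ⟨i, j⟩
  simp only [mulVec, dotProduct, Fintype.sum_prod_type, R₂_apply]
  exact c.R_mul_vv' hω hq hp' hq' i j

/-- The left side of the contracted reflection equation, when `Φ` passes at `x`. -/
theorem Passes.reflection {c : Chain N} (hω : 0 < c.ω.im) {l : List (Fin N)} (hl : l.Nodup)
    {s x : ℂ} {Φ χ : Op N} (h : c.Passes l s x Φ χ) (y : ℂ) :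
    (fun r : Fin 2 × Fin 2 => (c.wv (x + s + c.η) r.1 * c.wv (y + s) r.2) • Φ) ᵥ*
        (inSnd (c.Ur y l) * c.R₂' (x + y) * inFst (c.Ur x l) * c.R₂' (x - y)) =
      fun r => c.wv (-x + s + c.η) r.1 •
        (((c.θ (x - y + c.η) * c.θ (x + y + c.η)) • χ) * row (c.wv (y + s)) (c.Ur y l) r.2) := by
  rw [← c.Ur_reflection hω x y hl, ← vecMul_vecMul, ← vecMul_vecMul, ← vecMul_vecMul,
    c.vecMul_R₂ hω (p' := x + s) (q' := y + s + c.η) (by ring) (by ring) (by ring), vecMul_inFst]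
  have e : (fun r : Fin 2 × Fin 2 => c.wv (y + s + c.η) r.2 •
      ((c.θ (x - y + c.η) • Φ) * row (c.wv (x + s)) (c.Ur x l) r.1)) =
      fun r => (c.wv (-x + s) r.1 * c.wv (y + s + c.η) r.2) • (c.θ (x - y + c.η) • χ) := by
    ext1 r
    rw [smul_mul_assoc, h r.1, smul_smul, smul_smul, smul_smul]
    congr 1; ring
  rw [e, c.vecMul_R₂_swap hω (p' := -x + s + c.η) (q' := y + s) (by ring) (by ring) (by ring),
    vecMul_inSnd]
  ext1 r
  rw [smul_smul, mul_comm (c.θ _)]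

theorem con_fst_row (w v₁ v₂ : Fin 2 → ℂ) (X : Op N) (ρ : Fin 2 → Op N) :
    con (fun r : Fin 2 × Fin 2 => w r.1 • (X * ρ r.2)) (fun r => v₁ r.1 * v₂ r.2) =
      (∑ i, w i * v₁ i) • (X * ∑ j, v₂ j • ρ j) := by
  simp only [con, Fintype.sum_prod_type, Fin.sum_univ_two, mul_add, mul_smul_comm]
  module

theorem con_snd_row (w v₁ v₂ : Fin 2 → ℂ) (X : Op N) (ρ : Fin 2 → Op N) :
    con (fun r : Fin 2 × Fin 2 => w r.2 • (X * ρ r.1)) (fun r => v₁ r.1 * v₂ r.2) =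
      (∑ i, w i * v₂ i) • (X * ∑ j, v₁ j • ρ j) := by
  simp only [con, Fintype.sum_prod_type, Fin.sum_univ_two, mul_add, mul_smul_comm]
  module

theorem con_mixed (w v₁ v₂ : Fin 2 → ℂ) (u : ℂ) (α : Fin 2 → Op N)
    (T : Matrix (Fin 2) (Fin 2) (Op N)) :
    con ((fun r : Fin 2 × Fin 2 => w r.1 • α r.2) ᵥ* c.R₂' u ᵥ* inFst T)
        (fun r => v₁ r.1 * v₂ r.2) =
      ∑ b, ∑ a, (∑ i, ∑ e, w i * c.R u i a b e * v₂ e) • (α b * ∑ k, v₁ k • T a k) := by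
  simp only [con, vecMul, dotProduct, Fintype.sum_prod_type, R₂', scal, Matrix.map_apply, R₂_apply,
    inFst, mul_ite, mul_zero, mul_smul_comm, mul_one]
  simp only [Fin.sum_univ_two, add_mul, mul_add, smul_mul_assoc, mul_smul_comm]
  simp
  module

theorem con_smul (ρ : Fin 2 × Fin 2 → Op N) (z : ℂ) (V : Fin 2 × Fin 2 → ℂ) :
    con ρ (fun r => z * V r) = z • con ρ V := by
  simp only [con, Finset.smul_sum, smul_smul]

/-- Operators `𝒜` commute on covectors passing at both points. -/
theorem Passes.comm {c : Chain N} (hω : 0 < c.ω.im) {l : List (Fin N)} (hl : l.Nodup)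
    {s t x y : ℂ} {Φ χ χ' : Op N} (hx : c.Passes l s x Φ χ) (hy : c.Passes l s y Φ χ')
    (h1 : c.θ (x - y + c.η) ≠ 0) (h2 : c.θ (x + y + c.η) ≠ 0)
    (h3 : c.θ ((s - t) / 2 + c.η) ≠ 0) :
    Φ * c.gauged l s t x * c.gauged l s t y = Φ * c.gauged l s t y * c.gauged l s t x := by
  -- These vectors stay decomposable under R₂(x-y). One side becomes a scalar times χ 𝒜(y), the
  -- other a scalar times χ' 𝒜(x).
  have key := congrArg (fun ρ => con ρ (fun r => c.vv (-x + t - c.η) r.1 * c.vv (-y + t) r.2))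
    (hx.reflection hω hl y)
  simp only [con_fst_row, ← vecMul_vecMul, con_vecMul_R₂, vecMul_inSnd] at key
  rw [c.R₂_mulVec_swap hω (p' := -x + t) (q' := -y + t - c.η) (by ring) (by ring) (by ring)] at key
  have e : (fun r : Fin 2 × Fin 2 => c.wv (x + s + c.η) r.1 •
      (Φ * row (c.wv (y + s)) (c.Ur y l) r.2)) =
      fun r => (c.wv (x + s + c.η) r.1 * c.wv (-y + s) r.2) • χ' := by
    ext1 r; rw [hy r.2, smul_smul]
  rw [e, c.vecMul_R₂ hω (p' := x + s) (q' := -y + s + c.η) (by ring) (by ring) (by ring),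
    vecMul_inFst, con_smul, con_snd_row, ← gauged_eq, ← gauged_eq,
    c.wv_dot_vv hω (-y + (s + t) / 2) ((s - t) / 2 + c.η) (by ring) (by ring),
    c.wv_dot_vv hω (-x + (s + t) / 2) ((s - t) / 2 + c.η) (by ring) (by ring)] at key
  rw [hx.mul_gauged hω t (-x + (s + t) / 2) ((s - t) / 2) (by ring) (by ring),
    hy.mul_gauged hω t (-y + (s + t) / 2) ((s - t) / 2) (by ring) (by ring)]
  simp only [smul_mul_assoc, smul_smul] at key ⊢
  have h4 : c.θ (x - y + c.η) * c.θ (x + y + c.η) * c.θ ((s - t) / 2 + c.η) ≠ 0 :=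
    mul_ne_zero (mul_ne_zero h1 h2) h3
  -- The contraction carries θ((s-t)/2 + η) where the products of 𝒜 carry θ((s-t)/2); this factor
  -- converts one into the other and removes the R-matrix scalars.
  have key2 := congrArg (fun Z => (c.θ ((s - t) / 2) *
    (c.θ (x - y + c.η) * c.θ (x + y + c.η) * c.θ ((s - t) / 2 + c.η))⁻¹) • Z) key
  simp only [smul_smul] at key2
  generalize c.θ ((s - t) / 2 + c.η) = a at *
  generalize c.θ ((s - t) / 2) = b at *
  generalize c.θ (-x + (s + t) / 2) = d at *
  generalize c.θ (-y + (s + t) / 2) = e at *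
  generalize c.θ (x - y + c.η) = f at *
  generalize c.θ (x + y + c.η) = g at *
  convert key2.symm using 2 <;> field_simp

/-- Exchange of `𝒜` and `ℬ`, before cancelling a common factor. -/
theorem Passes.exchange {c : Chain N} (hω : 0 < c.ω.im) {l : List (Fin N)} (hl : l.Nodup)
    {s x y e : ℂ} {Φ Φ' χ χ' : Op N} (hx : c.Passes l s x Φ χ)
    (hx' : c.Passes l (s + 2 * c.η) x Φ' χ') (hB : Φ * c.gauged l s s y = e • Φ') :
    (c.θ (x - y + c.η) * c.θ (s + c.η - y)) •
        ((c.θ (x + y + c.η) * c.θ (y - x)) • (χ * c.gauged l s s y)) =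
      (c.θ (x - y + c.η) * c.θ (s + c.η - y)) • ((c.θ (x + y) * c.θ (y - x + c.η) * e) • χ') := by
  -- The vector v(-y+s) completes the row at y to ℬ(y); the first vector is then matched to it so
  -- that R₂(x-y) intertwines the pair.
  have key := congrArg (fun ρ => con ρ (fun r => c.vv (x - 2 * y + s + c.η) r.1 * c.vv (-y + s) r.2))
    (hx.reflection hω hl y)
  simp only [con_fst_row, ← vecMul_vecMul, con_vecMul_R₂, vecMul_inSnd] at key
  rw [c.R₂_mulVec hω (p' := x - 2 * y + s) (q' := -y + s + c.η) (by ring) (by ring) (by ring),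
    con_smul, ← gauged_eq,
    c.wv_dot_vv hω (s + c.η - y) (y - x) (by ring) (by ring)] at key
  have e2 : con ((fun r : Fin 2 × Fin 2 => c.wv (x + s + c.η) r.1 •
      (Φ * row (c.wv (y + s)) (c.Ur y l) r.2)) ᵥ* c.R₂' (x + y) ᵥ* inFst (c.Ur x l))
      (fun r => c.vv (x - 2 * y + s) r.1 * c.vv (-y + s + c.η) r.2) =
      c.θ (x + y) • (Φ * c.gauged l s s y * ∑ k, c.vv (x - 2 * y + s) k •
        row (c.wv (x + s + 2 * c.η)) (c.Ur x l) k) := by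
    have mix₀ := fun b a => c.wv_mul_R_mul_vv hω (u := x + y) (p := -y + s + c.η) (q := x + s + c.η)
      (p' := -y + s) (q' := x + s + 2 * c.η) (by ring) (by ring) (by ring) b a
    have mix : ∀ b a, ∑ j, ∑ k, c.wv (x + s + c.η) j * c.R (x + y) j a b k * c.vv (-y + s + c.η) k =
        c.θ (x + y) * (c.vv (-y + s) b * c.wv (x + s + 2 * c.η) a) := fun b a => by
      rw [← mix₀ b a]; simp only [fun i k => c.R_swap (x + y) i b a k]
    rw [gauged_eq]
    generalize row (c.wv (y + s)) (c.Ur y l) = ρ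
    rw [c.con_mixed _ _ _ _ (fun b => Φ * ρ b)]
    simp only [mix]
    simp only [Fin.sum_univ_two, row, add_mul, mul_add, smul_mul_assoc, mul_smul_comm]
    module
  rw [e2, hB, smul_mul_assoc, Finset.mul_sum] at key
  have e3 : ∀ k, Φ' * (c.vv (x - 2 * y + s) k • row (c.wv (x + s + 2 * c.η)) (c.Ur x l) k) =
      (c.wv (-x + (s + 2 * c.η)) k * c.vv (x - 2 * y + s) k) • χ' := fun k => by
    have := hx' k
    rw [show x + (s + 2 * c.η) = x + s + 2 * c.η by ring] at this
    rw [mul_smul_comm, this, smul_smul, mul_comm]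
  simp only [e3] at key
  rw [← Finset.sum_smul, c.wv_dot_vv hω (s + c.η - y) (y - x + c.η) (by ring) (by ring)] at key
  simp only [smul_mul_assoc, smul_smul] at key ⊢
  have key2 := congrArg (fun Z => (-1 : ℂ) • Z) key
  simp only [smul_smul] at key2
  convert key2.symm using 2 <;> ring

end Chain

end EightVertex

end

noncomputable section

namespace EightVertex

namespace Chain

variable {N : ℕ} (c : Chain N)

/-! ### Covectors as operators -/

/-- The operator all of whose rows are `φ`. -/
def rowOp (φ : (Fin N → Fin 2) → ℂ) : Op N := fun _ j => φ j

/-- It lets a covector play the part of Φ in `Passes`, whose relations are stated between operators.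
-/
theorem rowOp_mul (φ : (Fin N → Fin 2) → ℂ) (A : Op N) : rowOp φ * A = rowOp (φ ᵥ* A) := rfl

theorem rowOp_smul (z : ℂ) (φ : (Fin N → Fin 2) → ℂ) : rowOp (z • φ) = z • rowOp φ := rfl

theorem rowOp_injective : Function.Injective (rowOp (N := N)) := fun _ _ h => congrFun h 0

theorem rowOp_zero : rowOp (N := N) 0 = 0 := rfl

/-- The operator of a product covector. -/
def covOp (w : Fin N → Fin 2 → ℂ) : Op N := rowOp (cov w)

theorem covOp_mul_site (w : Fin N → Fin 2 → ℂ) (n : Fin N) (A : Matrix (Fin 2) (Fin 2) ℂ) :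
    covOp w * site n A = covOp (Function.update w n (w n ᵥ* A)) := by
  rw [covOp, rowOp_mul, cov_vecMul_site]; rfl

theorem covOp_update_add (w : Fin N → Fin 2 → ℂ) (n : Fin N) (y z : Fin 2 → ℂ) :
    covOp (Function.update w n (y + z)) =
      covOp (Function.update w n y) + covOp (Function.update w n z) := by
  ext h k
  simp only [covOp, rowOp, Matrix.add_apply, cov_update, Pi.add_apply, add_mul]

theorem covOp_update_smul (w : Fin N → Fin 2 → ℂ) (n : Fin N) (a : ℂ) (z : Fin 2 → ℂ) :
    covOp (Function.update w n (a • z)) = a • covOp (Function.update w n z) := by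
  ext h k
  simp only [covOp, rowOp, Matrix.smul_apply, cov_update, Pi.smul_apply, smul_eq_mul, mul_assoc]

theorem covOp_update_sum (w : Fin N → Fin 2 → ℂ) (n : Fin N) (a : Fin 2 → ℂ)
    (z : Fin 2 → Fin 2 → ℂ) :
    ∑ i, a i • covOp (Function.update w n (z i)) =
      covOp (Function.update w n (∑ i, a i • z i)) := by
  simp only [Fin.sum_univ_two, covOp_update_add, covOp_update_smul]

theorem covOp_mul_row_lax (hω : 0 < c.ω.im) {w : Fin N → Fin 2 → ℂ} {n : Fin N} {u p q p' q' : ℂ}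
    (hw : w n = c.wv q) (hq : q = p - (u + c.η)) (hp' : p' = p - c.η) (hq' : q' = p - u)
    (k : Fin 2) : covOp w * row (c.wv p) (c.lax n u) k =
      (c.θ (u + c.η) * c.wv p' k) • covOp (Function.update w n (c.wv q')) := by
  simp only [row, Finset.mul_sum, mul_smul_comm, lax, Matrix.map_apply, covOp_mul_site]
  rw [covOp_update_sum, ← covOp_update_smul]
  congr 2
  ext m
  simp only [Finset.sum_apply, Pi.smul_apply, vecMul, dotProduct, smul_eq_mul, hw]
  rw [mul_assoc, ← c.wv_mul_R hω hq hp' hq' k m]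
  simp only [Finset.mul_sum, mul_assoc]

theorem covOp_mul_row_lax_swap (hω : 0 < c.ω.im) {w : Fin N → Fin 2 → ℂ} {n : Fin N}
    {u p q p' q' : ℂ} (hw : w n = c.wv q) (hq : q = p + (u + c.η)) (hp' : p' = p + c.η)
    (hq' : q' = p + u) (k : Fin 2) : covOp w * row (c.wv p) (c.lax n u) k =
      (c.θ (u + c.η) * c.wv p' k) • covOp (Function.update w n (c.wv q')) := by
  have := c.covOp_mul_row_lax hω (w := w) (n := n) (u := u) (p := -p) (q := -q) (p' := -p')
    (q' := -q') (by rw [wv_neg, hw]) (by rw [hq]; ring) (by rw [hp']; ring) (by rw [hq']; ring) k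
  simpa only [wv_neg] using this

theorem covOp_mul_lax_vv (hω : 0 < c.ω.im) {w : Fin N → Fin 2 → ℂ} {n : Fin N} {u p q p' q' : ℂ}
    (hw : w n = c.wv q) (hq : q = p + u) (hp' : p' = p - c.η) (hq' : q' = q + c.η) (i : Fin 2) :
    ∑ k, c.vv p k • (covOp w * c.lax n u i k) =
      (c.θ u * c.vv p' i) • covOp (Function.update w n (c.wv q')) := by
  simp only [lax, Matrix.map_apply, covOp_mul_site]
  rw [covOp_update_sum, ← covOp_update_smul]
  congr 2
  ext m
  simp only [Finset.sum_apply, Pi.smul_apply, vecMul, dotProduct, smul_eq_mul, hw]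
  rw [mul_assoc, ← c.wv_mul_R_mul_vv hω hq hp' hq' i m, Finset.sum_comm]
  simp only [Finset.mul_sum]
  refine Finset.sum_congr rfl fun k _ => Finset.sum_congr rfl fun j _ => by ring

theorem row_mul (w : Fin 2 → ℂ) (A B : Matrix (Fin 2) (Fin 2) (Op N)) (j : Fin 2) :
    row w (A * B) j = ∑ k, row w A k * B k j := by
  simp only [row, Matrix.mul_apply, Finset.smul_sum, Finset.sum_mul, smul_mul_assoc]
  rw [Finset.sum_comm]

theorem row_commute {X : Op N} {T : Matrix (Fin 2) (Fin 2) (Op N)} (h : ∀ i j, Commute X (T i j))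
    (w : Fin 2 → ℂ) (j : Fin 2) : Commute X (row w T j) :=
  Commute.sum_right _ _ _ fun i _ => (h i j).smul_right _

theorem row_lax_commute {X : Op N} {n : Fin N} (h : ∀ A, Commute X (site n A)) (w : Fin 2 → ℂ)
    (u : ℂ) (j : Fin 2) : Commute X (row w (c.lax n u) j) := row_commute (fun _ _ => h _) w j

/-! ### The reference covector -/

/-- The components of `w` at the sites of `l` are those of the reference covector. -/
def Matched (w : Fin N → Fin 2 → ℂ) : List (Fin N) → ℂ → Prop
  | [], _ => True
  | n :: l, s => w n = c.wv (c.ξ n + s - c.η) ∧ Matched w l (s - c.η)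

theorem Matched.update {c : Chain N} {w : Fin N → Fin 2 → ℂ} {n : Fin N} (z : Fin 2 → ℂ) :
    ∀ {l : List (Fin N)} {s : ℂ}, c.Matched w l s → n ∉ l → c.Matched (Function.update w n z) l s
  | [], _, _, _ => trivial
  | m :: l, s, h, hn => by
    have hmn : m ≠ n := fun e => hn (e ▸ List.mem_cons_self)
    exact ⟨by rw [Function.update_of_ne hmn]; exact h.1,
      Matched.update z h.2 fun hl => hn (List.mem_cons_of_mem _ hl)⟩

/-- The left factor of the outer site is absorbed by its covector. The operator X, carried along,
allows states that are no longer products on the inner sites, as in `exists_annihilated`; elsewhere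
X = 1. -/
theorem covOp_mul_row_Ur (hω : 0 < c.ω.im) {w : Fin N → Fin 2 → ℂ} {n : Fin N}
    {l : List (Fin N)} {s : ℂ} (hw : w n = c.wv (c.ξ n + s - c.η)) (x : ℂ) (X : Op N)
    (hX : ∀ A, Commute X (site n A)) (j : Fin 2) :
    covOp w * X * row (c.wv (x + s)) (c.Ur x (n :: l)) j =
      c.θ (x - c.ξ n + c.η) • ∑ p, (covOp (Function.update w n (c.wv (c.ξ n + s))) * X *
        row (c.wv (x + (s - c.η))) (c.Ur x l) p) * c.lax n (x + c.ξ n) p j := by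
  have h1 := c.covOp_mul_row_lax hω (w := w) (n := n) (u := x - c.ξ n) (p := x + s)
    (p' := x + (s - c.η)) (q' := c.ξ n + s) hw (by ring) (by ring) (by ring)
  rw [Ur, row_mul, Finset.mul_sum, Finset.smul_sum]
  refine Finset.sum_congr rfl fun p _ => ?_
  rw [← mul_assoc, ← smul_mul_assoc, row_mul]
  congr 1
  rw [Finset.mul_sum, row, Finset.mul_sum, Finset.smul_sum]
  refine Finset.sum_congr rfl fun k _ => ?_
  rw [← mul_assoc, mul_assoc (covOp w), (c.row_lax_commute hX _ _ _).eq, ← mul_assoc, h1,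
    mul_smul_comm, smul_mul_assoc, smul_mul_assoc, smul_smul]

/-- The scalar factor in the action of `ℬ` on the reference covector. -/
def refFactor (x : ℂ) : List (Fin N) → ℂ → ℂ
  | [], s => c.wv (x + s) ⬝ᵥ (c.Kreg x *ᵥ c.vv (-x + s))
  | n :: l, s => c.θ (x - c.ξ n + c.η) * c.θ (x + c.ξ n) * refFactor x l (s - c.η)

/-- At each site the left factor advances the argument of w by η and the right factor, met by the
vector v, advances it by another η. The total shift 2η is the change from b to b - 2. Sites outside
the list are those already treated. -/
theorem covOp_mul_gauged (hω : 0 < c.ω.im) (x : ℂ) :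
    ∀ {l : List (Fin N)} {s : ℂ} {w w' : Fin N → Fin 2 → ℂ}, l.Nodup → c.Matched w l s →
      c.Matched w' l (s + 2 * c.η) → (∀ n ∉ l, w n = w' n) →
      covOp w * c.gauged l s s x = c.refFactor x l s • covOp w'
  | [], s, w, w', _, _, _, h => by
    rw [show w = w' from funext fun n => h n (by simp), gauged, Ur, refFactor]
    simp only [sandwich, aux, Matrix.map_apply, dotProduct, mulVec, Fin.sum_univ_two, mul_add,
      mul_smul_comm, mul_one]
    module
  | n :: l, s, w, w', hl, hw, hw', h => by
    obtain ⟨hn, hl⟩ := List.nodup_cons.1 hl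
    have h1 := fun j => c.covOp_mul_row_Ur hω hw.1 x 1 (fun _ => Commute.one_left _) (l := l) j
    simp only [mul_one] at h1
    set w₁ := Function.update w n (c.wv (c.ξ n + s)) with hw₁
    have h2 := fun p => c.covOp_mul_lax_vv hω (w := w₁) (n := n) (u := x + c.ξ n) (p := -x + s)
      (q := c.ξ n + s) (p' := -x + (s - c.η)) (q' := c.ξ n + s + c.η) (by simp [w₁]) (by ring)
      (by ring) (by ring) p
    have h3 : Function.update w₁ n (c.wv (c.ξ n + s + c.η)) =
        Function.update w n (c.wv (c.ξ n + s + c.η)) := by simp [w₁]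
    have IH := covOp_mul_gauged hω x (l := l) (s := s - c.η)
      (w := Function.update w n (c.wv (c.ξ n + s + c.η))) (w' := w') hl (hw.2.update _ hn)
      (by have := hw'.2; rwa [show s + 2 * c.η - c.η = s - c.η + 2 * c.η by ring] at this)
      (fun m hm => by
        by_cases hmn : m = n
        · subst hmn
          rw [Function.update_self, hw'.1]; congr 1; ring
        · rw [Function.update_of_ne hmn]
          exact h m (by simp [hmn, hm]))
    rw [c.mul_gauged]
    simp only [h1]
    have h4 : ∑ j, c.vv (-x + s) j • c.θ (x - c.ξ n + c.η) • ∑ p, (covOp w₁ *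
        row (c.wv (x + (s - c.η))) (c.Ur x l) p) * c.lax n (x + c.ξ n) p j =
        c.θ (x - c.ξ n + c.η) • ∑ p, (∑ j, c.vv (-x + s) j • (covOp w₁ * c.lax n (x + c.ξ n) p j)) *
          row (c.wv (x + (s - c.η))) (c.Ur x l) p := by
      have hc : ∀ p j, covOp w₁ * row (c.wv (x + (s - c.η))) (c.Ur x l) p *
          c.lax n (x + c.ξ n) p j = covOp w₁ * c.lax n (x + c.ξ n) p j *
            row (c.wv (x + (s - c.η))) (c.Ur x l) p := fun p j => by
        rw [mul_assoc, mul_assoc]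
        congr 1
        exact (row_commute (fun _ _ => c.site_commute_Ur _ x hn _ _) _ _).symm
      simp only [hc, Finset.smul_sum, Finset.sum_mul, smul_mul_assoc]
      rw [Finset.sum_comm]
      refine Finset.sum_congr rfl fun p _ => Finset.sum_congr rfl fun j _ => smul_comm _ _ _
    rw [h4]
    simp only [h2, h3]
    have h5 : ∑ p, (c.θ (x + c.ξ n) * c.vv (-x + (s - c.η)) p) •
        covOp (Function.update w n (c.wv (c.ξ n + s + c.η))) *
          row (c.wv (x + (s - c.η))) (c.Ur x l) p =
        c.θ (x + c.ξ n) • (covOp (Function.update w n (c.wv (c.ξ n + s + c.η))) *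
          c.gauged l (s - c.η) (s - c.η) x) := by
      rw [c.mul_gauged, Finset.smul_sum]
      refine Finset.sum_congr rfl fun p _ => ?_
      rw [smul_mul_assoc, smul_smul]
    rw [h5, IH, smul_smul, smul_smul, refFactor, mul_assoc]

/-- Absorbing the left factor of the site n yields θ(x - ξ_n + η), which is θ(0). -/
theorem covOp_mul_row_eq_zero (hω : 0 < c.ω.im) {n : Fin N} {x : ℂ} (hx : x = c.ξ n - c.η) :
    ∀ {l : List (Fin N)} {s : ℂ} {w : Fin N → Fin 2 → ℂ}, l.Nodup → n ∈ l → c.Matched w l s →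
      ∀ j, covOp w * row (c.wv (x + s)) (c.Ur x l) j = 0
  | m :: l, s, w, hl, hn, hw, j => by
    obtain ⟨hm, hl⟩ := List.nodup_cons.1 hl
    have h1 := c.covOp_mul_row_Ur hω hw.1 x 1 (fun _ => Commute.one_left _) (l := l) j
    simp only [mul_one] at h1
    rw [h1]
    by_cases hnm : n = m
    · subst hnm
      rw [hx, show c.ξ n - c.η - c.ξ n + c.η = 0 by ring, θ_zero, zero_smul]
    · have hn' : n ∈ l := by simpa [hnm] using hn
      simp only [covOp_mul_row_eq_zero hω hx hl hn' (hw.2.update _ hm), zero_mul,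
        Finset.sum_const_zero, smul_zero]

/-! ### Annihilation by a second application at the same site -/

/-- At x - y = -η the covector w(p) ⊗ w(p) lies in the left kernel of the R-matrix, its intertwining
scalar being θ(0). -/
theorem reflection_zero (hω : 0 < c.ω.im) {l : List (Fin N)} (hl : l.Nodup) {x y : ℂ}
    (hxy : x = y - c.η) (p : ℂ) (X : Op N) :
    (fun r : Fin 2 × Fin 2 => (c.wv p r.1 * c.wv p r.2) • X) ᵥ*
        (inSnd (c.Ur y l) * c.R₂' (x + y) * inFst (c.Ur x l) * c.R₂' (x - y)) = 0 := by
  rw [← c.Ur_reflection hω x y hl, ← vecMul_vecMul, ← vecMul_vecMul, ← vecMul_vecMul,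
    c.vecMul_R₂ hω (p' := p - c.η) (q' := p - (x - y)) (by rw [hxy]; ring) rfl rfl,
    show x - y + c.η = 0 by rw [hxy]; ring, θ_zero]
  simp only [zero_smul, smul_zero]
  rw [← Pi.zero_def, zero_vecMul, zero_vecMul, zero_vecMul]

theorem exists_dot_eq_one {z : Fin 2 → ℂ} (hz : z ≠ 0) : ∃ a, z ⬝ᵥ a = 1 := by
  obtain ⟨i, hi⟩ := Function.ne_iff.1 hz
  exact ⟨Pi.single i (z i)⁻¹, by simpa using mul_inv_cancel₀ hi⟩

theorem wv_vecMul_R_zero (hω : 0 < c.ω.im) (z : Fin 2 → ℂ) (p j : Fin 2) :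
    z ᵥ* c.R 0 p j = (c.θ c.η * z j) • Pi.single p 1 := by
  ext m
  simp only [vecMul, dotProduct, c.R_zero hω, Pi.smul_apply, Pi.single_apply, smul_eq_mul]
  by_cases h : p = m
  · subst h; simp [mul_comm]
  · have h' : ¬ m = p := fun e => h e.symm
    simp [h, h']

theorem covOp_update_single_mul_site (w : Fin N → Fin 2 → ℂ) (n : Fin N) (q : Fin 2)
    (A : Matrix (Fin 2) (Fin 2) ℂ) : covOp (Function.update w n (Pi.single q 1)) * site n A =
      ∑ b, A q b • covOp (Function.update w n (Pi.single b 1)) := by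
  rw [covOp_mul_site, covOp_update_sum, Function.update_self, Function.update_idem]
  congr 2
  ext m
  simp [vecMul, Pi.single_apply]

/-- At y = -ξ_n the right factor of the site is a permutation, so the site receives the auxiliary
index of the inner row at y. It then acts as the second auxiliary space of a reflection equation for
the inner sites, to which `reflection_zero` applies. -/
theorem exists_annihilated_head (hω : 0 < c.ω.im) {n : Fin N} {x y : ℂ} (hy : y = -c.ξ n)
    (hx : x = y - c.η) {l : List (Fin N)} {s : ℂ} (hl : l.Nodup) (hn : n ∉ l) :
    ∃ X : Op N, (∀ m ∉ n :: l, ∀ A, Commute X (site m A)) ∧ ∀ w, c.Matched w (n :: l) s →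
      c.Passes (n :: l) s y (covOp w) (covOp w * X) ∧
        ∀ j, covOp w * X * row (c.wv (x + s)) (c.Ur x (n :: l)) j = 0 := by
  -- A vector a dual to the covector at the site: a ⊗ e_q replaces that covector by e_q, which gives
  -- an X that serves for every matched w.
  obtain ⟨a, ha⟩ := exists_dot_eq_one (c.wv_ne_zero hω (c.ξ n + s - c.η))
  set ρ := row (c.wv (y + (s - c.η))) (c.Ur y l) with hρ
  have cρ : ∀ q A, Commute (site n A) (ρ q) := fun q A =>
    row_commute (fun _ _ => c.site_commute_Ur _ y hn _ _) _ _
  refine ⟨(c.θ (y - c.ξ n + c.η) * c.θ c.η) •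
    ∑ q, site n (vecMulVec a (Pi.single q 1)) * ρ q, fun m hm A => ?_, fun w hw => ?_⟩
  · have hmn : n ≠ m := fun e => hm (e ▸ List.mem_cons_self)
    have hml : m ∉ l := fun h => hm (List.mem_cons_of_mem _ h)
    refine Commute.smul_left (Commute.sum_left _ _ _ fun q _ => ?_) _
    exact (site_commute hmn _ _).mul_left
      (row_commute (fun _ _ => c.site_commute_Ur _ y hml _ _) _ _).symm
  set F := fun q : Fin 2 => covOp (Function.update w n (Pi.single q 1)) with hF
  have hX : covOp w * ((c.θ (y - c.ξ n + c.η) * c.θ c.η) •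
      ∑ q, site n (vecMulVec a (Pi.single q 1)) * ρ q) =
      (c.θ (y - c.ξ n + c.η) * c.θ c.η) • ∑ q, F q * ρ q := by
    rw [mul_smul_comm, Finset.mul_sum]
    congr 1
    refine Finset.sum_congr rfl fun q _ => ?_
    rw [← mul_assoc, covOp_mul_site, hw.1, vecMul_vecMulVec, ha, one_smul]
  rw [hX]
  refine ⟨fun j => ?_, fun j => ?_⟩
  · have h3 := c.covOp_mul_row_Ur hω hw.1 y 1 (fun _ => Commute.one_left _) (l := l) j
    simp only [mul_one] at h3
    rw [h3, ← hρ, smul_smul, Finset.smul_sum, Finset.smul_sum]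
    refine Finset.sum_congr rfl fun p _ => ?_
    have h4 : c.lax n (y + c.ξ n) p j = site n (c.R 0 p j) := by
      rw [hy, neg_add_cancel]; rfl
    rw [h4, mul_assoc, ← (cρ _ _).eq, ← mul_assoc, covOp_mul_site, Function.update_self,
      wv_vecMul_R_zero c hω, covOp_update_smul, Function.update_idem, smul_mul_assoc, smul_smul,
      show c.ξ n + s = -y + s by rw [hy]; ring]
    congr 1; ring
  -- Since ξ_n = -y, the two site factors at x are R(x+y) and R(x-y), exactly those of the
  -- reflection equation; F b contracts the second auxiliary index b with the site.
  · have key := congrArg (fun σ => ∑ b, F b * σ (j, b))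
      (c.reflection_zero hω hl hx (y + (s - c.η)) 1)
    simp only [Pi.zero_apply, mul_zero, Finset.sum_const_zero] at key
    rw [smul_mul_assoc]
    convert smul_zero _
    rw [← key, show x + s = y + (s - c.η) by rw [hx]; ring]
    have hFs : ∀ q A, F q * site n A = ∑ b, A q b • F b := fun q A =>
      covOp_update_single_mul_site w n q A
    have h5 : ∀ q i k p, F q * ρ q * (c.lax n (x - c.ξ n) i k * c.Ur x l k p *
        c.lax n (x + c.ξ n) p j) = ∑ a, ∑ b, (c.R (x - c.ξ n) i k q a * c.R (x + c.ξ n) p j a b) •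
          (F b * (ρ q * c.Ur x l k p)) := by
      intro q i k p
      have e1 := (cρ q (c.R (x - c.ξ n) i k)).eq
      have e2 := (cρ q (c.R (x + c.ξ n) p j)).eq
      have e3 := (c.site_commute_Ur (c.R (x + c.ξ n) p j) x hn k p).eq
      calc F q * ρ q * (c.lax n (x - c.ξ n) i k * c.Ur x l k p * c.lax n (x + c.ξ n) p j)
          = F q * (ρ q * site n (c.R (x - c.ξ n) i k)) *
            (c.Ur x l k p * site n (c.R (x + c.ξ n) p j)) := by
            simp only [lax, Matrix.map_apply, mul_assoc]
        _ = F q * site n (c.R (x - c.ξ n) i k) * (ρ q * site n (c.R (x + c.ξ n) p j)) *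
            c.Ur x l k p := by rw [← e1, ← e3]; simp only [mul_assoc]
        _ = F q * site n (c.R (x - c.ξ n) i k) * site n (c.R (x + c.ξ n) p j) *
            (ρ q * c.Ur x l k p) := by rw [← e2]; simp only [mul_assoc]
        _ = _ := by
          rw [hFs, Finset.sum_mul, Finset.sum_mul]
          refine Finset.sum_congr rfl fun a _ => ?_
          rw [smul_mul_assoc, hFs, smul_mul_assoc, Finset.sum_mul, Finset.smul_sum]
          refine Finset.sum_congr rfl fun b _ => ?_
          rw [smul_mul_assoc, smul_smul]
    have h6 : row (c.wv (y + (s - c.η))) (c.Ur x (n :: l)) j = ∑ i, ∑ k, ∑ p,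
        c.wv (y + (s - c.η)) i • (c.lax n (x - c.ξ n) i k * c.Ur x l k p *
          c.lax n (x + c.ξ n) p j) := by
      simp only [row, Ur, Matrix.mul_apply, Finset.sum_mul, Finset.smul_sum]
      refine Finset.sum_congr rfl fun i _ => Finset.sum_comm
    rw [show x - c.ξ n = x + y by rw [hy]; ring, show x + c.ξ n = x - y by rw [hy]; ring] at h5 h6
    rw [h6]
    simp only [Finset.sum_mul, Finset.mul_sum, mul_smul_comm, h5]
    rw [← vecMul_vecMul, ← vecMul_vecMul, ← vecMul_vecMul, vecMul_inSnd, ← hρ]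
    simp only [vecMul, dotProduct, Fintype.sum_prod_type, R₂', scal, Matrix.map_apply, R₂_apply,
      inFst, mul_ite, mul_zero, mul_smul_comm, mul_one, one_mul]
    simp only [Fin.sum_univ_two, add_mul, mul_add, smul_mul_assoc, mul_smul_comm]
    simp only [Fin.isValue, if_true, zero_ne_one, one_ne_zero, if_false, mul_zero,
      add_zero, zero_add, mul_add, smul_add, mul_smul_comm]
    module

/-- At a site outside n, the left factor at y advances the local covector by η and the right factor,
now met by w, takes it back. The operator X of the inner sites therefore serves again, up to a
scalar. -/
theorem exists_annihilated (hω : 0 < c.ω.im) {n : Fin N} {x y : ℂ} (hy : y = -c.ξ n)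
    (hx : x = y - c.η) : ∀ {l : List (Fin N)} {s : ℂ}, l.Nodup → n ∈ l →
    ∃ X : Op N, (∀ m ∉ l, ∀ A, Commute X (site m A)) ∧ ∀ w, c.Matched w l s →
      c.Passes l s y (covOp w) (covOp w * X) ∧
        ∀ j, covOp w * X * row (c.wv (x + s)) (c.Ur x l) j = 0
  | m :: l, s, hl, hn => by
    obtain ⟨hm, hl'⟩ := List.nodup_cons.1 hl
    by_cases hnm : n = m
    · subst hnm
      exact c.exists_annihilated_head hω hy hx hl' hm
    · have hn' : n ∈ l := by simpa [hnm] using hn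
      obtain ⟨X, hX, h⟩ := exists_annihilated hω hy hx (l := l) (s := s - c.η) hl' hn'
      refine ⟨(c.θ (y - c.ξ m + c.η) * c.θ (y + c.ξ m + c.η)) • X, fun k hk A => ?_, fun w hw => ?_⟩
      · exact (hX k (fun h => hk (List.mem_cons_of_mem _ h)) A).smul_left _
      · obtain ⟨h1, h2⟩ := h (Function.update w m (c.wv (c.ξ m + s))) (hw.2.update _ hm)
        refine ⟨fun j => ?_, fun j => ?_⟩
        · have h3 := c.covOp_mul_row_Ur hω hw.1 y 1 (fun _ => Commute.one_left _) (l := l) j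
          simp only [mul_one] at h3
          rw [h3]
          simp only [h1 _]
          have h4 := c.covOp_mul_row_lax_swap hω
            (w := Function.update w m (c.wv (c.ξ m + s))) (n := m) (u := y + c.ξ m)
            (p := -y + (s - c.η)) (q := c.ξ m + s) (p' := -y + s) (q' := c.ξ m + s - c.η)
            (by simp) (by ring) (by ring) (by ring) j
          rw [Function.update_idem, ← hw.1, Function.update_eq_self] at h4
          have h5 : ∑ p, c.wv (-y + (s - c.η)) p •
              (covOp (Function.update w m (c.wv (c.ξ m + s))) * X) * c.lax m (y + c.ξ m) p j =
              covOp (Function.update w m (c.wv (c.ξ m + s))) *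
                row (c.wv (-y + (s - c.η))) (c.lax m (y + c.ξ m)) j * X := by
            rw [mul_assoc, ← (c.row_lax_commute (hX m hm) _ _ _).eq, ← mul_assoc, row,
              Finset.mul_sum]
            simp only [smul_mul_assoc, mul_smul_comm]
          rw [h5, h4, mul_smul_comm, smul_mul_assoc, smul_smul, smul_smul]
          congr 1; ring
        · rw [mul_smul_comm, smul_mul_assoc,
            c.covOp_mul_row_Ur hω hw.1 x X (fun A => hX m hm A) (l := l) j]
          simp only [h2, zero_mul, Finset.sum_const_zero, smul_zero]

end Chain

end EightVertex

end

noncomputable section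

namespace EightVertex

/-! ### Entire dependence on the spectral parameter -/

theorem th1_comp {τ : ℂ} (hτ : 0 < τ.im) {g : ℂ → ℂ} (hg : Differentiable ℂ g) :
    Differentiable ℂ fun x => th1 (g x) τ := (differentiable_th1 hτ).comp hg

theorem th2_comp {τ : ℂ} (hτ : 0 < τ.im) {g : ℂ → ℂ} (hg : Differentiable ℂ g) :
    Differentiable ℂ fun x => th2 (g x) τ := (differentiable_th2 hτ).comp hg

theorem th3_comp {τ : ℂ} (hτ : 0 < τ.im) {g : ℂ → ℂ} (hg : Differentiable ℂ g) :
    Differentiable ℂ fun x => th3 (g x) τ := (differentiable_th3 hτ).comp hg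

theorem th4_comp {τ : ℂ} (hτ : 0 < τ.im) {g : ℂ → ℂ} (hg : Differentiable ℂ g) :
    Differentiable ℂ fun x => th4 (g x) τ := (differentiable_th4 hτ).comp hg

namespace Chain

variable {N : ℕ} (c : Chain N)

theorem differentiable_R (hω : 0 < c.ω.im) (i j k m : Fin 2) :
    Differentiable ℂ fun x => c.R x i j k m := by
  have hω2 := two_im_pos hω
  have t1 := th1_comp hω2 (g := fun x => x) differentiable_id
  have t4 := th4_comp hω2 (g := fun x => x) differentiable_id
  have t1' := th1_comp hω2 (g := fun x => x + c.η) (by fun_prop)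
  have t4' := th4_comp hω2 (g := fun x => x + c.η) (by fun_prop)
  have da : Differentiable ℂ fun x => c.Ra x :=
    (((differentiable_const _).mul t1').mul t4).div_const _
  have db : Differentiable ℂ fun x => c.Rb x :=
    (((differentiable_const _).mul t1).mul t4').div_const _
  have dc : Differentiable ℂ fun x => c.Rc x :=
    (((differentiable_const _).mul t4).mul t4').div_const _
  have dd : Differentiable ℂ fun x => c.Rd x :=
    (((differentiable_const _).mul t1').mul t1).div_const _
  fin_cases i <;> fin_cases j <;> fin_cases k <;> fin_cases m <;> simp [R, da, db, dc, dd]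

theorem differentiable_Kreg (hω : 0 < c.ω.im) (i j : Fin 2) :
    Differentiable ℂ fun x => c.Kreg x i j := by
  obtain ⟨c0, cx, cy, cz, h⟩ := c.Kreg_eq_boundaryMatrix hω
  have t1 := differentiable_th1 hω
  have t2 := differentiable_th2 hω
  have t3 := differentiable_th3 hω
  have t4 := differentiable_th4 hω
  have d0 := ((t2.mul t3).mul t4).const_mul c0
  have dx := ((t1.mul t2).mul t3).const_mul cx
  have dy := ((t1.mul t2).mul t4).const_mul cy
  have dz := ((t1.mul t3).mul t4).const_mul cz
  simp only [h, boundaryMatrix, pauliMatrix]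
  fin_cases i <;> fin_cases j
  · exact d0.add dz
  · exact dx.add dy
  · exact dx.sub dy
  · exact d0.sub dz

/-- All entries of a matrix of operators are entire. -/
def EntireMat (T : ℂ → Matrix (Fin 2) (Fin 2) (Op N)) : Prop :=
  ∀ i j h k, Differentiable ℂ fun x => T x i j h k

theorem EntireMat.mul {S T : ℂ → Matrix (Fin 2) (Fin 2) (Op N)} (hS : EntireMat S)
    (hT : EntireMat T) : EntireMat fun x => S x * T x := by
  intro i j h k
  simp only [Matrix.mul_apply, Matrix.sum_apply]
  exact Differentiable.fun_sum fun m _ => Differentiable.fun_sum fun n _ => (hS i m h n).mul (hT m j n k)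

theorem entireMat_lax (hω : 0 < c.ω.im) (n : Fin N) (z : ℂ) :
    EntireMat fun x => c.lax n (x + z) := by
  intro i j h k
  simp only [lax, Matrix.map_apply, site]
  split_ifs
  · exact (c.differentiable_R hω _ _ _ _).comp (differentiable_id.add_const z)
  · exact differentiable_const _

theorem entireMat_Ur (hω : 0 < c.ω.im) : ∀ l : List (Fin N), EntireMat fun x => c.Ur x l
  | [] => fun i j h k => by
    simp only [Ur, aux, Matrix.map_apply, Matrix.smul_apply]
    exact (c.differentiable_Kreg hω i j).smul_const _
  | n :: l => by
    have h1 := c.entireMat_lax hω n (-c.ξ n)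
    simp only [← sub_eq_add_neg] at h1
    exact (h1.mul (entireMat_Ur hω l)).mul (c.entireMat_lax hω n (c.ξ n))

theorem differentiable_vv (hω : 0 < c.ω.im) {g : ℂ → ℂ} (hg : Differentiable ℂ g) (i : Fin 2) :
    Differentiable ℂ fun x => c.vv (g x) i := by
  have hω2 := two_im_pos hω
  fin_cases i
  · exact th2_comp hω2 hg
  · exact th3_comp hω2 hg

theorem differentiable_wv (hω : 0 < c.ω.im) {g : ℂ → ℂ} (hg : Differentiable ℂ g) (i : Fin 2) :
    Differentiable ℂ fun x => c.wv (g x) i := by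
  have hω2 := two_im_pos hω
  fin_cases i
  · exact (th3_comp hω2 hg).neg
  · exact th2_comp hω2 hg

theorem differentiable_gauged (hω : 0 < c.ω.im) (l : List (Fin N)) (s t : ℂ) (h k : Fin N → Fin 2) :
    Differentiable ℂ fun x => c.gauged l s t x h k := by
  simp only [gauged, sandwich, Matrix.sum_apply, Matrix.smul_apply, smul_eq_mul]
  exact Differentiable.fun_sum fun i _ => Differentiable.fun_sum fun j _ =>
    ((c.differentiable_wv hω (by fun_prop) i).mul (c.differentiable_vv hω (by fun_prop) j)).mul
      (c.entireMat_Ur hω l i j h k)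

theorem differentiable_mul_gauged (hω : 0 < c.ω.im) (l : List (Fin N)) (s t : ℂ) (X : Op N)
    (h k : Fin N → Fin 2) : Differentiable ℂ fun x => (X * c.gauged l s t x) h k := by
  simp only [Matrix.mul_apply]
  exact Differentiable.fun_sum fun m _ => (c.differentiable_gauged hω l s t m k).const_mul _

theorem differentiable_refFactor_nil (hω : 0 < c.ω.im) (s : ℂ) :
    Differentiable ℂ fun x => c.refFactor x [] s := by
  simp only [refFactor, dotProduct, mulVec]
  exact Differentiable.fun_sum fun i _ => (c.differentiable_wv hω (by fun_prop) i).mul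
    (Differentiable.fun_sum fun j _ => (c.differentiable_Kreg hω i j).mul
      (c.differentiable_vv hω (by fun_prop) j))

/-! ### The gauge transformed operators in terms of intertwining vectors -/

/-- The gauge shifts `(α - b + 1)η` and `(α + b + 1)η`. -/
def gl (b : ℂ) : ℂ := (c.α - b + 1) * c.η

def gr (b : ℂ) : ℂ := (c.α + b + 1) * c.η

theorem Yreg_eq (b x : ℂ) : c.Yreg (b - 1) x = (c.θ (b * c.η))⁻¹ • c.wv (x + c.gl b) := by
  rw [Yreg, wv, gl, sub_add_cancel, show c.α - (b - 1) = c.α - b + 1 by ring]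

theorem B_eq_gauged (x b : ℂ) : c.B x b =
    (c.θ (b * c.η))⁻¹ • c.gauged (sites N) (c.gl b) (c.gl b) (x - c.η / 2) := by
  rw [B, Yreg_eq, (sandwich_smul _ 1 _ _ _).2, dress_eq_Ur, gauged]
  congr 2
  simp only [Y, vv, gl]
  rw [show c.η / 2 - x + (c.α - (b - 1)) * c.η = -(x - c.η / 2) + (c.α - b + 1) * c.η by ring]

theorem A_eq_gauged (x b : ℂ) : c.A x (b + 2) =
    (c.θ (b * c.η))⁻¹ • c.gauged (sites N) (c.gl b) (c.gr b) (x - c.η / 2) := by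
  rw [A, show b + 2 - 3 = b - 1 by ring, Yreg_eq, (sandwich_smul _ 1 _ _ _).2, dress_eq_Ur, gauged]
  congr 2
  simp only [X, vv, gr]
  rw [show c.η / 2 - x + (c.α + (b + 2 - 1)) * c.η = -(x - c.η / 2) + (c.α + b + 1) * c.η by ring]

theorem rK12_eq_refFactor (x b : ℂ) : c.rK12 x b =
    (c.θ ((b + N) * c.η))⁻¹ * c.refFactor (x - c.η / 2) [] (c.gl b - N * c.η) := by
  have h1 : c.gl (b + N) = c.gl b - N * c.η := by simp only [gl]; ring
  have h2 : c.Y (b + N - 1) (c.η / 2 - x) = c.vv (-(x - c.η / 2) + c.gl (b + N)) := by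
    rw [Y, vv, gl, show c.η / 2 - x + (c.α - (b + N - 1)) * c.η =
      -(x - c.η / 2) + (c.α - (b + N) + 1) * c.η by ring]
  rw [rK12, Yreg_eq, smul_dotProduct, smul_eq_mul, refFactor, h2, h1]

theorem refFactor_eq (x : ℂ) : ∀ (l : List (Fin N)) (s : ℂ), c.refFactor x l s =
    (l.map fun n => c.θ (x - c.ξ n + c.η) * c.θ (x + c.ξ n)).prod *
      c.refFactor x [] (s - l.length * c.η)
  | [], s => by simp
  | n :: l, s => by
    rw [show c.refFactor x (n :: l) s = c.θ (x - c.ξ n + c.η) * c.θ (x + c.ξ n) *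
      c.refFactor x l (s - c.η) from rfl, refFactor_eq x l, List.map_cons, List.prod_cons, List.length_cons,
      show s - c.η - l.length * c.η = s - ((l.length + 1 : ℕ) : ℂ) * c.η by push_cast; ring]
    ring

theorem prod_sites (f : Fin N → ℂ) : ((sites N).map f).prod = ∏ n, f n := by
  rw [sites, List.map_reverse, List.prod_reverse, ← List.ofFn_eq_map, List.prod_ofFn]

theorem length_sites : (sites N).length = N := by simp [sites]

/-- The components of the reference covector. -/
def refW (s : ℂ) (n : Fin N) : Fin 2 → ℂ := c.wv (c.ξ n + s - (N - n) * c.η)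

/-- The last site is outermost and s decreases inwards, so an initial segment of length m starts at
s - (N-m)η. -/
theorem matched_refW_take (s : ℂ) : ∀ m ≤ N, c.Matched (c.refW s) ((List.finRange N).take m).reverse
    (s - (N - m) * c.η)
  | 0, _ => trivial
  | m + 1, hm => by
    have h1 : ((List.finRange N).take (m + 1)).reverse =
        (⟨m, hm⟩ : Fin N) :: ((List.finRange N).take m).reverse := by
      rw [List.take_succ_eq_append_getElem (by simpa using hm)]
      simp
    rw [h1]
    refine ⟨?_, ?_⟩
    · rw [refW]; congr 1; push_cast; ring
    · have := matched_refW_take s m (Nat.le_of_succ_le hm)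
      convert this using 1
      push_cast; ring

theorem matched_refW (s : ℂ) : c.Matched (c.refW s) (sites N) s := by
  have := c.matched_refW_take s N le_rfl
  rw [List.take_of_length_le (by simp)] at this
  simpa [sites] using this

/-- The normalisation of the reference covector. -/
def refNorm : ℂ := 2 ^ N * ∏ n, (c.θ (c.ξ n + (c.α + 1) * c.η))⁻¹

/-- All shifts of `b` by integers are generic. -/
def Good (b : ℂ) : Prop := ∀ k : ℤ, c.θ ((b + k) * c.η) ≠ 0

theorem Good.sub_two {c : Chain N} {b : ℂ} (h : c.Good b) : c.Good (b - 2) := fun k => by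
  have := h (k - 2)
  push_cast at this
  rwa [show b - 2 + k = b + (k - 2) by ring]

theorem Good.ne_zero {c : Chain N} {b : ℂ} (h : c.Good b) : c.θ (b * c.η) ≠ 0 := by
  simpa using h 0

/-- The prefactors θ((N-n+b+1)η) of the reference covector cancel the b-dependent denominators of Ỹ,
leaving a normalisation independent of b. -/
theorem ref_eq {b : ℂ} (hb : c.Good b) : c.ref b = c.refNorm • cov (c.refW (c.gl b)) := by
  ext h
  simp only [ref, Pi.smul_apply, smul_eq_mul, refNorm, cov, mul_assoc]
  congr 1
  rw [← Finset.prod_mul_distrib, ← Finset.prod_mul_distrib]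
  refine Finset.prod_congr rfl fun n _ => ?_
  have h1 : b + N - (n + 1) = (b + N - n) - 1 := by ring
  have h2 : (N - (n + 1) + b + 1 : ℂ) = b + N - n := by ring
  have h3 : c.θ ((b + N - n) * c.η) ≠ 0 := by
    have := hb (N - n)
    push_cast at this
    rwa [← add_sub_assoc] at this
  rw [Yt, h1, Yreg_eq, h2, refW, Pi.smul_apply, Pi.smul_apply, smul_eq_mul, smul_eq_mul,
    show c.ξ n + c.gl (b + N - n) = c.ξ n + c.gl b - (N - n) * c.η by simp only [gl]; ring,
    mul_left_comm, mul_inv_cancel_left₀ h3]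

end Chain

end EightVertex

end

noncomputable section

namespace EightVertex

namespace Chain

variable {N : ℕ} (c : Chain N)

/-! ### The separated covectors -/

/-- `𝒜(x + η/2 | b + 2)`. -/
def Ag (b x : ℂ) : Op N := (c.θ (b * c.η))⁻¹ • c.gauged (sites N) (c.gl b) (c.gr b) x

/-- The covectors obtained from the reference covector by `𝒜` at the sites of a list. -/
def S (b : ℂ) : List (Fin N) → Op N
  | [] => covOp (c.refW (c.gl b))
  | n :: l => S b l * c.Ag b (-c.ξ n)

/-- Genericity of the inhomogeneities. -/
structure Generic : Prop where
  sub : ∀ {a b}, a ≠ b → c.θ (c.ξ a - c.ξ b) ≠ 0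
  sub_add : ∀ {a b}, a ≠ b → c.θ (c.ξ a - c.ξ b + c.η) ≠ 0
  add : ∀ a b, c.θ (c.ξ a + c.ξ b) ≠ 0
  add_add : ∀ a b, c.θ (c.ξ a + c.ξ b + c.η) ≠ 0
  add_sub : ∀ a b, c.θ (c.ξ a + c.ξ b - c.η) ≠ 0

/-- The factor of one site in the eigenvalue of `ℬ`. -/
def siteFactor (l : List (Fin N)) (n : Fin N) (x : ℂ) : ℂ :=
  if n ∈ l then c.θ (x - c.ξ n) * c.θ (x + c.ξ n + c.η) else c.θ (x - c.ξ n + c.η) * c.θ (x + c.ξ n)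

/-- The site dependent part of the eigenvalue of `ℬ`. -/
def eps (l : List (Fin N)) (x : ℂ) : ℂ := ∏ n, c.siteFactor l n x

/-- The boundary part of the eigenvalue of `ℬ`. -/
def bdry (b x : ℂ) : ℂ := c.refFactor x [] (c.gl b - N * c.η)

theorem differentiable_siteFactor (hω : 0 < c.ω.im) (l : List (Fin N)) (n : Fin N) :
    Differentiable ℂ (c.siteFactor l n) := by
  have dθ := c.differentiable_θ hω
  unfold siteFactor
  by_cases h : n ∈ l <;> simp only [h, if_true, if_false] <;> fun_prop

theorem differentiable_eps (hω : 0 < c.ω.im) (l : List (Fin N)) : Differentiable ℂ (c.eps l) :=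
  Differentiable.fun_finsetProd fun n _ => c.differentiable_siteFactor hω l n

theorem gl_sub_two (b : ℂ) : c.gl (b - 2) = c.gl b + 2 * c.η := by simp only [gl]; ring

theorem S_nil_mul (hω : 0 < c.ω.im) (b x : ℂ) :
    c.S b [] * c.gauged (sites N) (c.gl b) (c.gl b) x = (c.bdry b x * c.eps [] x) • c.S (b - 2) [] := by
  rw [S, c.covOp_mul_gauged hω x sites_nodup (c.matched_refW _)
    (w' := c.refW (c.gl (b - 2))) (by rw [← gl_sub_two]; exact c.matched_refW _)
    (fun n hn => absurd (mem_sites n) hn), refFactor_eq, prod_sites, length_sites, mul_comm]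
  simp only [eps, siteFactor, bdry, List.not_mem_nil, if_false, S]

/-- The two gauge shifts differ by 2bη, so the pairing contributes θ(bη), the denominator in 𝒜. -/
theorem Passes.mul_Ag {c : Chain N} (hω : 0 < c.ω.im) {b x : ℂ} (hb : c.Good b) {Φ χ : Op N}
    (h : c.Passes (sites N) (c.gl b) x Φ χ) :
    Φ * c.Ag b x = c.θ (-x + (c.α + 1) * c.η) • χ := by
  rw [Ag, mul_smul_comm, h.mul_gauged hω (c.gr b) (-x + (c.α + 1) * c.η) (-(b * c.η))
    (by simp only [gl]; ring) (by simp only [gr]; ring), smul_smul, θ_neg]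
  congr 1
  have := hb.ne_zero
  field_simp

theorem Passes.comm_Ag {c : Chain N} (hω : 0 < c.ω.im) {b x y : ℂ} (hb : c.Good b)
    {Φ χ χ' : Op N} (hx : c.Passes (sites N) (c.gl b) x Φ χ)
    (hy : c.Passes (sites N) (c.gl b) y Φ χ') (h1 : c.θ (x - y + c.η) ≠ 0)
    (h2 : c.θ (x + y + c.η) ≠ 0) : Φ * c.Ag b x * c.Ag b y = Φ * c.Ag b y * c.Ag b x := by
  have h3 : c.θ ((c.gl b - c.gr b) / 2 + c.η) ≠ 0 := by
    rw [show (c.gl b - c.gr b) / 2 + c.η = -((b + ((-1 : ℤ) : ℂ)) * c.η) by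
      simp only [gl, gr]; push_cast; ring, θ_neg]
    exact neg_ne_zero.2 (hb (-1))
  simp only [Ag, mul_smul_comm, smul_mul_assoc, hx.comm hω sites_nodup hy h1 h2 h3]

theorem exists_mul_ne_zero {f g : ℂ → ℂ} (hf : Differentiable ℂ f) (hg : Differentiable ℂ g)
    (h1 : ∃ x, f x ≠ 0) (h2 : ∃ x, g x ≠ 0) : ∃ x, f x * g x ≠ 0 := by
  by_contra h
  push Not at h
  rcases entire_mul_eq_zero hf hg h with h | h
  · obtain ⟨x, hx⟩ := h1; exact hx (h x)
  · obtain ⟨x, hx⟩ := h2; exact hx (h x)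

theorem exists_θ_add_ne_zero (hω : 0 < c.ω.im) (z : ℂ) : ∃ x, c.θ (x + z) ≠ 0 := by
  obtain ⟨x, hx⟩ := c.exists_θ_ne_zero hω
  exact ⟨x - z, by simpa using hx⟩

theorem exists_θ_sub_ne_zero (hω : 0 < c.ω.im) (z : ℂ) : ∃ x, c.θ (z - x) ≠ 0 := by
  obtain ⟨x, hx⟩ := c.exists_θ_ne_zero hω
  exact ⟨z - x, by simpa using hx⟩

theorem eps_eq_zero {l : List (Fin N)} {n : Fin N} {x : ℂ} (h : c.siteFactor l n x = 0) :
    c.eps l x = 0 := Finset.prod_eq_zero (Finset.mem_univ n) h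

theorem eps_cons (l : List (Fin N)) (n : Fin N) (x : ℂ) : c.eps (n :: l) x =
    c.θ (x - c.ξ n) * c.θ (x + c.ξ n + c.η) *
      ∏ m ∈ Finset.univ.erase n, c.siteFactor l m x := by
  rw [eps, ← Finset.mul_prod_erase _ _ (Finset.mem_univ n)]
  congr 1
  · simp [siteFactor]
  · refine Finset.prod_congr rfl fun m hm => ?_
    simp [siteFactor, Finset.ne_of_mem_erase hm]

theorem eps_of_not_mem {l : List (Fin N)} {n : Fin N} (hn : n ∉ l) (x : ℂ) : c.eps l x =
    c.θ (x - c.ξ n + c.η) * c.θ (x + c.ξ n) *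
      ∏ m ∈ Finset.univ.erase n, c.siteFactor l m x := by
  rw [eps, ← Finset.mul_prod_erase _ _ (Finset.mem_univ n)]
  congr 1
  simp [siteFactor, hn]

/-- For n outside l the eigenvalue vanishes at -ξ_n, at b and at b - 2 alike, so `Passes.exchange`
applies. It replaces θ(y-ξ_n+η)θ(y+ξ_n) by θ(y-ξ_n)θ(y+ξ_n+η). -/
theorem S_mul_gauged (hω : 0 < c.ω.im) : ∀ {l : List (Fin N)}, l.Nodup → ∀ {b : ℂ}, c.Good b → ∀ x,
    c.S b l * c.gauged (sites N) (c.gl b) (c.gl b) x = (c.bdry b x * c.eps l x) • c.S (b - 2) l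
  | [], _, b, _, x => c.S_nil_mul hω b x
  | n :: l, hl, b, hb, x => by
    obtain ⟨hn, hl⟩ := List.nodup_cons.1 hl
    have IH := @S_mul_gauged hω l hl
    have e0 : c.eps l (-c.ξ n) = 0 :=
      c.eps_eq_zero (n := n) (by rw [siteFactor, if_neg hn, neg_add_cancel, θ_zero, mul_zero])
    have hp : ∀ {b}, c.Good b → ∃ χ, c.Passes (sites N) (c.gl b) (-c.ξ n) (c.S b l) χ :=
      fun {b} hb => c.exists_passes hω (by rw [IH hb, e0, mul_zero, zero_smul])
    obtain ⟨χ, h1⟩ := hp hb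
    obtain ⟨χ', h2⟩ := hp hb.sub_two
    have key := fun y => h1.exchange hω sites_nodup (y := y) (by rw [← gl_sub_two]; exact h2)
      (IH hb y)
    rw [S, S, h1.mul_Ag hω hb, h2.mul_Ag hω hb.sub_two, smul_mul_assoc, smul_comm]
    congr 1
    have dθ := c.differentiable_θ hω
    have dE : Differentiable ℂ fun y => ∏ m ∈ Finset.univ.erase n, c.siteFactor l m y :=
      Differentiable.fun_finsetProd fun m _ => c.differentiable_siteFactor hω l m
    have db : Differentiable ℂ fun y => c.bdry b y := c.differentiable_refFactor_nil hω _
    ext h k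
    -- The cancelled function of y is the common factor left in `Passes.exchange` times the scalar
    -- in front of χ ℬ(y). Cancelling it as an entire function gives the relation at every x.
    refine entire_cancel (f := fun y => (c.θ (-c.ξ n - y + c.η) * c.θ (c.gl b + c.η - y)) *
      (c.θ (y + (-c.ξ n + c.η)) * c.θ (y + c.ξ n)))
      (g := fun y => (χ * c.gauged (sites N) (c.gl b) (c.gl b) y) h k)
      (h := fun y => ((c.bdry b y * c.eps (n :: l) y) • χ') h k) (by fun_prop)
      (c.differentiable_mul_gauged hω _ _ _ _ _ _) ?_ ?_ (fun y => ?_) x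
    · simp only [Matrix.smul_apply, smul_eq_mul]
      exact (db.mul (c.differentiable_eps hω _)).mul_const _
    · refine exists_mul_ne_zero (by fun_prop) (by fun_prop)
        (exists_mul_ne_zero (by fun_prop) (by fun_prop) ?_ (c.exists_θ_sub_ne_zero hω _))
        (exists_mul_ne_zero (by fun_prop) (by fun_prop) (c.exists_θ_add_ne_zero hω _)
          (c.exists_θ_add_ne_zero hω _))
      obtain ⟨z, hz⟩ := c.exists_θ_sub_ne_zero hω (-c.ξ n + c.η)
      exact ⟨z, by rwa [show -c.ξ n - z + c.η = -c.ξ n + c.η - z by ring]⟩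
    · have := congrFun (congrFun (key y) h) k
      simp only [Matrix.smul_apply, smul_eq_mul] at this ⊢
      rw [c.eps_of_not_mem hn] at this
      rw [c.eps_cons]
      rw [show -c.ξ n + y + c.η = y + (-c.ξ n + c.η) by ring, show y - -c.ξ n = y + c.ξ n by ring,
        show -c.ξ n + y = y - c.ξ n by ring,
        show y - c.ξ n + c.η = y + (-c.ξ n + c.η) by ring] at this
      linear_combination this

theorem exists_S_passes (hω : 0 < c.ω.im) {l : List (Fin N)} (hl : l.Nodup) {b : ℂ} (hb : c.Good b)
    {n : Fin N} {x : ℂ} (hx : c.siteFactor l n x = 0) :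
    ∃ χ, c.Passes (sites N) (c.gl b) x (c.S b l) χ :=
  c.exists_passes hω (by rw [c.S_mul_gauged hω hl hb, c.eps_eq_zero hx, mul_zero, zero_smul])

theorem siteFactor_neg {l : List (Fin N)} {n : Fin N} (hn : n ∉ l) :
    c.siteFactor l n (-c.ξ n) = 0 := by
  rw [siteFactor, if_neg hn, neg_add_cancel, θ_zero, mul_zero]

theorem siteFactor_sub {l : List (Fin N)} {n : Fin N} (hn : n ∉ l) :
    c.siteFactor l n (c.ξ n - c.η) = 0 := by
  rw [siteFactor, if_neg hn, show c.ξ n - c.η - c.ξ n + c.η = 0 by ring, θ_zero, zero_mul]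

theorem siteFactor_neg_sub {l : List (Fin N)} {n : Fin N} (hn : n ∈ l) :
    c.siteFactor l n (-c.ξ n - c.η) = 0 := by
  rw [siteFactor, if_pos hn, show -c.ξ n - c.η + c.ξ n + c.η = 0 by ring, θ_zero, mul_zero]

/-- The covector of l passes at both -ξ_n and -ξ_m, and genericity keeps the scalars of
`Passes.comm_Ag` nonzero. -/
theorem S_swap (hω : 0 < c.ω.im) (hc : c.Generic) {l : List (Fin N)} {n m : Fin N}
    (hl : (n :: m :: l).Nodup) {b : ℂ} (hb : c.Good b) :
    c.S b (n :: m :: l) = c.S b (m :: n :: l) := by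
  obtain ⟨hn, hl⟩ := List.nodup_cons.1 hl
  obtain ⟨hm, hl⟩ := List.nodup_cons.1 hl
  have hnm : n ≠ m := fun e => hn (e ▸ List.mem_cons_self)
  have hn' : n ∉ l := fun h => hn (List.mem_cons_of_mem _ h)
  obtain ⟨χ, h1⟩ := c.exists_S_passes hω hl hb (c.siteFactor_neg hm)
  obtain ⟨χ', h2⟩ := c.exists_S_passes hω hl hb (c.siteFactor_neg hn')
  refine h1.comm_Ag hω hb h2 ?_ ?_
  · rw [show -c.ξ m - -c.ξ n + c.η = c.ξ n - c.ξ m + c.η by ring]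
    exact hc.sub_add hnm
  · rw [show -c.ξ m + -c.ξ n + c.η = -(c.ξ m + c.ξ n - c.η) by ring, θ_neg]
    exact neg_ne_zero.2 (hc.add_sub _ _)

theorem S_perm (hω : 0 < c.ω.im) (hc : c.Generic) {b : ℂ} (hb : c.Good b) {l l' : List (Fin N)}
    (h : l.Perm l') : l.Nodup → c.S b l = c.S b l' := by
  induction h with
  | nil => intro _; rfl
  | cons n _ ih => intro hl; rw [S, S, ih (List.nodup_cons.1 hl).2]
  | swap n m l => intro hl; exact c.S_swap hω hc hl hb
  | trans h1 _ ih1 ih2 => intro hl; rw [ih1 hl, ih2 (h1.nodup_iff.1 hl)]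

/-- Shifts below the range annihilate. -/
theorem S_mul_Ag_lower (hω : 0 < c.ω.im) (hc : c.Generic) {b : ℂ} (hb : c.Good b) {n : Fin N} :
    ∀ {l : List (Fin N)}, l.Nodup → n ∉ l → c.S b l * c.Ag b (c.ξ n - c.η) = 0
  | [], _, _ => by
    have := c.covOp_mul_row_eq_zero hω (n := n) rfl sites_nodup (mem_sites n) (c.matched_refW (c.gl b))
    rw [S, Ag, mul_smul_comm, c.mul_gauged]
    simp only [this, smul_zero, Finset.sum_const_zero]
  | m :: l, hl, hn => by
    obtain ⟨hm, hl⟩ := List.nodup_cons.1 hl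
    have hn' : n ∉ l := fun h => hn (List.mem_cons_of_mem _ h)
    have hnm : n ≠ m := fun e => hn (e ▸ List.mem_cons_self)
    obtain ⟨χ, h1⟩ := c.exists_S_passes hω hl hb (c.siteFactor_sub hn')
    obtain ⟨χ', h2⟩ := c.exists_S_passes hω hl hb (c.siteFactor_neg hm)
    rw [S, ← h1.comm_Ag hω hb h2, S_mul_Ag_lower hω hc hb hl hn', zero_mul]
    · rw [show c.ξ n - c.η - -c.ξ m + c.η = c.ξ n + c.ξ m by ring]
      exact hc.add _ _
    · rw [show c.ξ n - c.η + -c.ξ m + c.η = c.ξ n - c.ξ m by ring]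
      exact hc.sub hnm

/-- Shifts above the range annihilate. -/
theorem S_mul_Ag_upper (hω : 0 < c.ω.im) (hc : c.Generic) {b : ℂ} (hb : c.Good b) {n : Fin N} :
    ∀ {l : List (Fin N)}, (n :: l).Nodup → c.S b (n :: l) * c.Ag b (-c.ξ n - c.η) = 0
  | [], _ => by
    obtain ⟨X, -, hX⟩ := c.exists_annihilated hω (n := n) rfl rfl (s := c.gl b) sites_nodup
      (mem_sites n)
    obtain ⟨h1, h2⟩ := hX _ (c.matched_refW (c.gl b))
    rw [S, S, h1.mul_Ag hω hb, Ag, mul_smul_comm, smul_mul_assoc, c.mul_gauged]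
    simp only [h2, smul_zero, Finset.sum_const_zero]
  | m :: l, hl => by
    -- With m applied last, the upper shift at n commutes past it and meets the shorter list, on
    -- which it vanishes by induction.
    rw [c.S_swap hω hc hl hb]
    obtain ⟨hn, hl⟩ := List.nodup_cons.1 hl
    obtain ⟨hm, hl⟩ := List.nodup_cons.1 hl
    have hn' : n ∉ l := fun h => hn (List.mem_cons_of_mem _ h)
    have hnm : n ≠ m := fun e => hn (e ▸ List.mem_cons_self)
    have hnl : (n :: l).Nodup := List.nodup_cons.2 ⟨hn', hl⟩
    have hm' : m ∉ n :: l := by simp [hnm.symm, hm]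
    obtain ⟨χ, h1⟩ := c.exists_S_passes hω hnl hb (c.siteFactor_neg_sub List.mem_cons_self)
    obtain ⟨χ', h2⟩ := c.exists_S_passes hω hnl hb (c.siteFactor_neg hm')
    rw [show c.S b (m :: n :: l) = c.S b (n :: l) * c.Ag b (-c.ξ m) from rfl,
      ← h1.comm_Ag hω hb h2, S_mul_Ag_upper hω hc hb hnl, zero_mul]
    · rw [show -c.ξ n - c.η - -c.ξ m + c.η = c.ξ m - c.ξ n by ring]
      exact hc.sub hnm.symm
    · rw [show -c.ξ n - c.η + -c.ξ m + c.η = -(c.ξ n + c.ξ m) by ring, θ_neg]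
      exact neg_ne_zero.2 (hc.add _ _)

/-- `𝒜` at the reflected point undoes the raising of a site. -/
theorem S_cons_mul_Ag (hω : 0 < c.ω.im) {b : ℂ} (hb : c.Good b) {n : Fin N} {l : List (Fin N)}
    (hl : (n :: l).Nodup) : c.S b (n :: l) * c.Ag b (c.ξ n) =
      (c.θ (c.ξ n + (c.α + 1) * c.η) * c.θ (-c.ξ n + (c.α + 1) * c.η) *
        c.qdet (-c.ξ n) (sites N)) • c.S b l := by
  obtain ⟨hn, hl⟩ := List.nodup_cons.1 hl
  obtain ⟨χ, h1⟩ := c.exists_S_passes hω hl hb (c.siteFactor_neg hn)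
  have h2 := h1.neg hω
  rw [neg_neg] at h2
  rw [S, h1.mul_Ag hω hb, smul_mul_assoc, h2.mul_Ag hω hb, smul_smul, smul_smul, neg_neg]

end Chain

end EightVertex

end

noncomputable section

namespace EightVertex

namespace Chain

variable {N : ℕ} (c : Chain N)

/-! ### The quantum determinant -/

/-- The roots are even and k is odd, so the product of the two values of g is a difference of
squares: its two terms are the diagonal and off-diagonal contributions to the determinant. -/
theorem det_Kreg {ρ₁ ρ₂ : ℂ → ℂ} (hρ : c.IsRoots ρ₁ ρ₂) {x : ℂ} (hx : th4 (2 * x) (2 * c.ω) ≠ 0) :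
    (c.Kreg x).det = th4 (2 * x) (2 * c.ω) ^ 2 *
      (c.g ρ₁ ρ₂ (c.η / 2 + x) * c.g ρ₁ ρ₂ (c.η / 2 - x)) := by
  obtain ⟨e1, e2, s1, s2⟩ := hρ
  have h1 := s1 x
  have h2 := s2 x
  have hE : Complex.exp c.τ * Complex.exp (-c.τ) = 1 := by rw [← Complex.exp_add]; simp
  rw [Matrix.det_fin_two, Kreg, g, g, show c.η / 2 + x - c.η / 2 = x by ring,
    show c.η / 2 - x - c.η / 2 = -x by ring, e1, e2]
  simp only [mul_neg, th1_neg, th4_neg, of_apply, cons_val', cons_val_zero, cons_val_one,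
    cons_val_fin_one, add_comm x]
  generalize ρ₁ x = r1 at *
  generalize ρ₂ x = r2 at *
  generalize Complex.exp c.τ = E at *
  generalize Complex.exp (-c.τ) = E' at *
  generalize Complex.exp (2 * c.τ) = F at *
  generalize Complex.exp (-2 * c.τ) = F' at *
  generalize th4 (2 * x) (2 * c.ω) = f at *
  generalize th1 (2 * x) (2 * c.ω) = u at *
  generalize th1 x (2 * c.ω) = a at *
  generalize th4 x (2 * c.ω) = b at *
  generalize th1 (c.ζ + x) (2 * c.ω) = p1 at *
  generalize th4 (c.ζ + x) (2 * c.ω) = p4 at *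
  generalize th1 (c.ζ - x) (2 * c.ω) = m1 at *
  generalize th4 (c.ζ - x) (2 * c.ω) = m4 at *
  have k1 : c.κ * u * th4 c.ζ (2 * c.ω) ^ 3 / (th1 c.ζ (2 * c.ω) * th4 0 (2 * c.ω) ^ 2 * f) =
      c.κ * u * th4 c.ζ (2 * c.ω) ^ 3 / (th1 c.ζ (2 * c.ω) * th4 0 (2 * c.ω) ^ 2) / f := by
    rw [div_div]
  have k2 : -(c.κ * u) * th4 c.ζ (2 * c.ω) ^ 3 / (th1 c.ζ (2 * c.ω) * th4 0 (2 * c.ω) ^ 2 * f) =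
      -(c.κ * u * th4 c.ζ (2 * c.ω) ^ 3 / (th1 c.ζ (2 * c.ω) * th4 0 (2 * c.ω) ^ 2)) / f := by
    rw [neg_mul, neg_div, neg_div, div_div]
  rw [k1, k2]
  set Q := c.κ * u * th4 c.ζ (2 * c.ω) ^ 3 / (th1 c.ζ (2 * c.ω) * th4 0 (2 * c.ω) ^ 2) with hQ
  have k3 : ∀ e A, c.κ * e * u * A * th4 c.ζ (2 * c.ω) ^ 3 /
      (th1 c.ζ (2 * c.ω) * th4 0 (2 * c.ω) ^ 2) = e * A * Q := by intros; rw [hQ]; ring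
  rw [k3, k3]
  have k5 : f ^ 2 * ((th4 c.ζ (2 * c.ω) / th1 c.ζ (2 * c.ω) * r1 + Q / f * r2) *
      (th4 c.ζ (2 * c.ω) / th1 c.ζ (2 * c.ω) * r1 + -Q / f * r2)) =
      f ^ 2 * (th4 c.ζ (2 * c.ω) / th1 c.ζ (2 * c.ω)) ^ 2 * r1 ^ 2 - Q ^ 2 * r2 ^ 2 := by
    field_simp; ring
  rw [k5, h1, h2]
  linear_combination -(b ^ 2 - F * a ^ 2) * (b ^ 2 - F' * a ^ 2) * Q ^ 2 * hE

theorem qdet_eq {ρ₁ ρ₂ : ℂ → ℂ} (hρ : c.IsRoots ρ₁ ρ₂) {x : ℂ} (hx : th4 (2 * x) (2 * c.ω) ≠ 0) :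
    c.θ (x + (c.α + 1) * c.η) * c.θ (-x + (c.α + 1) * c.η) * c.qdet x (sites N) =
      c.As ρ₁ ρ₂ (c.η / 2 + x) * c.As ρ₁ ρ₂ (c.η / 2 - x) := by
  have r1 : c.r (c.η / 2 + x) = th4 (2 * x) (2 * c.ω) * c.θ (x + (c.α + 1) * c.η) := by
    rw [r]; congr 2 <;> ring
  have r2 : c.r (c.η / 2 - x) = th4 (2 * x) (2 * c.ω) * c.θ (-x + (c.α + 1) * c.η) := by
    rw [r, ← th4_neg]; congr 2 <;> ring
  have ha : (∏ n, c.θ (c.η + (x - c.ξ n)) * c.θ (c.η - (x - c.ξ n)) *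
      (c.θ (c.η + (x + c.ξ n)) * c.θ (c.η - (x + c.ξ n)))) =
      c.a (c.η / 2 + x) * c.a (-(c.η / 2 + x) - c.η) *
        (c.a (c.η / 2 - x) * c.a (-(c.η / 2 - x) - c.η)) := by
    simp only [a, ← Finset.prod_mul_distrib]
    refine Finset.prod_congr rfl fun n _ => ?_
    rw [show c.η / 2 + x - c.ξ n + c.η / 2 = c.η + (x - c.ξ n) by ring,
      show -(c.η / 2 + x) - c.η - c.ξ n + c.η / 2 = -(c.η + (x + c.ξ n)) by ring,
      show c.η / 2 - x - c.ξ n + c.η / 2 = c.η - (x + c.ξ n) by ring,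
      show -(c.η / 2 - x) - c.η - c.ξ n + c.η / 2 = -(c.η - (x - c.ξ n)) by ring, θ_neg, θ_neg]
    ring
  rw [qdet, prod_sites, ha, c.det_Kreg hρ hx, As, As, r1, r2]
  ring

/-! ### The covectors of the basis as products -/

/-- The sites raised in `h`. -/
def up (h : Fin N → Fin 2) : List (Fin N) := ((List.finRange N).filter fun n => h n = 1).reverse

theorem mem_up {h : Fin N → Fin 2} {n : Fin N} : n ∈ up h ↔ h n = 1 := by simp [up]

theorem nodup_up (h : Fin N → Fin 2) : (up h).Nodup :=
  List.nodup_reverse.2 ((List.nodup_finRange N).filter _)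

theorem A_eq_Ag (x b : ℂ) : c.A x (b + 2) = c.Ag b (x - c.η / 2) := c.A_eq_gauged x b

/-- A new operator multiplies on the right, while `S` keeps the site applied last at the head; hence
the reversal. -/
theorem S_nil_mul_prod (b : ℂ) (z : Fin N → ℂ) (h : Fin N → Fin 2) (l : List (Fin N)) :
    c.S b [] * (l.map fun n => ((z n)⁻¹ • c.Ag b (-c.ξ n)) ^ (h n : ℕ)).prod =
      (l.map fun n => (z n)⁻¹ ^ (h n : ℕ)).prod • c.S b (l.filter fun n => h n = 1).reverse := by
  induction l using List.reverseRecOn with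
  | nil => simp
  | append_singleton l n ih =>
    rw [List.map_append, List.prod_append, ← mul_assoc, ih, List.map_append, List.prod_append,
      List.filter_append, List.reverse_append]
    rcases Fin.eq_zero_or_eq_succ (h n) with h0 | ⟨j, hj⟩
    · simp [h0]
    · have h1 : h n = 1 := by rw [hj, Subsingleton.elim j 0]; rfl
      simp [h1, S, smul_smul, mul_comm]

/-- The normalisation of the covectors of the basis. -/
def stateNorm (ρ₁ ρ₂ nf : ℂ → ℂ) (b : ℂ) (h : Fin N → Fin 2) : ℂ :=
  (nf (b + 2))⁻¹ * c.refNorm * ∏ n, (c.As ρ₁ ρ₂ (c.η / 2 - c.ξ n))⁻¹ ^ (h n : ℕ)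

theorem rowOp_state (ρ₁ ρ₂ nf : ℂ → ℂ) {b : ℂ} (hb : c.Good b) (h : Fin N → Fin 2) :
    rowOp (c.state ρ₁ ρ₂ nf b h) = c.stateNorm ρ₁ ρ₂ nf b h • c.S b (up h) := by
  have h1 : ∀ n, c.A (c.η / 2 - c.ξ n) (b + 2) = c.Ag b (-c.ξ n) := fun n => by
    rw [A_eq_Ag]; congr 1; ring
  have h2 := c.S_nil_mul_prod b (fun n => c.As ρ₁ ρ₂ (c.η / 2 - c.ξ n)) h (List.finRange N)
  rw [state, rowOp_smul, ← rowOp_mul, c.ref_eq hb, rowOp_smul, smul_mul_assoc]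
  simp only [h1, List.ofFn_eq_map]
  rw [show rowOp (cov (c.refW (c.gl b))) = c.S b [] from rfl, h2, smul_smul, smul_smul, up,
    ← List.ofFn_eq_map, List.prod_ofFn, stateNorm, mul_assoc]

theorem ah_mul_ah_neg (h : Fin N → Fin 2) (x : ℂ) :
    (-1) ^ N * (c.ah h x * c.ah h (-x)) = c.eps (up h) (x - c.η / 2) := by
  have hN : ((-1 : ℂ)) ^ N = ∏ _n : Fin N, (-1 : ℂ) := by simp
  rw [hN, ah, ah, eps, ← Finset.prod_mul_distrib, ← Finset.prod_mul_distrib]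
  refine Finset.prod_congr rfl fun n _ => ?_
  rw [siteFactor]
  simp only [mem_up]
  rcases Fin.eq_zero_or_eq_succ (h n) with h0 | ⟨j, hj⟩
  · rw [h0, if_neg (by simp), show x - c.ξ n - (((0 : Fin 2) : ℕ) - 1 / 2) * c.η =
        x - c.η / 2 - c.ξ n + c.η by simp; ring,
      show -x - c.ξ n - (((0 : Fin 2) : ℕ) - 1 / 2) * c.η = -(x - c.η / 2 + c.ξ n) by simp; ring,
      θ_neg]
    ring
  · have h1 : h n = 1 := by rw [hj, Subsingleton.elim j 0]; rfl
    rw [h1, if_pos rfl, show x - c.ξ n - (((1 : Fin 2) : ℕ) - 1 / 2) * c.η =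
        x - c.η / 2 - c.ξ n by simp; ring,
      show -x - c.ξ n - (((1 : Fin 2) : ℕ) - 1 / 2) * c.η = -(x - c.η / 2 + c.ξ n + c.η) by
        simp; ring, θ_neg]
    ring

theorem state_vecMul_B (hω : 0 < c.ω.im) (ρ₁ ρ₂ nf : ℂ → ℂ) {b : ℂ} (hb : c.Good b)
    (hnf : nf b ≠ 0) (h : Fin N → Fin 2) (x : ℂ) :
    c.state ρ₁ ρ₂ nf b h ᵥ* c.B x b = c.eigB nf b h x • c.state ρ₁ ρ₂ nf (b - 2) h := by
  refine rowOp_injective ?_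
  rw [← rowOp_mul, rowOp_smul, c.rowOp_state _ _ _ hb, c.rowOp_state _ _ _ hb.sub_two, B_eq_gauged,
    smul_mul_assoc, mul_smul_comm, c.S_mul_gauged hω (nodup_up h) hb, smul_smul, smul_smul, smul_smul]
  congr 1
  have h1 : c.θ ((b + N) * c.η) ≠ 0 := by simpa using hb N
  rw [← c.ah_mul_ah_neg, eigB, rK12_eq_refFactor, stateNorm, stateNorm, sub_add_cancel, bdry,
    add_comm (N : ℂ) b]
  generalize ∏ n, (c.As ρ₁ ρ₂ (c.η / 2 - c.ξ n))⁻¹ ^ (h n : ℕ) = P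
  generalize c.θ ((b + N) * c.η) = t at *
  generalize c.refFactor _ _ _ = f
  generalize c.θ (b * c.η) = t'
  field_simp

/-! ### Linear independence -/

theorem S_nil_ne_zero (hω : 0 < c.ω.im) (b : ℂ) : c.S b [] ≠ 0 := by
  intro h
  have h1 : ∀ n : Fin N, ∃ i, c.refW (c.gl b) n i ≠ 0 := fun n => Function.ne_iff.1 (c.wv_ne_zero hω _)
  choose k hk using h1
  have := congrFun (congrFun h 0) k
  change ∏ n, c.refW (c.gl b) n (k n) = 0 at this
  exact Finset.prod_ne_zero_iff.2 (fun n _ => hk n) this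

/-- Lowering by `S_cons_mul_Ag` with a nonzero quantum determinant leads back to the product
covector, which is nonzero. -/
theorem S_ne_zero (hω : 0 < c.ω.im) {b : ℂ} (hb : c.Good b)
    (hq : ∀ n, c.θ (c.ξ n + (c.α + 1) * c.η) * c.θ (-c.ξ n + (c.α + 1) * c.η) *
        c.qdet (-c.ξ n) (sites N) ≠ 0) : ∀ {l : List (Fin N)}, l.Nodup → c.S b l ≠ 0
  | [], _ => c.S_nil_ne_zero hω b
  | n :: l, hl => fun h => by
    have := c.S_cons_mul_Ag hω hb hl
    rw [h, zero_mul, eq_comm, smul_eq_zero] at this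
    exact this.elim (hq n) (S_ne_zero hω hb hq (List.nodup_cons.1 hl).2)

/-- Applying ℬ(y) to a relation weights each term by its eigenvalue and passes from b to b - 2. The
boundary factor is common to all terms and is cancelled as an entire function, so y is unrestricted.
-/
theorem sum_eps_smul_S (hω : 0 < c.ω.im) {b : ℂ} (hb : c.Good b) (hk : ∃ x, c.bdry b x ≠ 0)
    {d : (Fin N → Fin 2) → ℂ} (hd : ∑ h, d h • c.S b (up h) = 0) (y : ℂ) :
    ∑ h, (d h * c.eps (up h) y) • c.S (b - 2) (up h) = 0 := by
  ext h₀ k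
  refine entire_cancel (f := c.bdry b)
    (g := fun y => (∑ h, (d h * c.eps (up h) y) • c.S (b - 2) (up h)) h₀ k) (h := fun _ => 0)
    (c.differentiable_refFactor_nil hω _) ?_ (differentiable_const _) hk (fun y => ?_) y
  · simp only [Matrix.sum_apply, Matrix.smul_apply, smul_eq_mul]
    exact Differentiable.fun_sum fun h _ =>
      ((c.differentiable_eps hω (up h)).const_mul _).mul_const _
  · have := congrArg (fun X => X * c.gauged (sites N) (c.gl b) (c.gl b) y) hd
    simp only [zero_mul, Finset.sum_mul, smul_mul_assoc] at this
    simp only [c.S_mul_gauged hω (nodup_up _) hb, smul_smul] at this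
    have := congrFun (congrFun this h₀) k
    simp only [Matrix.sum_apply, Matrix.smul_apply, smul_eq_mul, Matrix.zero_apply] at this ⊢
    rw [mul_zero, ← this, Finset.mul_sum]
    exact Finset.sum_congr rfl fun h _ => by ring

theorem Good.sub_nat {c : Chain N} {b : ℂ} (h : c.Good b) (j : ℕ) : c.Good (b - 2 * j) := fun k => by
  have := h (k - 2 * j)
  push_cast at this
  rwa [show b - 2 * j + k = b + (k - 2 * j) by ring]

theorem sum_prod_eps_smul_S (hω : 0 < c.ω.im) {b : ℂ} (hb : c.Good b)
    {d : (Fin N → Fin 2) → ℂ} (hd : ∑ h, d h • c.S b (up h) = 0) : ∀ ys : List ℂ,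
    (∀ j < ys.length, ∃ x, c.bdry (b - 2 * j) x ≠ 0) →
    ∑ h, (d h * (ys.map (c.eps (up h))).prod) • c.S (b - 2 * ys.length) (up h) = 0
  | [], _ => by simpa using hd
  | y :: ys, hk => by
    have IH := sum_prod_eps_smul_S hω hb hd ys fun j hj => hk j (by simp; omega)
    have := c.sum_eps_smul_S hω (hb.sub_nat _) (hk ys.length (by simp)) IH y
    rw [show b - 2 * ys.length - 2 = b - 2 * ((y :: ys).length : ℕ) by
      rw [List.length_cons]; push_cast; ring] at this
    rw [← this]
    refine Finset.sum_congr rfl fun h _ => ?_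
    rw [List.map_cons, List.prod_cons]
    congr 1; ring

/-- A point at which `ℬ` annihilates exactly the covectors that differ from `h` at the site `n`. -/
def probe (h : Fin N → Fin 2) (n : Fin N) : ℂ := if h n = 1 then -c.ξ n else -c.ξ n - c.η

theorem eps_probe_eq_zero {h h' : Fin N → Fin 2} {n : Fin N} (hn : h' n ≠ h n) :
    c.eps (up h') (c.probe h n) = 0 := by
  rw [probe]
  split_ifs with h1
  · exact c.eps_eq_zero (c.siteFactor_neg (by rw [mem_up]; rwa [h1] at hn))
  · have : h' n = 1 := by omega
    exact c.eps_eq_zero (c.siteFactor_neg_sub (mem_up.2 this))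

/-- The condition on θ(η) is asked only in the presence of a site, since it is read off from 𝖠_- at
a site. -/
theorem eps_probe_ne_zero (hc : c.Generic) (hη : Fin N → c.θ c.η ≠ 0) (h : Fin N → Fin 2)
    (n : Fin N) : c.eps (up h) (c.probe h n) ≠ 0 := by
  refine Finset.prod_ne_zero_iff.2 fun m _ => ?_
  have neg : ∀ {z w : ℂ}, w = -z → c.θ z ≠ 0 → c.θ w ≠ 0 := fun e hz => by
    rw [e, θ_neg]; exact neg_ne_zero.2 hz
  have hd : m ≠ n → c.θ (c.ξ m - c.ξ n) ≠ 0 := fun h => hc.sub h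
  rw [siteFactor, probe]
  simp only [mem_up]
  split_ifs with h1 h2 h2
  · refine mul_ne_zero (neg (by ring) (hc.add m n)) ?_
    by_cases hmn : m = n
    · subst hmn; simpa using hη m
    · rw [show -c.ξ n + c.ξ m + c.η = c.ξ m - c.ξ n + c.η by ring]
      exact hc.sub_add hmn
  · have hmn : m ≠ n := fun e => h2 (e ▸ h1)
    refine mul_ne_zero (neg (by ring) (hc.add_add m n)) ?_
    rw [show -c.ξ n - c.η + c.ξ m + c.η = c.ξ m - c.ξ n by ring]
    exact hd hmn
  · have hmn : m ≠ n := fun e => h1 (e ▸ h2)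
    refine mul_ne_zero (neg (by ring) (hc.add_sub m n)) ?_
    rw [show -c.ξ n + c.ξ m = c.ξ m - c.ξ n by ring]
    exact hd hmn
  · refine mul_ne_zero (neg (by ring) (hc.add m n)) ?_
    by_cases hmn : m = n
    · subst hmn
      exact neg (by ring) (hη m)
    · exact neg (by ring) (hc.sub_add (Ne.symm hmn))

/-- One application of ℬ per site, at the probe of h for that site, kills every covector other than
that of h and multiplies the latter by a nonzero number. -/
theorem S_linearIndependent (hω : 0 < c.ω.im) (hc : c.Generic) (hη : Fin N → c.θ c.η ≠ 0) {b : ℂ}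
    (hb : c.Good b) (hk : ∀ j < N, ∃ x, c.bdry (b - 2 * j) x ≠ 0)
    (hq : ∀ n, c.θ (c.ξ n + (c.α + 1) * c.η) * c.θ (-c.ξ n + (c.α + 1) * c.η) *
        c.qdet (-c.ξ n) (sites N) ≠ 0) : LinearIndependent ℂ fun h => c.S b (up h) := by
  rw [Fintype.linearIndependent_iff]
  intro d hd h
  have key := c.sum_prod_eps_smul_S hω hb hd ((List.finRange N).map (c.probe h)) (by simpa using hk)
  rw [Finset.sum_eq_single h] at key
  · rw [smul_eq_zero] at key
    rcases key with key | key
    · rw [mul_eq_zero] at key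
      refine key.resolve_right fun h0 => ?_
      rw [List.prod_eq_zero_iff] at h0
      simp only [List.map_map, List.mem_map, Function.comp] at h0
      obtain ⟨n, -, hn⟩ := h0
      exact c.eps_probe_ne_zero hc hη h n hn
    · exact absurd key (c.S_ne_zero hω (hb.sub_nat _) hq (nodup_up h))
  · intro h' _ hh
    obtain ⟨n, hn⟩ := Function.ne_iff.1 hh
    rw [List.prod_eq_zero, mul_zero, zero_smul]
    rw [← c.eps_probe_eq_zero hn]
    exact List.mem_map_of_mem (List.mem_map_of_mem (List.mem_finRange n))
  · exact fun hh => absurd (Finset.mem_univ _) hh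

theorem state_linearIndependent (hω : 0 < c.ω.im) (hc : c.Generic) (hη : Fin N → c.θ c.η ≠ 0)
    (ρ₁ ρ₂ nf : ℂ → ℂ) {b : ℂ} (hb : c.Good b) (hk : ∀ j < N, ∃ x, c.bdry (b - 2 * j) x ≠ 0)
    (hq : ∀ n, c.θ (c.ξ n + (c.α + 1) * c.η) * c.θ (-c.ξ n + (c.α + 1) * c.η) *
        c.qdet (-c.ξ n) (sites N) ≠ 0) (hn : ∀ h, c.stateNorm ρ₁ ρ₂ nf b h ≠ 0) :
    LinearIndependent ℂ (c.state ρ₁ ρ₂ nf b) := by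
  have h1 := c.S_linearIndependent hω hc hη hb hk hq
  rw [Fintype.linearIndependent_iff] at h1 ⊢
  intro d hd h
  have h2 := h1 (fun h => d h * c.stateNorm ρ₁ ρ₂ nf b h) (by
    have h3 : ∀ h, (d h * c.stateNorm ρ₁ ρ₂ nf b h) • c.S b (up h) =
        d h • rowOp (c.state ρ₁ ρ₂ nf b h) := fun h => by
      rw [c.rowOp_state _ _ _ hb, smul_smul]
    simp only [h3]
    ext i j
    have := congrFun hd j
    simpa [Matrix.sum_apply, rowOp] using this) h
  exact (mul_eq_zero.1 h2).resolve_right (hn h)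

/-! ### The action of `𝒜` at the separated points -/

theorem up_update_zero {h : Fin N → Fin 2} {n : Fin N} (hn : h n = 1) :
    (up h).Perm (n :: up (Function.update h n 0)) := by
  refine (List.perm_ext_iff_of_nodup (nodup_up h) (List.nodup_cons.2 ⟨?_, nodup_up _⟩)).2 fun m => ?_
  · simp [mem_up]
  · by_cases hm : m = n
    · subst hm; simp [mem_up, hn]
    · simp [mem_up, hm]

theorem up_update_one {h : Fin N → Fin 2} {n : Fin N} (hn : h n = 0) :
    (n :: up h).Perm (up (Function.update h n 1)) := by
  refine (List.perm_ext_iff_of_nodup (List.nodup_cons.2 ⟨?_, nodup_up _⟩) (nodup_up _)).2 fun m => ?_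
  · simp [mem_up, hn]
  · by_cases hm : m = n
    · subst hm; simp [mem_up]
    · simp [mem_up, hm]

theorem stateNorm_update (ρ₁ ρ₂ nf : ℂ → ℂ) (b : ℂ) (h : Fin N → Fin 2) (n : Fin N) :
    c.stateNorm ρ₁ ρ₂ nf b (Function.update h n 1) = (c.As ρ₁ ρ₂ (c.η / 2 - c.ξ n))⁻¹ *
      c.stateNorm ρ₁ ρ₂ nf b (Function.update h n 0) := by
  have h1 : ∀ i : Fin 2, ∏ m, (c.As ρ₁ ρ₂ (c.η / 2 - c.ξ m))⁻¹ ^ ((Function.update h n i) m : ℕ) =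
      (c.As ρ₁ ρ₂ (c.η / 2 - c.ξ n))⁻¹ ^ (i : ℕ) *
        ∏ m ∈ Finset.univ.erase n, (c.As ρ₁ ρ₂ (c.η / 2 - c.ξ m))⁻¹ ^ (h m : ℕ) := fun i => by
    rw [← Finset.mul_prod_erase _ _ (Finset.mem_univ n), Function.update_self]
    congr 1
    refine Finset.prod_congr rfl fun m hm => ?_
    rw [Function.update_of_ne (Finset.ne_of_mem_erase hm)]
  rw [stateNorm, stateNorm, h1, h1]
  simp
  ring

/-- In the variable x the four cases are -ξ_n (raising), ξ_n - η (lowering an unraised site, zero),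
-ξ_n - η (raising a raised site, zero) and ξ_n (lowering). In the last one the determinant divided
by 𝖠_-(η/2-ξ_n) leaves 𝖠_-(η/2+ξ_n). -/
theorem state_vecMul_A (hω : 0 < c.ω.im) (hc : c.Generic) {ρ₁ ρ₂ : ℂ → ℂ} (hρ : c.IsRoots ρ₁ ρ₂)
    (nf : ℂ → ℂ) {b : ℂ} (hb : c.Good b) (h4 : ∀ n, th4 (2 * c.ξ n) (2 * c.ω) ≠ 0)
    (hA : ∀ n, c.As ρ₁ ρ₂ (c.η / 2 - c.ξ n) ≠ 0) (h : Fin N → Fin 2) (n : Fin N) (s : Bool) :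
    c.state ρ₁ ρ₂ nf b h ᵥ* c.A (c.zeta h n s) (b + 2) =
      c.As ρ₁ ρ₂ (c.zeta h n s) • shifted (c.state ρ₁ ρ₂ nf b) h n s := by
  refine rowOp_injective ?_
  rw [← rowOp_mul, rowOp_smul, c.rowOp_state _ _ _ hb, A_eq_Ag, smul_mul_assoc, shifted]
  have hcases : h n = 0 ∨ h n = 1 := by omega
  rcases hcases with h0 | h1
  · have hm : n ∉ up h := by rw [mem_up, h0]; simp
    cases s
    · rw [show c.zeta h n false = c.η / 2 - c.ξ n by simp [zeta, h0]; ring,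
        show c.η / 2 - c.ξ n - c.η / 2 = -c.ξ n by ring, if_neg (by simp), if_pos h0,
        c.rowOp_state _ _ _ hb, stateNorm_update,
        show c.S b (up h) * c.Ag b (-c.ξ n) = c.S b (n :: up h) from rfl,
        c.S_perm hω hc hb (up_update_one h0) (List.nodup_cons.2 ⟨hm, nodup_up h⟩), smul_smul,
        mul_inv_cancel_left₀ (hA n), ← h0, Function.update_eq_self]
    · rw [show c.zeta h n true - c.η / 2 = c.ξ n - c.η by simp [zeta, h0]; ring,
        c.S_mul_Ag_lower hω hc hb (nodup_up h) hm, if_pos rfl, if_neg (by simp [h0]), smul_zero,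
        rowOp_zero, smul_zero]
  · have hp := up_update_zero h1
    have hnd := hp.nodup_iff.1 (nodup_up h)
    rw [c.S_perm hω hc hb hp (nodup_up h)]
    cases s
    · rw [show c.zeta h n false - c.η / 2 = -c.ξ n - c.η by simp [zeta, h1]; ring,
        c.S_mul_Ag_upper hω hc hb hnd, if_neg (by simp), if_neg (by simp [h1]), smul_zero,
        rowOp_zero, smul_zero]
    · rw [show c.zeta h n true = c.η / 2 + c.ξ n by simp [zeta, h1]; ring,
        show c.η / 2 + c.ξ n - c.η / 2 = c.ξ n by ring, if_pos rfl, if_pos h1,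
        c.S_cons_mul_Ag hω hb hnd, c.rowOp_state _ _ _ hb, smul_smul, smul_smul]
      congr 1
      have hq := c.qdet_eq hρ (x := -c.ξ n) (by rw [mul_neg, th4_neg]; exact h4 n)
      rw [neg_neg, mul_comm (c.θ (-c.ξ n + _)), sub_neg_eq_add, ← sub_eq_add_neg] at hq
      have hs := c.stateNorm_update ρ₁ ρ₂ nf b h n
      rw [← h1, Function.update_eq_self] at hs
      rw [hs, hq]
      rw [mul_right_comm, mul_assoc, mul_assoc, mul_left_comm, mul_inv_cancel_left₀ (hA n)]

end Chain

end EightVertex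

end

/-! ### Quasi-periodicity of the gauge transformed operators in the spectral parameter. -/

noncomputable section

namespace EightVertex

theorem halfMult_mul_halfMult (x τ a b : ℂ) :
    halfMult (x + a) τ * halfMult (x + b) τ =
      halfMult x τ ^ 2 * Complex.exp (-Complex.I * (a + b)) := by
  simp only [halfMult, ← Complex.exp_nat_mul, ← Complex.exp_add]
  congr 1; push_cast; ring

theorem perMult_two_mul (x τ : ℂ) : perMult (2 * x) τ = halfMult x τ ^ 4 := by
  simp only [perMult, halfMult, ← Complex.exp_nat_mul]
  congr 1; push_cast; ring

theorem th1_sub_pi (x τ : ℂ) : th1 (x - Real.pi) τ = -th1 x τ := by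
  have := th1_add_pi (x - Real.pi) τ
  rw [sub_add_cancel] at this
  rw [this, neg_neg]

theorem th4_sub_pi (x τ : ℂ) : th4 (x - Real.pi) τ = th4 x τ := by
  rw [← th4_add_pi, sub_add_cancel]

theorem th4_two_mul_add_half_period (x τ : ℂ) :
    th4 (2 * (x + Real.pi * τ / 2)) τ = -halfMult x τ ^ 4 * th4 (2 * x) τ := by
  rw [show 2 * (x + Real.pi * τ / 2) = 2 * x + Real.pi * τ by ring, th4_add_period, perMult_two_mul]

theorem th1_two_mul_add_half_period (x τ : ℂ) :
    th1 (2 * (x + Real.pi * τ / 2)) τ = -halfMult x τ ^ 4 * th1 (2 * x) τ := by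
  rw [show 2 * (x + Real.pi * τ / 2) = 2 * x + Real.pi * τ by ring, th1_add_period, perMult_two_mul]

namespace Chain

variable {N : ℕ} (c : Chain N)

/-! ### The period `π` -/

/-- The diagonal of `σᶻ`. -/
def sgn (i : Fin 2) : ℂ := ![1, -1] i

theorem sgn_mul_self (i : Fin 2) : sgn i * sgn i = 1 := by fin_cases i <;> simp [sgn]

/-- A shift by π conjugates the auxiliary space by σᶻ, up to sign. The conjugations telescope along
the chain and are absorbed by the gauge vectors. The shift by πω does the same with σˣ. -/
theorem R_add_pi (x : ℂ) (i j : Fin 2) :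
    c.R (x + Real.pi) i j = -(sgn i * sgn j) • c.R x i j := by
  have e : x + Real.pi + c.η = x + c.η + Real.pi := by ring
  fin_cases i <;> fin_cases j <;> ext k m <;> fin_cases k <;> fin_cases m <;>
    simp [R, sgn, Ra, Rb, Rc, Rd, e, th1_add_pi, th4_add_pi] <;> ring

theorem lax_add_pi (n : Fin N) (x : ℂ) (i j : Fin 2) :
    c.lax n (x + Real.pi) i j = -(sgn i * sgn j) • c.lax n x i j := by
  rw [lax, Matrix.map_apply, R_add_pi, ← siteAlg_apply, map_smul]; rfl

theorem Kreg_add_pi (x : ℂ) (i j : Fin 2) :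
    c.Kreg (x + Real.pi) i j = -(sgn i * sgn j) * c.Kreg x i j := by
  have e1 : 2 * (x + Real.pi) = 2 * x + Real.pi + Real.pi := by ring
  have e2 : c.ζ - (x + Real.pi) = c.ζ - x - Real.pi := by ring
  have e3 : x + Real.pi + c.ζ = x + c.ζ + Real.pi := by ring
  fin_cases i <;> fin_cases j <;>
    simp [Kreg, sgn, e1, e2, e3, th1_add_pi, th4_add_pi, th1_sub_pi, th4_sub_pi] <;> ring

theorem Ur_add_pi (x : ℂ) : ∀ (l : List (Fin N)) (i j : Fin 2),
    c.Ur (x + Real.pi) l i j = -(sgn i * sgn j) • c.Ur x l i j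
  | [], i, j => by simp only [Ur, aux, Matrix.map_apply, Kreg_add_pi, mul_smul]
  | n :: l, i, j => by
    have e1 : x + Real.pi - c.ξ n = x - c.ξ n + Real.pi := by ring
    have e2 : x + Real.pi + c.ξ n = x + c.ξ n + Real.pi := by ring
    simp only [Ur, Matrix.mul_apply, e1, e2, lax_add_pi, Ur_add_pi x l, smul_mul_assoc,
      mul_smul_comm, smul_smul, Finset.smul_sum, Finset.sum_mul]
    refine Finset.sum_congr rfl fun k _ => Finset.sum_congr rfl fun m _ => ?_
    congr 1
    linear_combination -(sgn i * sgn j * (sgn m * sgn m)) * sgn_mul_self k -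
      sgn i * sgn j * sgn_mul_self m

theorem gauged_add_pi (l : List (Fin N)) (s t x : ℂ) :
    c.gauged l s t (x + Real.pi) = c.gauged l s t x := by
  have hw : ∀ i, c.wv (x + Real.pi + s) i = sgn i * c.wv (x + s) i := fun i => by
    rw [show x + Real.pi + s = x + s + Real.pi by ring]
    fin_cases i <;> simp [wv, sgn, th2_add_pi, th3_add_pi]
  have hv : ∀ j, c.vv (-(x + Real.pi) + t) j = -sgn j * c.vv (-x + t) j := fun j => by
    rw [show -(x + Real.pi) + t = -(x - t + Real.pi) by ring, show -x + t = -(x - t) by ring,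
      vv_neg, vv_neg]
    fin_cases j <;> simp [vv, sgn, th2_add_pi, th3_add_pi]
  simp only [gauged, sandwich, hw, hv, Ur_add_pi, smul_smul]
  refine Finset.sum_congr rfl fun i _ => Finset.sum_congr rfl fun j _ => ?_
  congr 1
  linear_combination c.wv (x + s) i * c.vv (-x + t) j *
    ((sgn j * sgn j) * sgn_mul_self i + sgn_mul_self j)

/-! ### The half period `πω` -/

theorem R_add_half_period (x : ℂ) (i j : Fin 2) : c.R (x + Real.pi * (2 * c.ω) / 2) i j =
    -(halfMult x (2 * c.ω) * halfMult (x + c.η) (2 * c.ω)) • c.R x (i + 1) (j + 1) := by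
  have e : x + Real.pi * (2 * c.ω) / 2 + c.η = x + c.η + Real.pi * (2 * c.ω) / 2 := by ring
  have ha : c.Ra (x + Real.pi * (2 * c.ω) / 2) =
      -(halfMult x (2 * c.ω) * halfMult (x + c.η) (2 * c.ω)) * c.Rb x := by
    simp only [Ra, Rb, e, th1_add_half_period, th4_add_half_period]; ring_nf; rw [Complex.I_sq]; ring
  have hb : c.Rb (x + Real.pi * (2 * c.ω) / 2) =
      -(halfMult x (2 * c.ω) * halfMult (x + c.η) (2 * c.ω)) * c.Ra x := by
    simp only [Ra, Rb, e, th1_add_half_period, th4_add_half_period]; ring_nf; rw [Complex.I_sq]; ring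
  have hc : c.Rc (x + Real.pi * (2 * c.ω) / 2) =
      -(halfMult x (2 * c.ω) * halfMult (x + c.η) (2 * c.ω)) * c.Rd x := by
    simp only [Rc, Rd, e, th4_add_half_period]; ring_nf; rw [Complex.I_sq]; ring
  have hd : c.Rd (x + Real.pi * (2 * c.ω) / 2) =
      -(halfMult x (2 * c.ω) * halfMult (x + c.η) (2 * c.ω)) * c.Rc x := by
    simp only [Rc, Rd, e, th1_add_half_period]; ring_nf; rw [Complex.I_sq]; ring
  fin_cases i <;> fin_cases j <;> ext k m <;> fin_cases k <;> fin_cases m <;>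
    simp [R, ha, hb, hc, hd]

theorem lax_add_half_period (n : Fin N) (x : ℂ) (i j : Fin 2) :
    c.lax n (x + Real.pi * (2 * c.ω) / 2) i j =
      -(halfMult x (2 * c.ω) * halfMult (x + c.η) (2 * c.ω)) • c.lax n x (i + 1) (j + 1) := by
  rw [lax, Matrix.map_apply, R_add_half_period, ← siteAlg_apply, map_smul]; rfl

theorem Kreg_add_half_period (x : ℂ) (i j : Fin 2) : c.Kreg (x + Real.pi * (2 * c.ω) / 2) i j =
    -halfMult x (2 * c.ω) ^ 6 * c.Kreg x (i + 1) (j + 1) := by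
  have e2 : c.ζ - (x + Real.pi * (2 * c.ω) / 2) = -(x - c.ζ + Real.pi * (2 * c.ω) / 2) := by ring
  have e3 : x + Real.pi * (2 * c.ω) / 2 + c.ζ = x + c.ζ + Real.pi * (2 * c.ω) / 2 := by ring
  have hp : halfMult (x - c.ζ) (2 * c.ω) * halfMult (x + c.ζ) (2 * c.ω) =
      halfMult x (2 * c.ω) ^ 2 := by
    rw [sub_eq_add_neg, halfMult_mul_halfMult]; simp
  have hE : Complex.exp c.τ * Complex.exp (-2 * c.τ) = Complex.exp (-c.τ) := by
    rw [← Complex.exp_add]; congr 1; ring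
  have hE' : Complex.exp (-c.τ) * Complex.exp (2 * c.τ) = Complex.exp c.τ := by
    rw [← Complex.exp_add]; congr 1; ring
  have hI := Complex.I_mul_I
  simp only [Kreg, th1_two_mul_add_half_period, th4_two_mul_add_half_period, e2, e3, th1_neg, th4_neg,
    th1_add_half_period, th4_add_half_period, show c.ζ - x = -(x - c.ζ) by ring]
  generalize halfMult x (2 * c.ω) = w at *
  generalize Complex.exp c.τ = E at *
  generalize Complex.exp (-c.τ) = E' at *
  generalize Complex.exp (2 * c.τ) = F at *
  generalize Complex.exp (-2 * c.τ) = F' at *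
  generalize th1 (2 * x) (2 * c.ω) = u at *
  generalize th4 (2 * x) (2 * c.ω) = f at *
  generalize th1 x (2 * c.ω) = a at *
  generalize th4 x (2 * c.ω) = b at *
  generalize th1 c.ζ (2 * c.ω) = z1 at *
  generalize th4 c.ζ (2 * c.ω) = z4 at *
  generalize th1 (x - c.ζ) (2 * c.ω) = m1 at *
  generalize th4 (x - c.ζ) (2 * c.ω) = m4 at *
  generalize th1 (x + c.ζ) (2 * c.ω) = p1 at *
  generalize th4 (x + c.ζ) (2 * c.ω) = p4 at *
  generalize halfMult (x - c.ζ) (2 * c.ω) = wm at *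
  generalize halfMult (x + c.ζ) (2 * c.ω) = wp at *
  generalize th4 0 (2 * c.ω) = t at *
  fin_cases i <;> fin_cases j <;> simp
  · linear_combination (w ^ 4 * f * z4 * m1 * p4 / z1) * (wm * wp * hI - hp)
  · linear_combination (w ^ 6 * c.κ * u * z4 ^ 3 / (z1 * t ^ 2)) *
      (-E * (a ^ 2 - F' * b ^ 2) * hI - b ^ 2 * hE - a ^ 2 * hE')
  · linear_combination (w ^ 6 * c.κ * u * z4 ^ 3 / (z1 * t ^ 2)) *
      (-E' * (a ^ 2 - F * b ^ 2) * hI - b ^ 2 * hE' - a ^ 2 * hE)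
  · linear_combination (-w ^ 4 * f * z4 * m4 * p1 / z1) * (wm * wp * hI - hp)

theorem Ur_add_half_period (x : ℂ) : ∀ (l : List (Fin N)) (i j : Fin 2),
    c.Ur (x + Real.pi * (2 * c.ω) / 2) l i j = -(halfMult x (2 * c.ω) ^ (4 * l.length + 6) *
      Complex.exp (-Complex.I * (2 * c.η)) ^ l.length) • c.Ur x l (i + 1) (j + 1)
  | [], i, j => by simp [Ur, aux, Kreg_add_half_period, smul_smul]
  | n :: l, i, j => by
    have e1 : x + Real.pi * (2 * c.ω) / 2 - c.ξ n = x - c.ξ n + Real.pi * (2 * c.ω) / 2 := by ring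
    have e2 : x + Real.pi * (2 * c.ω) / 2 + c.ξ n = x + c.ξ n + Real.pi * (2 * c.ω) / 2 := by ring
    have hp : halfMult (x - c.ξ n) (2 * c.ω) * halfMult (x - c.ξ n + c.η) (2 * c.ω) *
        (halfMult (x + c.ξ n) (2 * c.ω) * halfMult (x + c.ξ n + c.η) (2 * c.ω)) =
        halfMult x (2 * c.ω) ^ 4 * Complex.exp (-Complex.I * (2 * c.η)) := by
      simp only [halfMult, ← Complex.exp_nat_mul, ← Complex.exp_add]
      congr 1; push_cast; ring
    simp only [Ur, Matrix.mul_apply, e1, e2, lax_add_half_period, Ur_add_half_period x l,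
      smul_mul_assoc, mul_smul_comm, smul_smul, List.length_cons, ← Finset.smul_sum]
    rw [show 4 * (l.length + 1) + 6 = 4 * l.length + 6 + 4 by ring, pow_add _ (4 * l.length + 6) 4,
      pow_succ _ l.length]
    simp only [Fin.sum_univ_two, zero_add, show (1 : Fin 2) + 1 = 0 from rfl]
    rw [add_comm (_ * c.lax n (x + c.ξ n) 1 (j + 1)), add_comm (c.lax n (x - c.ξ n) (i + 1) 1 * _),
      add_comm (c.lax n (x - c.ξ n) (i + 1) 1 * _)]
    congr 1
    linear_combination -(halfMult x (2 * c.ω) ^ (4 * l.length + 6) *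
      Complex.exp (-Complex.I * (2 * c.η)) ^ l.length) * hp

theorem vv_add_half_period (x : ℂ) (i : Fin 2) :
    c.vv (x + Real.pi * (2 * c.ω) / 2) i = halfMult x (2 * c.ω) * c.vv x (i + 1) := by
  fin_cases i <;> simp [vv, th2_add_half_period, th3_add_half_period]

theorem wv_add_half_period (x : ℂ) (i : Fin 2) :
    c.wv (x + Real.pi * (2 * c.ω) / 2) i = -halfMult x (2 * c.ω) * c.wv x (i + 1) := by
  fin_cases i <;> simp [wv, th2_add_half_period, th3_add_half_period]

/-- The components of both gauge vectors are exchanged along with the conjugation of 𝒰 by σˣ, so the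
contraction reproduces itself: πω is already a quasi-period. The elliptic polynomial property uses
this twice, the interpolation once. -/
theorem gauged_add_half_period (l : List (Fin N)) (s t x : ℂ) :
    c.gauged l s t (x + Real.pi * (2 * c.ω) / 2) = (halfMult x (2 * c.ω) ^ (4 * l.length + 8) *
      Complex.exp (-Complex.I * (2 * l.length * c.η + s - t))) • c.gauged l s t x := by
  have hp : halfMult (x + s) (2 * c.ω) * halfMult (x - t) (2 * c.ω) = halfMult x (2 * c.ω) ^ 2 *
      Complex.exp (-Complex.I * (s - t)) := by
    rw [sub_eq_add_neg x, halfMult_mul_halfMult, sub_eq_add_neg]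
  have he : Complex.exp (-Complex.I * (2 * l.length * c.η + s - t)) =
      Complex.exp (-Complex.I * (2 * c.η)) ^ l.length * Complex.exp (-Complex.I * (s - t)) := by
    rw [← Complex.exp_nat_mul, ← Complex.exp_add]; congr 1; ring
  rw [gauged, gauged,
    show x + Real.pi * (2 * c.ω) / 2 + s = x + s + Real.pi * (2 * c.ω) / 2 by ring,
    show -(x + Real.pi * (2 * c.ω) / 2) + t = -(x - t + Real.pi * (2 * c.ω) / 2) by ring,
    show -x + t = -(x - t) by ring, vv_neg, vv_neg]
  have key : ∀ i j, (-halfMult (x + s) (2 * c.ω) * c.wv (x + s) (i + 1) *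
      (halfMult (x - t) (2 * c.ω) * c.vv (x - t) (j + 1)) * -(halfMult x (2 * c.ω) ^ (4 * l.length + 6) *
      Complex.exp (-Complex.I * (2 * c.η)) ^ l.length)) = (halfMult x (2 * c.ω) ^ (4 * l.length + 8) *
      Complex.exp (-Complex.I * (2 * l.length * c.η + s - t))) * (c.wv (x + s) (i + 1) *
        c.vv (x - t) (j + 1)) := fun i j => by
    rw [he, show 4 * l.length + 8 = 4 * l.length + 6 + 2 by ring, pow_add _ (4 * l.length + 6) 2]
    linear_combination (c.wv (x + s) (i + 1) * c.vv (x - t) (j + 1) *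
      halfMult x (2 * c.ω) ^ (4 * l.length + 6) *
      Complex.exp (-Complex.I * (2 * c.η)) ^ l.length) * hp
  simp only [sandwich, vv_add_half_period, wv_add_half_period, Ur_add_half_period, smul_smul, key]
  simp only [← smul_smul, ← Finset.smul_sum]
  congr 1
  simp only [Fin.sum_univ_two, zero_add, show (1 : Fin 2) + 1 = 0 from rfl]
  module

theorem gauged_add_period (l : List (Fin N)) (s t x : ℂ) :
    c.gauged l s t (x + Real.pi * (2 * c.ω)) = (perMult x (2 * c.ω) ^ (4 * l.length + 8) *
      Complex.exp (-2 * Complex.I * (2 * l.length * c.η + s - t))) • c.gauged l s t x := by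
  rw [show x + Real.pi * (2 * c.ω) = x + Real.pi * (2 * c.ω) / 2 + Real.pi * (2 * c.ω) / 2 by ring,
    gauged_add_half_period, gauged_add_half_period, smul_smul, ← halfMult_mul, mul_pow,
    show -2 * Complex.I * (2 * l.length * c.η + s - t) = -Complex.I * (2 * l.length * c.η + s - t) +
      -Complex.I * (2 * l.length * c.η + s - t) by ring, Complex.exp_add]
  congr 1; ring

theorem neg_exp_div_eq (x : ℂ) : -Complex.exp (-2 * Complex.I * x) /
    Complex.exp (Complex.I * Real.pi * c.ω) ^ 2 = -perMult x (2 * c.ω) := by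
  rw [perMult, neg_div, ← Complex.exp_nat_mul, ← Complex.exp_sub]
  congr 2; push_cast; ring

theorem isEllipticPolynomial_gauged (hω : 0 < c.ω.im) (z s t : ℂ) {a : ℂ}
    (ha : a = 4 * c.η - s + t) : c.IsEllipticPolynomial (4 * N + 8) a
      fun x => z • c.gauged (sites N) s t (x - c.η / 2) := by
  have hm : Even (4 * N + 8) := ⟨2 * N + 4, by ring⟩
  refine ⟨fun h k => ?_, fun x => ?_, fun x => ?_⟩
  · exact ((c.differentiable_gauged hω _ s t h k).comp (differentiable_id.sub_const _)).const_mul z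
  · beta_reduce
    rw [show x + Real.pi - c.η / 2 = x - c.η / 2 + Real.pi by ring, gauged_add_pi, hm.neg_one_pow,
      one_smul]
  · beta_reduce
    rw [show x + 2 * Real.pi * c.ω - c.η / 2 = x - c.η / 2 + Real.pi * (2 * c.ω) by ring,
      gauged_add_period, smul_comm, length_sites, neg_exp_div_eq, hm.neg_pow, ha]
    congr 1
    simp only [perMult, ← Complex.exp_nat_mul, ← Complex.exp_add]
    congr 1; push_cast; ring

theorem isEllipticPolynomial_B (hω : 0 < c.ω.im) (b : ℂ) :
    c.IsEllipticPolynomial (4 * N + 8) (4 * c.η) fun x => c.B x b := by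
  simp only [B_eq_gauged]
  exact c.isEllipticPolynomial_gauged hω _ _ _ (by ring)

theorem isEllipticPolynomial_A (hω : 0 < c.ω.im) (b : ℂ) :
    c.IsEllipticPolynomial (4 * N + 8) (2 * b * c.η) fun x => c.A x b := by
  have h : ∀ x, c.A x b = c.A x (b - 2 + 2) := fun x => by rw [sub_add_cancel]
  simp only [h, A_eq_gauged]
  exact c.isEllipticPolynomial_gauged hω _ _ _ (by simp only [gl, gr]; ring)

end Chain

end EightVertex

end

noncomputable section

namespace EightVertex

/-! ### Division by products with simple zeros -/

theorem exists_entire_quotient_prod {ι : Type*} (S : Finset ι) {F : ℂ → ℂ} (hF : Differentiable ℂ F)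
    {f : ι → ℂ → ℂ} (hf : ∀ i ∈ S, Differentiable ℂ (f i))
    (hs : ∀ i ∈ S, ∀ x, f i x = 0 → deriv (f i) x ≠ 0)
    (hd : ∀ i ∈ S, ∀ j ∈ S, i ≠ j → ∀ x, f i x = 0 → f j x ≠ 0)
    (hz : ∀ i ∈ S, ∀ x, f i x = 0 → F x = 0) :
    ∃ g : ℂ → ℂ, Differentiable ℂ g ∧ ∀ x, F x = g x * ∏ i ∈ S, f i x := by
  classical
  induction S using Finset.induction_on with
  | empty => exact ⟨F, hF, by simp⟩
  | insert a S ha ih =>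
    obtain ⟨g, hg, he⟩ := ih (fun i hi => hf i (Finset.mem_insert_of_mem hi))
      (fun i hi => hs i (Finset.mem_insert_of_mem hi))
      (fun i hi j hj => hd i (Finset.mem_insert_of_mem hi) j (Finset.mem_insert_of_mem hj))
      (fun i hi => hz i (Finset.mem_insert_of_mem hi))
    obtain ⟨g', hg', he'⟩ := exists_entire_quotient hg (hf a (Finset.mem_insert_self a S))
      (hs a (Finset.mem_insert_self a S)) fun x hx => by
        have h0 := hz a (Finset.mem_insert_self a S) x hx
        rw [he] at h0
        refine (mul_eq_zero.1 h0).resolve_right (Finset.prod_ne_zero_iff.2 fun j hj => ?_)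
        exact hd a (Finset.mem_insert_self a S) j (Finset.mem_insert_of_mem hj)
          (by rintro rfl; exact ha hj) x hx
    refine ⟨g', hg', fun x => ?_⟩
    rw [he, he', Finset.prod_insert ha, mul_assoc]

theorem exists_prod_ne_zero {ι : Type*} {S : Finset ι} {f : ι → ℂ → ℂ}
    (hf : ∀ i ∈ S, Differentiable ℂ (f i)) (h0 : ∀ i ∈ S, ∃ x, f i x ≠ 0) :
    ∃ x, ∏ i ∈ S, f i x ≠ 0 := by
  classical
  induction S using Finset.induction_on with
  | empty => exact ⟨0, by simp⟩
  | insert a S ha ih =>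
    simp only [Finset.prod_insert ha]
    exact Chain.exists_mul_ne_zero (hf a (Finset.mem_insert_self a S))
      (Differentiable.fun_finsetProd fun i hi => hf i (Finset.mem_insert_of_mem hi))
      (h0 a (Finset.mem_insert_self a S)) (ih (fun i hi => hf i (Finset.mem_insert_of_mem hi))
        fun i hi => h0 i (Finset.mem_insert_of_mem hi))

theorem deriv_th1_sub_ne_zero {τ : ℂ} (hτ : 0 < τ.im) {x y : ℂ} (hz : th1 (x - y) τ = 0) :
    deriv (fun x => th1 (x - y) τ) x ≠ 0 := by
  rw [deriv_comp_sub_const (f := fun x => th1 x τ)]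
  exact deriv_th1_ne_zero hτ hz

theorem th1_sub_eq_zero {τ : ℂ} (hτ : 0 < τ.im) {x y : ℂ} (hx : th1 x τ = 0) (hy : th1 y τ = 0) :
    th1 (x - y) τ = 0 := by
  rw [sub_eq_add_neg]
  exact (th1_add_zero_eq_zero hτ (by rw [th1_neg, hy, neg_zero]) hx)

theorem differentiable_th1_sub {τ : ℂ} (hτ : 0 < τ.im) (y : ℂ) :
    Differentiable ℂ fun x => th1 (x - y) τ := th1_comp hτ (by fun_prop)

/-! ### Lagrange interpolation for theta functions -/

/-- Theta functions of order `n` and characteristic `s` for the periods `π, πτ`. -/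
structure IsThetaFun (τ : ℂ) (n : ℕ) (s : ℂ) (G : ℂ → ℂ) : Prop where
  entire : Differentiable ℂ G
  add_pi : ∀ x, G (x + Real.pi) = (-1) ^ n * G x
  add_period : ∀ x, G (x + Real.pi * τ) = (-perMult x τ) ^ n * Complex.exp (2 * Complex.I * s) * G x

namespace IsThetaFun

variable {τ : ℂ} {n m : ℕ} {s t : ℂ} {F G : ℂ → ℂ}

theorem mul (hF : IsThetaFun τ n s F) (hG : IsThetaFun τ m t G) :
    IsThetaFun τ (n + m) (s + t) fun x => F x * G x where
  entire := hF.entire.mul hG.entire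
  add_pi x := by simp only [hF.add_pi, hG.add_pi, pow_add]; ring
  add_period x := by
    simp only [hF.add_period, hG.add_period, pow_add, mul_add, Complex.exp_add]; ring

theorem sub (hF : IsThetaFun τ n s F) (hG : IsThetaFun τ n s G) :
    IsThetaFun τ n s fun x => F x - G x where
  entire := hF.entire.sub hG.entire
  add_pi x := by simp only [hF.add_pi, hG.add_pi]; ring
  add_period x := by simp only [hF.add_period, hG.add_period]; ring

theorem mul_const (hF : IsThetaFun τ n s F) (a : ℂ) : IsThetaFun τ n s fun x => F x * a where
  entire := hF.entire.mul_const a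
  add_pi x := by simp only [hF.add_pi]; ring
  add_period x := by simp only [hF.add_period]; ring

theorem const_mul (hF : IsThetaFun τ n s F) (a : ℂ) : IsThetaFun τ n s fun x => a * F x := by
  simpa only [mul_comm a] using hF.mul_const a

theorem sum {ι : Type*} {S : Finset ι} {f : ι → ℂ → ℂ} (hf : ∀ i ∈ S, IsThetaFun τ n s (f i)) :
    IsThetaFun τ n s fun x => ∑ i ∈ S, f i x where
  entire := Differentiable.fun_sum fun i hi => (hf i hi).entire
  add_pi x := by
    rw [Finset.mul_sum]; exact Finset.sum_congr rfl fun i hi => (hf i hi).add_pi x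
  add_period x := by
    rw [Finset.mul_sum]; exact Finset.sum_congr rfl fun i hi => (hf i hi).add_period x

theorem one : IsThetaFun τ 0 0 fun _ => 1 := ⟨differentiable_const _, by simp, by simp⟩

theorem prod {ι : Type*} {S : Finset ι} {d : ι → ℕ} {c : ι → ℂ} {f : ι → ℂ → ℂ}
    (hf : ∀ i ∈ S, IsThetaFun τ (d i) (c i) (f i)) :
    IsThetaFun τ (∑ i ∈ S, d i) (∑ i ∈ S, c i) fun x => ∏ i ∈ S, f i x := by
  classical
  induction S using Finset.induction_on with
  | empty => simpa using one
  | insert a S ha ih =>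
    simp only [Finset.sum_insert ha, Finset.prod_insert ha]
    exact (hf a (Finset.mem_insert_self a S)).mul
      (ih fun i hi => hf i (Finset.mem_insert_of_mem hi))

theorem th1_sub (hτ : 0 < τ.im) (y : ℂ) : IsThetaFun τ 1 y fun x => th1 (x - y) τ where
  entire := differentiable_th1_sub hτ y
  add_pi x := by rw [show x + Real.pi - y = x - y + Real.pi by ring, th1_add_pi]; ring
  add_period x := by
    rw [show x + Real.pi * τ - y = x - y + Real.pi * τ by ring, th1_add_period, pow_one, perMult,
      perMult, neg_mul (Complex.exp _) (Complex.exp _), ← Complex.exp_add]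
    congr 3; ring

/-- A theta function of order `0` that is not resonant vanishes. -/
theorem eq_zero (hτ : 0 < τ.im) (hG : IsThetaFun τ 0 s G) (hs : th1 s τ ≠ 0) (x : ℂ) : G x = 0 := by
  have hT : 0 < (Real.pi * τ).im := by
    rw [Complex.im_ofReal_mul]; exact mul_pos Real.pi_pos hτ
  refine eq_zero_of_quasi_periodic hG.entire hT (fun x => by simpa using hG.add_pi x)
    (fun x => by simpa using hG.add_period x) (fun m n h => hs ?_) x
  exact (th1_eq_zero_iff hτ).2 ⟨m, n, h⟩

/-- The quotient of theta functions is one, if it is entire. -/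
theorem quotient (hF : IsThetaFun τ (n + m) (s + t) F) (hG : IsThetaFun τ m t G) {g : ℂ → ℂ}
    (hg : Differentiable ℂ g) (hG0 : ∃ x, G x ≠ 0) (he : ∀ x, F x = g x * G x) :
    IsThetaFun τ n s g where
  entire := hg
  add_pi x := by
    refine entire_cancel (f := G) (g := fun x => g (x + Real.pi)) (h := fun x => (-1) ^ n * g x)
      hG.entire (hg.comp (differentiable_id.add_const _)) (hg.const_mul _) hG0 (fun x => ?_) x
    have h1 := hF.add_pi x
    rw [he, he, hG.add_pi, pow_add] at h1
    refine mul_left_cancel₀ (pow_ne_zero m (neg_ne_zero.2 (one_ne_zero (α := ℂ)))) ?_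
    linear_combination h1
  add_period x := by
    refine entire_cancel (f := G) (g := fun x => g (x + Real.pi * τ))
      (h := fun x => (-perMult x τ) ^ n * Complex.exp (2 * Complex.I * s) * g x)
      hG.entire (hg.comp (differentiable_id.add_const _)) ?_ hG0 (fun x => ?_) x
    · have : Differentiable ℂ fun x => perMult x τ := by unfold perMult; fun_prop
      fun_prop
    · have h1 := hF.add_period x
      rw [he, he, hG.add_period, pow_add, mul_add, Complex.exp_add] at h1
      refine mul_left_cancel₀ (mul_ne_zero (pow_ne_zero m (neg_ne_zero.2 (perMult_ne_zero x τ)))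
        (Complex.exp_ne_zero (2 * Complex.I * t))) ?_
      linear_combination h1

/-- For odd n the sign under π would not be that of order 2n. -/
theorem double (hF : IsThetaFun τ n s F) (hn : Even n) : IsThetaFun (2 * τ) (2 * n) (2 * s) F where
  entire := hF.entire
  add_pi x := by rw [hF.add_pi, hn.neg_one_pow, (even_two_mul n).neg_one_pow]
  add_period x := by
    rw [show x + Real.pi * (2 * τ) = x + Real.pi * τ + Real.pi * τ by ring, hF.add_period,
      hF.add_period, hn.neg_pow, hn.neg_pow, (even_two_mul n).neg_pow]
    simp only [perMult, ← Complex.exp_nat_mul, ← mul_assoc, ← Complex.exp_add]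
    congr 2; push_cast; ring

theorem eq_zero_add (hτ : 0 < τ.im) (hF : IsThetaFun τ n s F) {x y : ℂ} (h : F y = 0)
    (hx : th1 (x - y) τ = 0) : F x = 0 := by
  obtain ⟨j, k, e⟩ := (th1_eq_zero_iff hτ).1 hx
  have h1 : ∀ (z : ℂ), F (z + Real.pi) = 0 ↔ F z = 0 := fun z => by simp [hF.add_pi]
  have h2 : ∀ (z : ℂ), F (z + Real.pi * τ) = 0 ↔ F z = 0 := fun z => by
    simp [hF.add_period, perMult_ne_zero]
  have h3 : ∀ (j : ℤ) (z : ℂ), F (z + j * Real.pi) = 0 ↔ F z = 0 := fun j => by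
    induction j using Int.induction_on with
    | zero => simp
    | succ i ih =>
      intro z
      rw [show z + ((i + 1 : ℤ) : ℂ) * Real.pi = z + (i : ℤ) * Real.pi + Real.pi by push_cast; ring, h1, ih]
    | pred i ih =>
      intro z
      rw [← h1, show z + ((-i - 1 : ℤ) : ℂ) * Real.pi + Real.pi = z + (-i : ℤ) * Real.pi by push_cast; ring, ih]
  have h4 : ∀ (j : ℤ) (z : ℂ), F (z + j * (Real.pi * τ)) = 0 ↔ F z = 0 := fun j => by
    induction j using Int.induction_on with
    | zero => simp
    | succ i ih =>
      intro z
      rw [show z + ((i + 1 : ℤ) : ℂ) * (Real.pi * τ) = z + (i : ℤ) * (Real.pi * τ) + Real.pi * τ by push_cast; ring, h2, ih]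
    | pred i ih =>
      intro z
      rw [← h2, show z + ((-i - 1 : ℤ) : ℂ) * (Real.pi * τ) + Real.pi * τ = z + (-i : ℤ) * (Real.pi * τ) by push_cast; ring, ih]
  rw [show x = y + j * Real.pi + k * (Real.pi * τ) by linear_combination e, h4, h3]
  exact h

/-- The zeros extend to all lattice translates, where the factors θ₁(x - y_p) have simple and
pairwise different zeros; the quotient is therefore entire. -/
theorem eq_quotient_th1 (hτ : 0 < τ.im) {ι : Type*} [Fintype ι] {y : ι → ℂ}
    (hy : ∀ p q, p ≠ q → th1 (y p - y q) τ ≠ 0) (hG : IsThetaFun τ (m + Fintype.card ι) s G)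
    (h0 : ∀ p, G (y p) = 0) :
    ∃ g, IsThetaFun τ m (s - ∑ p, y p) g ∧ ∀ x, G x = g x * ∏ p, th1 (x - y p) τ := by
  have hz : ∀ p x, th1 (x - y p) τ = 0 → G x = 0 := fun p x hx => hG.eq_zero_add hτ (h0 p) hx
  obtain ⟨g, hg, he⟩ := exists_entire_quotient_prod Finset.univ hG.entire
    (f := fun p x => th1 (x - y p) τ)
    (fun p _ => differentiable_th1_sub hτ (y p)) (fun p _ x hx => deriv_th1_sub_ne_zero hτ hx)
    (fun p _ q _ hpq x hp hq => hy p q hpq (by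
      have := th1_sub_eq_zero hτ hq hp
      rwa [show x - y q - (x - y p) = y p - y q by ring] at this)) (fun p _ x hx => hz p x hx)
  have hP := prod (S := Finset.univ) fun p _ => th1_sub hτ (y p)
  simp only [Finset.sum_const, Finset.card_univ, smul_eq_mul, mul_one] at hP
  refine ⟨g, ?_, he⟩
  refine quotient (t := ∑ p, y p) (by rwa [sub_add_cancel]) hP hg ?_ he
  refine exists_prod_ne_zero (fun p _ => differentiable_th1_sub hτ (y p)) fun p _ => ?_
  obtain ⟨x, hx⟩ := exists_th1_ne_zero hτ
  exact ⟨x + y p, by rwa [add_sub_cancel_right]⟩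

/-- The interpolant is a theta function of the same type as G. Their difference vanishes at all
nodes, so it is ∏ θ₁(x - y_p) times a theta function of order 0 and characteristic s - Σ y_p, which
is zero off resonance. -/
theorem lagrange (hτ : 0 < τ.im) {ι : Type*} [Fintype ι] [DecidableEq ι] {y : ι → ℂ}
    (hy : ∀ p q, p ≠ q → th1 (y p - y q) τ ≠ 0) (hs : th1 (s - ∑ p, y p) τ ≠ 0)
    (hG : IsThetaFun τ (Fintype.card ι) s G) (x : ℂ) :
    G x = ∑ p, th1 (s - x - ∑ q ∈ Finset.univ.erase p, y q) τ / th1 (s - ∑ q, y q) τ *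
      (∏ q ∈ Finset.univ.erase p, th1 (x - y q) τ / th1 (y p - y q) τ) * G (y p) := by
  set T : ι → ℂ → ℂ := fun p x =>
    th1 (s - x - ∑ q ∈ Finset.univ.erase p, y q) τ / th1 (s - ∑ q, y q) τ *
      (∏ q ∈ Finset.univ.erase p, th1 (x - y q) τ / th1 (y p - y q) τ) * G (y p) with hT
  have hTt : ∀ p, IsThetaFun τ (Fintype.card ι) s (T p) := fun p => by
    have h1 := th1_sub hτ (s - ∑ q ∈ Finset.univ.erase p, y q)
    have h2 := prod (S := Finset.univ.erase p) fun q _ =>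
      (th1_sub hτ (y q)).mul_const (th1 (y p - y q) τ)⁻¹
    have h3 := ((h1.mul h2).mul_const (-(th1 (s - ∑ q, y q) τ)⁻¹)).mul_const (G (y p))
    simp only [Finset.sum_const, smul_eq_mul, mul_one, sub_add_cancel,
      Finset.card_erase_of_mem (Finset.mem_univ p), Finset.card_univ] at h3
    rw [Nat.add_sub_cancel' (Fintype.card_pos_iff.2 ⟨p⟩)] at h3
    convert h3 using 2 with z
    rw [hT]
    simp only
    rw [show s - z - ∑ q ∈ Finset.univ.erase p, y q =
      -(z - (s - ∑ q ∈ Finset.univ.erase p, y q)) by ring, th1_neg]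
    simp only [div_eq_mul_inv]
    ring
  have hT0 : ∀ p q, T p (y q) = if p = q then G (y p) else 0 := fun p q => by
    split_ifs with h
    · subst h
      have e : s - y p - ∑ q ∈ Finset.univ.erase p, y q = s - ∑ q, y q := by
        rw [← Finset.add_sum_erase _ _ (Finset.mem_univ p)]; ring
      simp only [hT]
      rw [e, div_self hs, Finset.prod_eq_one, one_mul, one_mul]
      exact fun q hq => div_self (hy _ _ (Finset.ne_of_mem_erase hq).symm)
    · simp only [hT]
      rw [Finset.prod_eq_zero (Finset.mem_erase.2 ⟨Ne.symm h, Finset.mem_univ q⟩) (by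
        rw [sub_self, th1_zero, zero_div]), mul_zero, zero_mul]
  have hD := hG.sub (sum (S := Finset.univ) fun p _ => hTt p)
  obtain ⟨g, hg, he⟩ := eq_quotient_th1 (m := 0) hτ hy (by rwa [zero_add]) (fun q => by simp [hT0])
  have := he x
  rw [hg.eq_zero hτ hs, zero_mul, sub_eq_zero] at this
  exact this

end IsThetaFun

end EightVertex

end

noncomputable section

namespace EightVertex

namespace Chain

variable {N : ℕ} (c : Chain N)

/-! ### The interpolation nodes -/

theorem zeta_false (h : Fin N → Fin 2) (n : Fin N) : c.zeta h n false = -c.zeta h n true := by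
  simp [zeta]

theorem diff_eq (hω : 0 < c.ω.im) (x y : ℂ) :
    c.diff x y = c.θ (x + y) * c.θ (x - y) * th3 0 c.ω ^ 2 := th4_th2_difference hω x y

theorem th4_mul_th1_eq (hω : 0 < c.ω.im) (x : ℂ) :
    th4 x (2 * c.ω) * th1 x (2 * c.ω) = th2 0 c.ω / 2 * c.θ x := by
  have := th1_mul_th4_same hω x
  rw [θ]
  linear_combination this / 2

theorem ah_mul_ah_neg_eq_prod (h : Fin N → Fin 2) (x : ℂ) :
    c.ah h x * c.ah h (-x) = (-1) ^ N * ∏ p : Fin N × Bool, c.θ (x - c.zeta h p.1 p.2) := by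
  rw [Fintype.prod_prod_type]
  have hN : ((-1 : ℂ)) ^ N = ∏ _n : Fin N, (-1 : ℂ) := by simp
  rw [hN, ah, ah, ← Finset.prod_mul_distrib, ← Finset.prod_mul_distrib]
  refine Finset.prod_congr rfl fun n _ => ?_
  have e : c.zeta h n true = c.ξ n + (((h n : ℕ) : ℂ) - 1 / 2) * c.η := by simp [zeta]
  rw [Fintype.prod_bool, zeta_false, e, sub_neg_eq_add, ← sub_sub,
    show -x - c.ξ n - (((h n : ℕ) : ℂ) - 1 / 2) * c.η =
      -(x + (c.ξ n + (((h n : ℕ) : ℂ) - 1 / 2) * c.η)) by ring, θ_neg]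
  ring

/-- The condition that the boundary nodes are not separated points. -/
def OffNodes : Prop := ∀ n, c.θ (2 * c.ξ n) ≠ 0 ∧ c.θ (2 * c.ξ n - 2 * c.η) ≠ 0 ∧
  c.θ (2 * c.ξ n + 2 * c.η) ≠ 0

theorem θ_ne_zero_of_neg {z w : ℂ} (e : w = -z) (hz : c.θ z ≠ 0) : c.θ w ≠ 0 := by
  rw [e, θ_neg]; exact neg_ne_zero.2 hz

/-- The argument is ±2ξ_n, 2ξ_n - 2η or -(2ξ_n + 2η), according to h_n and the sign. -/
theorem θ_two_zeta_sub_ne_zero (hc : c.OffNodes) (h : Fin N → Fin 2) (n : Fin N) (s : Bool) :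
    c.θ (2 * c.zeta h n s - c.η) ≠ 0 := by
  obtain ⟨h1, h2, h3⟩ := hc n
  have hcases : h n = 0 ∨ h n = 1 := by omega
  rcases hcases with h0 | h0 <;> cases s
  · exact c.θ_ne_zero_of_neg (by simp [zeta, h0]; ring) h1
  · rwa [show 2 * c.zeta h n true - c.η = 2 * c.ξ n - 2 * c.η by simp [zeta, h0]; ring]
  · exact c.θ_ne_zero_of_neg (by simp [zeta, h0]; ring) h3
  · rwa [show 2 * c.zeta h n true - c.η = 2 * c.ξ n by simp [zeta, h0]; ring]

theorem θ_zeta_add_ne_zero (hc : c.Generic) (h : Fin N → Fin 2) (n m : Fin N) :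
    c.θ (c.zeta h n true + c.zeta h m true) ≠ 0 := by
  have hn : h n = 0 ∨ h n = 1 := by omega
  have hm : h m = 0 ∨ h m = 1 := by omega
  rcases hn with hn | hn <;> rcases hm with hm | hm
  · convert hc.add_sub n m using 2; simp [zeta, hn, hm]; ring
  · convert hc.add n m using 2; simp [zeta, hn, hm]; ring
  · convert hc.add n m using 2; simp [zeta, hn, hm]; ring
  · convert hc.add_add n m using 2; simp [zeta, hn, hm]; ring

theorem θ_zeta_sub_ne_zero (hc : c.Generic) (h : Fin N → Fin 2) {n m : Fin N} (hnm : n ≠ m) :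
    c.θ (c.zeta h n true - c.zeta h m true) ≠ 0 := by
  have hn : h n = 0 ∨ h n = 1 := by omega
  have hm : h m = 0 ∨ h m = 1 := by omega
  rcases hn with hn | hn <;> rcases hm with hm | hm
  · convert hc.sub hnm using 2; simp [zeta, hn, hm]
  · exact c.θ_ne_zero_of_neg (by simp [zeta, hn, hm]; ring) (hc.sub_add hnm.symm)
  · convert hc.sub_add hnm using 2; simp [zeta, hn, hm]; ring
  · convert hc.sub hnm using 2; simp [zeta, hn, hm]

theorem zeta_distinct (hc : c.Generic) (h : Fin N → Fin 2) (p q : Fin N × Bool) (hpq : p ≠ q) :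
    th1 (c.zeta h p.1 p.2 - c.zeta h q.1 q.2) c.ω ≠ 0 := by
  change c.θ _ ≠ 0
  obtain ⟨n, s⟩ := p
  obtain ⟨m, t⟩ := q
  have hs : ∀ s' : Bool, (n, s') ≠ (m, s') → n ≠ m := fun s' h e => h (by rw [e])
  cases s <;> cases t <;> simp only [zeta_false]
  · exact c.θ_ne_zero_of_neg (by ring) (c.θ_zeta_sub_ne_zero hc h (hs _ hpq))
  · exact c.θ_ne_zero_of_neg (by ring) (c.θ_zeta_add_ne_zero hc h n m)
  · rw [sub_neg_eq_add]; exact c.θ_zeta_add_ne_zero hc h n m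
  · exact c.θ_zeta_sub_ne_zero hc h (hs _ hpq)

theorem diff_zeta_ne_zero (hω : 0 < c.ω.im) (hc : c.Generic) (h : Fin N → Fin 2) {n m : Fin N}
    (hnm : n ≠ m) (s : Bool) : c.diff (c.zeta h n s) (c.zeta h m true) ≠ 0 := by
  rw [c.diff_eq hω]
  have h3 := pow_ne_zero 2 (th3_zero_ne_zero hω)
  refine mul_ne_zero (mul_ne_zero ?_ ?_) h3 <;> cases s <;> try rw [zeta_false]
  · exact c.θ_ne_zero_of_neg (by ring) (c.θ_zeta_sub_ne_zero hc h hnm)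
  · exact c.θ_zeta_add_ne_zero hc h n m
  · exact c.θ_ne_zero_of_neg (by ring) (c.θ_zeta_add_ne_zero hc h n m)
  · exact c.θ_zeta_sub_ne_zero hc h hnm

/-- The half lattice coordinates of the boundary nodes. -/
def nodePi : Fin 8 → ℤ := ![0, -1, 0, -1, 0, -1, 0, -1]

def nodePeriod : Fin 8 → ℤ := ![0, 0, -1, -1, 2, 2, 1, 1]

theorem node_eq (p : Fin 8) : c.node p =
    c.η / 2 + (nodePi p * Real.pi + nodePeriod p * (Real.pi * c.ω)) / 2 := by
  fin_cases p <;> simp [node, nodePi, nodePeriod] <;> ring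

theorem sum_node : ∑ p, c.node p = 4 * c.η - 2 * Real.pi + 2 * (Real.pi * c.ω) := by
  simp only [Fin.sum_univ_eight, node_eq, nodePi, nodePeriod]
  simp
  ring

theorem lattice_coords (hω : 0 < c.ω.im) {j k : ℤ} (h : (j * Real.pi + k * (Real.pi * c.ω) : ℂ) = 0) :
    j = 0 ∧ k = 0 := by
  have hπ := Real.pi_ne_zero
  have hk : (k : ℝ) = 0 := by
    have := congrArg Complex.im h
    simpa [hπ, hω.ne'] using this
  have hk' : k = 0 := by exact_mod_cast hk
  subst hk'
  have := congrArg Complex.re h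
  simp [hπ] at this
  exact ⟨this, rfl⟩

/-- The node coordinates count half units of π and of πω, while the lattice has periods π and 2πω;
congruences modulo 2 and modulo 4 decide the question. -/
theorem node_distinct (hω : 0 < c.ω.im) (p q : Fin 8) (hpq : p ≠ q) :
    th1 (c.node p - c.node q) (2 * c.ω) ≠ 0 := by
  intro h0
  obtain ⟨j, k, e⟩ := (th1_eq_zero_iff (two_im_pos hω)).1 h0
  rw [node_eq, node_eq] at e
  obtain ⟨h1, h2⟩ := c.lattice_coords hω (j := nodePi p - nodePi q - 2 * j)
    (k := nodePeriod p - nodePeriod q - 4 * k) (by push_cast; linear_combination 2 * e)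
  have h1' : (nodePi p - nodePi q) % 2 = 0 := by omega
  have h2' : (nodePeriod p - nodePeriod q) % 4 = 0 := by omega
  clear h0 e h1 h2
  revert p q
  decide

theorem θ_two_node_sub (hω : 0 < c.ω.im) (p : Fin 8) : c.θ (2 * c.node p - c.η) = 0 :=
  (th1_eq_zero_iff hω).2 ⟨nodePi p, nodePeriod p, by rw [node_eq]; ring⟩

theorem θ_node_sub_zeta_ne_zero (hω : 0 < c.ω.im) (hc : c.OffNodes) (h : Fin N → Fin 2) (p : Fin 8)
    (n : Fin N) (s : Bool) : c.θ (c.node p - c.zeta h n s) ≠ 0 := by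
  intro h0
  refine c.θ_two_zeta_sub_ne_zero hc h n s ?_
  obtain ⟨j, k, e⟩ := (th1_eq_zero_iff hω).1 h0
  refine (th1_eq_zero_iff hω).2 ⟨nodePi p - 2 * j, nodePeriod p - 2 * k, ?_⟩
  rw [node_eq] at e
  push_cast
  linear_combination -2 * e

/-! ### The coefficients as theta functions -/

theorem isThetaFun_θ_two_mul (hω : 0 < c.ω.im) :
    IsThetaFun c.ω 4 (2 * c.η) fun x => c.θ (2 * x - c.η) where
  entire := th1_comp hω (by fun_prop)
  add_pi x := by
    rw [θ, show 2 * (x + Real.pi) - c.η = 2 * x - c.η + Real.pi + Real.pi by ring, th1_add_pi,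
      th1_add_pi, θ]
    ring
  add_period x := by
    rw [θ, show 2 * (x + Real.pi * c.ω) - c.η = 2 * x - c.η + Real.pi * c.ω + Real.pi * c.ω by ring,
      th1_add_period, th1_add_period, θ, (show Even 4 by decide).neg_pow]
    have : perMult (2 * x - c.η + Real.pi * c.ω) c.ω * perMult (2 * x - c.η) c.ω =
        perMult x c.ω ^ 4 * Complex.exp (2 * Complex.I * (2 * c.η)) := by
      simp only [perMult, ← Complex.exp_nat_mul, ← Complex.exp_add]
      congr 1; push_cast; ring
    linear_combination th1 (2 * x - c.η) c.ω * this

theorem isThetaFun_diff (hω : 0 < c.ω.im) (y : ℂ) : IsThetaFun c.ω 2 0 fun x => c.diff x y := by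
  have := ((IsThetaFun.th1_sub hω (-y)).mul (IsThetaFun.th1_sub hω y)).mul_const (th3 0 c.ω ^ 2)
  simp only [sub_neg_eq_add, neg_add_cancel] at this
  simpa only [c.diff_eq hω, θ] using this

/-- The node z drops out of the characteristic because the two linear theta factors contribute bη +
z and -z. Order and characteristic agree with those of 𝒜. -/
theorem isThetaFun_coeff (hω : 0 < c.ω.im) (ρ₁ ρ₂ : ℂ → ℂ) (b : ℂ) (h : Fin N → Fin 2) (n : Fin N)
    (s : Bool) : IsThetaFun c.ω (2 * N + 4) ((b + 2) * c.η) fun x => c.coeff ρ₁ ρ₂ b h x n s := by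
  set z := c.zeta h n s with hz
  have h1 := (IsThetaFun.th1_sub hω (b * c.η + z)).mul (IsThetaFun.th1_sub hω (-z))
  have h2 := IsThetaFun.prod (S := Finset.univ.erase n) fun m _ =>
    (c.isThetaFun_diff hω (c.zeta h m true)).mul_const (c.diff z (c.zeta h m true))⁻¹
  have h3 := (((c.isThetaFun_θ_two_mul hω).mul h1).mul h2).mul_const (-(th2 0 c.ω / 2) /
    (th4 (2 * z - c.η) (2 * c.ω) * th1 (2 * z - c.η) (2 * c.ω) * c.θ (b * c.η)) / c.θ (2 * z) *
      c.As ρ₁ ρ₂ z)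
  simp only [Finset.sum_const, Finset.card_erase_of_mem (Finset.mem_univ n), Finset.card_univ,
    Fintype.card_fin, smul_eq_mul, smul_zero, add_zero] at h3
  -- The truncated N - 1 is harmless because the site n witnesses N > 0.
  have hN : 4 + (1 + 1) + (N - 1) * 2 = 2 * N + 4 := by have := n.pos; omega
  rw [hN, show 2 * c.η + (b * c.η + z + -z) = (b + 2) * c.η by ring] at h3
  convert h3 using 2 with x
  have e1 : c.θ (b * c.η + z - x) = -th1 (x - (b * c.η + z)) c.ω := by
    rw [← th1_neg, θ]; congr 1; ring
  rw [coeff]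
  simp only [← hz]
  rw [c.th4_mul_th1_eq hω (2 * x - c.η), e1, show c.θ (x + z) = th1 (x - -z) c.ω by
    rw [sub_neg_eq_add]; rfl]
  simp only [div_eq_mul_inv]
  ring

theorem coeff_node (hω : 0 < c.ω.im) (ρ₁ ρ₂ : ℂ → ℂ) (b : ℂ) (h : Fin N → Fin 2) (p : Fin 8)
    (n : Fin N) (s : Bool) : c.coeff ρ₁ ρ₂ b h (c.node p) n s = 0 := by
  rw [coeff, c.th4_mul_th1_eq hω (2 * c.node p - c.η), c.θ_two_node_sub hω]
  simp

theorem diff_self (hω : 0 < c.ω.im) (h : Fin N → Fin 2) (n : Fin N) (s : Bool) :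
    c.diff (c.zeta h n s) (c.zeta h n true) = 0 := by
  rw [c.diff_eq hω]
  cases s <;> simp [zeta_false, θ_zero]

/-- At another site's point the product over `diff` vanishes; at the reflected point of the same
site the factor θ(x + z) does. At the node itself every ratio is 1. -/
theorem coeff_zeta (hω : 0 < c.ω.im) (hc : c.Generic) (hc' : c.OffNodes) (ρ₁ ρ₂ : ℂ → ℂ) {b : ℂ}
    (hb : c.θ (b * c.η) ≠ 0) (h : Fin N → Fin 2) (n m : Fin N) (s t : Bool) :
    c.coeff ρ₁ ρ₂ b h (c.zeta h m t) n s =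
      if m = n ∧ t = s then c.As ρ₁ ρ₂ (c.zeta h n s) else 0 := by
  have h2 : ∀ n s, c.θ (2 * c.zeta h n s) ≠ 0 := fun n s => by
    have := c.θ_zeta_add_ne_zero hc h n n
    rw [← two_mul] at this
    cases s
    · exact c.θ_ne_zero_of_neg (by rw [zeta_false]; ring) this
    · exact this
  rw [coeff]
  split_ifs with hmn
  · obtain ⟨rfl, rfl⟩ := hmn
    have h4 : th4 (2 * c.zeta h m t - c.η) (2 * c.ω) * th1 (2 * c.zeta h m t - c.η) (2 * c.ω) ≠ 0 := by
      rw [c.th4_mul_th1_eq hω]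
      exact mul_ne_zero (div_ne_zero (th2_zero_ne_zero hω) two_ne_zero)
        (c.θ_two_zeta_sub_ne_zero hc' h m t)
    rw [Finset.prod_eq_one fun k hk => div_self
      (c.diff_zeta_ne_zero hω hc h (Finset.ne_of_mem_erase hk).symm t), add_sub_cancel_right,
      div_self (mul_ne_zero h4 hb), ← two_mul, div_self (h2 m t)]
    ring
  · by_cases e : m = n
    · subst e
      have hts : t ≠ s := fun e => hmn ⟨rfl, e⟩
      have : c.zeta h m t + c.zeta h m s = 0 := by
        cases s <;> cases t
        · exact absurd rfl hts
        · rw [zeta_false, add_neg_cancel]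
        · rw [zeta_false, neg_add_cancel]
        · exact absurd rfl hts
      rw [this, θ_zero]
      simp
    · rw [Finset.prod_eq_zero (Finset.mem_erase.2 ⟨e, Finset.mem_univ m⟩) (by
        rw [c.diff_self hω, zero_div])]
      simp

/-! ### Interpolation of `𝒜` -/

theorem isThetaFun_A (hω : 0 < c.ω.im) (v : (Fin N → Fin 2) → ℂ) (b : ℂ) (k : Fin N → Fin 2) :
    IsThetaFun c.ω (2 * N + 4) ((b + 2) * c.η) fun x => (v ᵥ* c.A x (b + 2)) k := by
  have hE := c.isEllipticPolynomial_A hω (b + 2)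
  have hm : Even (2 * N + 4) := ⟨N + 2, by ring⟩
  simp only [vecMul, dotProduct]
  refine IsThetaFun.sum fun j _ => IsThetaFun.const_mul ⟨hE.1 j k, fun x => ?_, fun x => ?_⟩ (v j)
  · rw [hE.2.1 x, (show Even (4 * N + 8) from ⟨2 * N + 4, by ring⟩).neg_one_pow, hm.neg_one_pow]
    simp
  · have e : x + Real.pi * c.ω - c.η / 2 = x - c.η / 2 + Real.pi * (2 * c.ω) / 2 := by ring
    beta_reduce
    rw [A_eq_gauged, A_eq_gauged, e, gauged_add_half_period, smul_comm, Matrix.smul_apply,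
      smul_eq_mul, hm.neg_pow, length_sites]
    congr 1
    simp only [perMult, halfMult, gl, gr, ← Complex.exp_nat_mul, ← Complex.exp_add]
    congr 1; push_cast; ring

theorem state_vecMul_A_eq (hω : 0 < c.ω.im) (hc : c.Generic) (hc' : c.OffNodes) {ρ₁ ρ₂ : ℂ → ℂ}
    (hρ : c.IsRoots ρ₁ ρ₂) (nf : ℂ → ℂ) {b : ℂ} (hb : c.Good b)
    (h4 : ∀ n, th4 (2 * c.ξ n) (2 * c.ω) ≠ 0) (hA : ∀ n, c.As ρ₁ ρ₂ (c.η / 2 - c.ξ n) ≠ 0)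
    (hb' : th1 (2 * b * c.η) (2 * c.ω) ≠ 0) (h : Fin N → Fin 2) (x : ℂ) :
    c.state ρ₁ ρ₂ nf b h ᵥ* c.A x (b + 2) = c.zeroPart (c.state ρ₁ ρ₂ nf b h) b h x +
      ∑ n, ∑ s, c.coeff ρ₁ ρ₂ b h x n s • shifted (c.state ρ₁ ρ₂ nf b) h n s := by
  set v := c.state ρ₁ ρ₂ nf b h with hv
  set w := fun n s => shifted (c.state ρ₁ ρ₂ nf b) h n s with hw
  ext k
  have hF := (c.isThetaFun_A hω v b k).sub (IsThetaFun.sum (S := Finset.univ)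
    fun n _ => IsThetaFun.sum (S := Finset.univ)
      fun s _ => (c.isThetaFun_coeff hω ρ₁ ρ₂ b h n s).mul_const (w n s k))
  -- Dividing out the 2N separated points leaves order 4. They come in opposite pairs and sum to
  -- zero, so the characteristic is unchanged.
  rw [show 2 * N + 4 = 4 + Fintype.card (Fin N × Bool) by simp; ring] at hF
  obtain ⟨g, hg, he⟩ := IsThetaFun.eq_quotient_th1 hω (c.zeta_distinct hc h) hF fun p => by
    simp only [hv, c.state_vecMul_A hω hc hρ nf hb h4 hA, c.coeff_zeta hω hc hc' ρ₁ ρ₂ hb.ne_zero,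
      ite_mul, zero_mul, ite_and]
    simp [hw]
  have hsum : ∑ p : Fin N × Bool, c.zeta h p.1 p.2 = 0 := by
    rw [Fintype.sum_prod_type]
    exact Finset.sum_eq_zero fun n _ => by simp [zeta_false]
  rw [hsum, sub_zero] at hg
  -- The nodes sum to 4η up to periods, so this argument is 2bη up to the lattice of π and 2πω.
  have hs : th1 (2 * ((b + 2) * c.η) - ∑ p, c.node p) (2 * c.ω) ≠ 0 := by
    intro h0
    obtain ⟨j, l, e⟩ := (th1_eq_zero_iff (two_im_pos hω)).1 h0
    refine hb' ((th1_eq_zero_iff (two_im_pos hω)).2 ⟨j - 2, l + 1, ?_⟩)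
    rw [sum_node] at e
    push_cast
    linear_combination e
  -- Order 4 for πω is order 8 for 2πω, which matches the eight nodes and the modulus 2ω of the
  -- interpolation formula.
  have hL := (hg.double (by decide)).lagrange (ι := Fin 8) (two_im_pos hω) (c.node_distinct hω) hs x
  have hnode : ∀ p, (v ᵥ* c.A (c.node p) (b + 2)) k =
      g (c.node p) * ∏ q : Fin N × Bool, c.θ (c.node p - c.zeta h q.1 q.2) := fun p => by
    have := he (c.node p)
    simp only [c.coeff_node hω, zero_mul, Finset.sum_const_zero, sub_zero] at this
    exact this
  have hx := he x
  rw [sub_eq_iff_eq_add] at hx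
  simp only [Pi.add_apply, Finset.sum_apply, Pi.smul_apply, smul_eq_mul]
  rw [hx]
  congr 1
  rw [hL, zeroPart, Finset.sum_apply, Finset.sum_mul]
  refine Finset.sum_congr rfl fun p _ => ?_
  rw [Pi.smul_apply, smul_eq_mul, hnode, ah_mul_ah_neg_eq_prod, ah_mul_ah_neg_eq_prod,
    mul_div_mul_left _ _ (pow_ne_zero N (neg_ne_zero.2 (one_ne_zero (α := ℂ)))),
    ← mul_assoc 2 (b + 2) c.η]
  have hP : ∏ q : Fin N × Bool, c.θ (c.node p - c.zeta h q.1 q.2) ≠ 0 :=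
    Finset.prod_ne_zero_iff.2 fun q _ => c.θ_node_sub_zeta_ne_zero hω hc' h p q.1 q.2
  change _ * ∏ q : Fin N × Bool, c.θ (x - c.zeta h q.1 q.2) = _
  generalize ∏ q : Fin N × Bool, c.θ (c.node p - c.zeta h q.1 q.2) = P at *
  rw [show ∀ a d e f : ℂ, a * (d / P) * e * (f * P) = a * (d * (P / P)) * e * f by intros; ring,
    div_self hP]
  ring

end Chain

end EightVertex

end

noncomputable section

namespace EightVertex

namespace Chain

variable {N : ℕ} (c : Chain N)

/-! ### Consequences of the genericity assumptions -/

theorem θ_ne_zero_iff (hω : 0 < c.ω.im) {z : ℂ} : c.θ z ≠ 0 ↔ ¬ c.InLattice z :=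
  not_congr (th1_eq_zero_iff hω)

theorem good_of_not_inLattice (hω : 0 < c.ω.im) {b : ℂ} (hb : ∀ k : ℤ, ¬ c.InLattice ((b + k) * c.η)) :
    c.Good b := fun k => (c.θ_ne_zero_iff hω).2 (hb k)

theorem generic_of_not_inLattice (hω : 0 < c.ω.im)
    (hξ : ∀ a b : Fin N, a ≠ b → ∀ r ∈ ({-1, 0, 1} : Set ℤ), ¬ c.InLattice (c.ξ a - c.ξ b - r * c.η))
    (hξ' : ∀ a b : Fin N, ∀ r ∈ ({-1, 0, 1} : Set ℤ), ¬ c.InLattice (c.ξ a + c.ξ b - r * c.η)) :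
    c.Generic where
  sub {a b} hab := (c.θ_ne_zero_iff hω).2 (by simpa using hξ a b hab 0 (by simp))
  sub_add {a b} hab := (c.θ_ne_zero_iff hω).2 (by simpa using hξ a b hab (-1) (by simp))
  add a b := (c.θ_ne_zero_iff hω).2 (by simpa using hξ' a b 0 (by simp))
  add_add a b := (c.θ_ne_zero_iff hω).2 (by simpa using hξ' a b (-1) (by simp))
  add_sub a b := (c.θ_ne_zero_iff hω).2 (by simpa using hξ' a b 1 (by simp))

theorem offNodes_of_not_inLattice (hω : 0 < c.ω.im) (hc : c.Generic)
    (hξ : ∀ a : Fin N, ¬ c.InLattice (2 * c.ξ a - 2 * c.η) ∧ ¬ c.InLattice (2 * c.ξ a + 2 * c.η)) :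
    c.OffNodes := fun n => ⟨by rw [two_mul]; exact hc.add n n, (c.θ_ne_zero_iff hω).2 (hξ n).1,
      (c.θ_ne_zero_iff hω).2 (hξ n).2⟩

/-- The first two are the factors of r at η/2 + ξ_n; θ(η) is the n-th factor of a at the same point.
-/
theorem factors_ne_zero {ρ₁ ρ₂ : ℂ → ℂ} {n : Fin N} (h : c.As ρ₁ ρ₂ (c.η / 2 + c.ξ n) ≠ 0) :
    th4 (2 * c.ξ n) (2 * c.ω) ≠ 0 ∧ c.θ (c.ξ n + (c.α + 1) * c.η) ≠ 0 ∧ c.θ c.η ≠ 0 := by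
  rw [As, r] at h
  obtain ⟨h1, -⟩ := mul_ne_zero_iff.1 h
  obtain ⟨h2, h3⟩ := mul_ne_zero_iff.1 h1
  obtain ⟨h4, -⟩ := mul_ne_zero_iff.1 h2
  obtain ⟨h5, h6⟩ := mul_ne_zero_iff.1 h4
  refine ⟨by convert h5 using 2; ring, by convert h6 using 2; ring, ?_⟩
  have := Finset.prod_ne_zero_iff.1 h3 n (Finset.mem_univ n)
  convert this using 2; ring

/-- An operator with prescribed values on a basis of covectors. -/
theorem exists_vecMul_eq {v : (Fin N → Fin 2) → (Fin N → Fin 2) → ℂ} (hv : LinearIndependent ℂ v)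
    (w : (Fin N → Fin 2) → (Fin N → Fin 2) → ℂ) : ∃ X : Op N, ∀ h, v h ᵥ* X = w h := by
  have hu : IsUnit (Matrix.of v) := Matrix.linearIndependent_rows_iff_isUnit.1 hv
  obtain ⟨u, hu⟩ := hu
  refine ⟨(↑u⁻¹ : Op N) * Matrix.of w, fun h => ?_⟩
  have : Matrix.of v * ((↑u⁻¹ : Op N) * Matrix.of w) = Matrix.of w := by
    rw [← mul_assoc, ← hu, Units.mul_inv, one_mul]
  exact congrFun this h

end Chain

end EightVertex

end

/-! ### The separated basis and the actions of ℬ and 𝒜 on it. -/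

theorem mainTheorem3 {N : ℕ} (c : EightVertex.Chain N) (β : ℂ) (ρ₁ ρ₂ nf : ℂ → ℂ)
    (hω : 0 < c.ω.im) (hζ : EightVertex.th1 c.ζ (2 * c.ω) ≠ 0) (hρ : c.IsRoots ρ₁ ρ₂)
    (hnf : nf β ≠ 0) (hnf' : nf (β + 2) ≠ 0)
    (hβ : ∀ k : ℤ, ¬ c.InLattice ((β + k) * c.η))
    (hβ' : EightVertex.th1 (2 * β * c.η) (2 * c.ω) ≠ 0)
    (hξ : ∀ a b : Fin N, a ≠ b → ∀ r ∈ ({-1, 0, 1} : Set ℤ),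
      ¬ c.InLattice (c.ξ a - c.ξ b - r * c.η))
    (hξ' : ∀ a b : Fin N, ∀ r ∈ ({-1, 0, 1} : Set ℤ), ¬ c.InLattice (c.ξ a + c.ξ b - r * c.η))
    (hξ'' : ∀ a : Fin N, ¬ c.InLattice (2 * c.ξ a - 2 * c.η) ∧ ¬ c.InLattice (2 * c.ξ a + 2 * c.η))
    (hA : ∀ a : Fin N, c.As ρ₁ ρ₂ (c.η / 2 - c.ξ a) ≠ 0 ∧ c.As ρ₁ ρ₂ (c.η / 2 + c.ξ a) ≠ 0)
    (hK : ∀ k < N, ∃ x, c.rK12 x (β - 2 * k) ≠ 0) :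
    (LinearIndependent ℂ (c.state ρ₁ ρ₂ nf β) ∧
      Submodule.span ℂ (Set.range (c.state ρ₁ ρ₂ nf β)) = ⊤) ∧
    (∀ h x, Matrix.vecMul (c.state ρ₁ ρ₂ nf β h) (c.B x β) =
      c.eigB nf β h x • c.state ρ₁ ρ₂ nf (β - 2) h) ∧
    (∀ b, c.IsEllipticPolynomial (4 * N + 8) (4 * c.η) fun x => c.B x b) ∧
    (∀ b, c.IsEllipticPolynomial (4 * N + 8) (2 * b * c.η) fun x => c.A x b) ∧
    ∀ x, ∃ A₀ : EightVertex.Op N,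
      (∀ h, Matrix.vecMul (c.state ρ₁ ρ₂ nf β h) A₀ =
        c.zeroPart (c.state ρ₁ ρ₂ nf β h) β h x) ∧
      ∀ h, Matrix.vecMul (c.state ρ₁ ρ₂ nf β h) (c.A x (β + 2) - A₀) =
        ∑ n, ∑ s, c.coeff ρ₁ ρ₂ β h x n s •
          EightVertex.Chain.shifted (c.state ρ₁ ρ₂ nf β) h n s := by
  have hb := c.good_of_not_inLattice hω hβ
  have hc := c.generic_of_not_inLattice hω hξ hξ'
  have hc' := c.offNodes_of_not_inLattice hω hc hξ''
  have hf := fun n => c.factors_ne_zero (hA n).2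
  -- Nonvanishing of 𝖠_- at both points of a site makes raising that site invertible.
  have hq : ∀ n, c.θ (c.ξ n + (c.α + 1) * c.η) * c.θ (-c.ξ n + (c.α + 1) * c.η) *
      c.qdet (-c.ξ n) (EightVertex.Chain.sites N) ≠ 0 := fun n => by
    have h := c.qdet_eq hρ (x := -c.ξ n) (by rw [mul_neg, EightVertex.th4_neg]; exact (hf n).1)
    rw [neg_neg, mul_comm (c.θ (-c.ξ n + _)), sub_neg_eq_add, ← sub_eq_add_neg] at h
    rw [h]
    exact mul_ne_zero (hA n).1 (hA n).2
  -- The N successive applications of ℬ in the independence proof act at β, β - 2, …, β - 2(N-1),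
  -- which fixes the range of j.
  have hk : ∀ j < N, ∃ x, c.bdry (β - 2 * j) x ≠ 0 := fun j hj => by
    obtain ⟨x, hx⟩ := hK j hj
    rw [c.rK12_eq_refFactor] at hx
    exact ⟨x - c.η / 2, right_ne_zero_of_mul hx⟩
  have hn : ∀ h, c.stateNorm ρ₁ ρ₂ nf β h ≠ 0 := fun h =>
    mul_ne_zero (mul_ne_zero (inv_ne_zero hnf') (mul_ne_zero (pow_ne_zero _ two_ne_zero)
      (Finset.prod_ne_zero_iff.2 fun n _ => inv_ne_zero (hf n).2.1)))
      (Finset.prod_ne_zero_iff.2 fun n _ => pow_ne_zero _ (inv_ne_zero (hA n).1))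
  have hli := c.state_linearIndependent hω hc (fun n => (hf n).2.2) ρ₁ ρ₂ nf hb hk hq hn
  refine ⟨⟨hli, hli.span_eq_top_of_card_eq_finrank' (by simp)⟩,
    fun h x => c.state_vecMul_B hω ρ₁ ρ₂ nf hb hnf h x, c.isEllipticPolynomial_B hω,
    c.isEllipticPolynomial_A hω, fun x => ?_⟩
  obtain ⟨A₀, hA₀⟩ := EightVertex.Chain.exists_vecMul_eq hli
    fun h => c.zeroPart (c.state ρ₁ ρ₂ nf β h) β h x
  refine ⟨A₀, hA₀, fun h => ?_⟩
  rw [Matrix.vecMul_sub, hA₀, c.state_vecMul_A_eq hω hc hc' hρ nf hb (fun n => (hf n).1)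
    (fun n => (hA n).1) hβ' h x, add_sub_cancel_left]
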